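/- An $N\times N$ complex matrix $H$ is a complex Hadamard matrix, $H\in\mathbb{H}(N)$, if all its entries have modulus $1$ and $HH^\dagger=N\mathbb{I}_N$. It is of Butson type if, for some integer $q\ge 1$, all its entries are $q$-th roots of unity. Two matrices are equivalent, $H_1\simeq H_2$, if $H_1=D_1P_1H_2P_2D_2$ with $D_1,D_2$ diagonal unitary and $P_1,P_2$ permutation matrices. $H\in\mathbb{H}(N)$ is isolated if it has a neighbourhood in $\mathbb{C}^{N\times N}$ in which all complex Hadamard matrices are equivalent to $H$. The defect of $H$ is $$\mathbf{d}(H)=\dim_{\mathbb R}\Big\{R\in\mathbb{R}^{N\times N}:\ \sum_{k}H_{jk}\overline{H_{lk}}\,(R_{jk}-R_{lk})=0\ \text{ for all } j,l\Big\}-(2N-1),$$ and the Haagerup set is $\Lambda(H)=\{H_{jk}H_{lm}\overline{H_{jm}}\,\overline{H_{lk}}: 1\le j,k,l,m\le N\}$. For unimodular complex numbers $a,b,c,d$ put $e=abcd$, $f=-a(2+b)-2(1+d+cd)/d$ and $$Y_{10A}=\begin{bmatrix} 1&1&1&1&1&1&1&1&1&1\\ 1&f&\frac1d&\frac1d&a&a&ba&c&c&1\\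 1&\frac1d&\frac1{ad^2}&\frac1{d^2}&\frac1d&a&\frac{e}{c^2d^2}&\frac{c^2}{e}&\frac cd&\frac1{cd}\\ 1&\frac1d&\frac1{d^2}&\frac1{cd^2}&\frac a{cd}&\frac{ac}e&\frac bd&c&\frac{bc^2}e&\frac1d\\ 1&a&\frac1d&\frac a{cd}&\frac{ae}{bc}&a^2&a^2b&a&\frac eb&\frac1b\\ 1&a&a&\frac{ac}e&a^2&\frac{a^2}c&\frac{ae}c&ac&c&\frac ac\\ 1&ba&\frac e{c^2d^2}&\frac bd&a^2b&\frac{ae}c&\frac{e^2}{c^2d^2}&e&ba&b\\ 1&c&\frac{c^2}e&c&a&ac&e&\frac{c^2}a&c^2&\frac ca\\ 1&c&\frac cd&\frac{bc^2}e&\frac eb&c&ba&c^2&\frac{c^3d}e&cd\\ 1&1&\frac1{cd}&\frac1d&\frac1b&\frac ac&b&\frac ca&cd&d \end{bmatrix}.$$ Consider the system $$\begin{aligned} &1+a+cd/b+ad(2+1/c+c+d)+a^2d(b+cd)/c=0,\\ &2+1/b+b+a/c+c/a+1/d+1/(cd)+d+cd=0,\\ &a^2bcd(1+b+d)+c(b+d+bd)+ab(1+cd)^2=0,\\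 &c+bd\big((1+a)(1+c)(a+c)+a^2bcd\big)=0. \end{aligned}$$ The system has a solution $(a,b,c,d)$ with $|a|=|b|=|c|=|d|=1$. For every such unimodular solution, $Y_{10A}$ is a symmetric complex Hadamard matrix of order $10$, has defect $\mathbf{d}(Y_{10A})=0$, is isolated, is not of Butson type (for any $q\ge1$), and satisfies $\#\Lambda(Y_{10A})=99$. Its equivalence class is different from that of every $K\in\mathbb{H}(10)$ which is of Butson type, or is not isolated, or has nonzero defect, or has $\#\Lambda(K)\ne 99$. (In particular $Y_{10A}$ is not equivalent to any matrix in $\mathrm{B}\mathbb{H}(10,6)$ or to any $K\in\mathbb{H}(10)$ with $\#\Lambda(K)=9$; these are the data of the isolated matrices $B_{10}^{(0)}$ and $N_{10A}^{(0)}$ listed as previously known.) -/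

import Mathlib

open scoped Topology Matrix

/-- A complex Hadamard matrix of order `N`: all entries are unimodular and `H Hᴴ = N I`. -/
def IsComplexHadamard {N : ℕ} (H : Matrix (Fin N) (Fin N) ℂ) : Prop :=
  (∀ j k, ‖H j k‖ = 1) ∧ H * Hᴴ = (N : ℂ) • (1 : Matrix (Fin N) (Fin N) ℂ)

/-- Membership in `BH(N, q)`: a complex Hadamard matrix all of whose entries are `q`-th roots of
unity. -/
def IsButson {N : ℕ} (q : ℕ) (H : Matrix (Fin N) (Fin N) ℂ) : Prop :=
  IsComplexHadamard H ∧ ∀ j k, H j k ^ q = 1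

/-- Equivalence of matrices: `H₁ = D₁ P₁ H₂ P₂ D₂` with `D₁, D₂` diagonal unitary and `P₁, P₂`
permutation matrices. -/
def HadamardEquiv {N : ℕ} (H₁ H₂ : Matrix (Fin N) (Fin N) ℂ) : Prop :=
  ∃ (u v : Fin N → ℂ) (σ τ : Equiv.Perm (Fin N)),
    (∀ j, ‖u j‖ = 1) ∧ (∀ j, ‖v j‖ = 1) ∧
      H₁ = Matrix.diagonal u * σ.permMatrix ℂ * H₂ * τ.permMatrix ℂ * Matrix.diagonal v

/-- `H` is isolated: all complex Hadamard matrices in some neighbourhood of `H` (for the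
Euclidean topology on the space of matrices) are equivalent to `H`. -/
def IsIsolatedHadamard {N : ℕ} (H : Matrix (Fin N) (Fin N) ℂ) : Prop :=
  IsComplexHadamard H ∧ ∀ᶠ K in 𝓝 H, IsComplexHadamard K → HadamardEquiv K H

/-- The real linear space of first-order phase variations `R`: those for which
`H j k * exp (i t R j k)` stays unitary (up to scaling) to first order in `t`, that is,
`∑ₖ H j k * conj (H l k) * (R j k - R l k) = 0` for all `j, l`. -/
def phaseVariations {N : ℕ} (H : Matrix (Fin N) (Fin N) ℂ) :
    Submodule ℝ (Matrix (Fin N) (Fin N) ℝ) where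
  carrier := {R | ∀ j l,
    ∑ k, H j k * (starRingEnd ℂ) (H l k) * ((R j k : ℂ) - (R l k : ℂ)) = 0}
  zero_mem' := by
    intro j l
    simp
  add_mem' := by
    intro R S hR hS j l
    have h := congrArg₂ (· + ·) (hR j l) (hS j l)
    simp only [← Finset.sum_add_distrib, add_zero] at h
    rw [← h]
    refine Finset.sum_congr rfl fun k _ => ?_
    simp only [Matrix.add_apply, Complex.ofReal_add]
    ring
  smul_mem' := by
    intro t R hR j l
    have h := congrArg (fun z => (t : ℂ) * z) (hR j l)
    simp only [Finset.mul_sum, mul_zero] at h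
    rw [← h]
    refine Finset.sum_congr rfl fun k _ => ?_
    simp only [Matrix.smul_apply, smul_eq_mul, Complex.ofReal_mul]
    ring

/-- The defect of a complex Hadamard matrix: the dimension of the space of first-order phase
variations, minus the `2 N - 1` dimensions `R j k = x j + y k` that come from multiplying rows and
columns by phases. -/
noncomputable def hadamardDefect {N : ℕ} (H : Matrix (Fin N) (Fin N) ℂ) : ℤ :=
  (Module.finrank ℝ (phaseVariations H) : ℤ) - (2 * (N : ℤ) - 1)

/-- The Haagerup set `Λ(H)`. -/
def haagerupSet {N : ℕ} (H : Matrix (Fin N) (Fin N) ℂ) : Set ℂ :=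
  {z | ∃ j k l m : Fin N,
    z = H j k * H l m * (starRingEnd ℂ) (H j m) * (starRingEnd ℂ) (H l k)}

/-- The system of four equations for `(a, b, c, d)`. -/
def Y10ASystem (a b c d : ℂ) : Prop :=
  1 + a + c * d / b + a * d * (2 + 1 / c + c + d) + a ^ 2 * d * (b + c * d) / c = 0 ∧
  2 + 1 / b + b + a / c + c / a + 1 / d + 1 / c / d + d + c * d = 0 ∧
  a ^ 2 * b * c * d * (1 + b + d) + c * (b + d + b * d) + a * b * (1 + c * d) ^ 2 = 0 ∧
  c + b * d * ((1 + a) * (1 + c) * (a + c) + a ^ 2 * b * c * d) = 0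

/-- The set of unimodular solutions `(a, b, c, d)` of the system. -/
def IsUnimodularY10ASolution (a b c d : ℂ) : Prop :=
  ‖a‖ = 1 ∧ ‖b‖ = 1 ∧ ‖c‖ = 1 ∧ ‖d‖ = 1 ∧ Y10ASystem a b c d

/-- The shape of the matrix `Y_{10A}`, with `e` and `f` as separate variables. -/
noncomputable def y10AShape (a b c d e f : ℂ) : Matrix (Fin 10) (Fin 10) ℂ :=
  !![1, 1, 1, 1, 1, 1, 1, 1, 1, 1;
     1, f, 1 / d, 1 / d, a, a, b * a, c, c, 1;
     1, 1 / d, 1 / (a * d ^ 2), 1 / d ^ 2, 1 / d, a, e / (c ^ 2 * d ^ 2), c ^ 2 / e, c / d,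
       1 / (c * d);
     1, 1 / d, 1 / d ^ 2, 1 / (c * d ^ 2), a / (c * d), a * c / e, b / d, c, b * c ^ 2 / e, 1 / d;
     1, a, 1 / d, a / (c * d), a * e / (b * c), a ^ 2, a ^ 2 * b, a, e / b, 1 / b;
     1, a, a, a * c / e, a ^ 2, a ^ 2 / c, a * e / c, a * c, c, a / c;
     1, b * a, e / (c ^ 2 * d ^ 2), b / d, a ^ 2 * b, a * e / c, e ^ 2 / (c ^ 2 * d ^ 2), e, b * a,
       b;
     1, c, c ^ 2 / e, c, a, a * c, e, c ^ 2 / a, c ^ 2, c / a;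
     1, c, c / d, b * c ^ 2 / e, e / b, c, b * a, c ^ 2, c ^ 3 * d / e, c * d;
     1, 1, 1 / (c * d), 1 / d, 1 / b, a / c, b, c / a, c * d, d]

/-- The matrix `Y_{10A}`, where `e = a b c d` and `f = -a (2 + b) - 2 (1 + d + c d) / d`. -/
noncomputable def y10A (a b c d : ℂ) : Matrix (Fin 10) (Fin 10) ℂ :=
  y10AShape a b c d (a * b * c * d) (-a * (2 + b) - 2 * (1 + d + c * d) / d)

/-! Write `a = x/y`, `b = y/v`, `c = x/z`, `d = u/x` with unimodular `x, y, z, u, v`. Up to monomial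
factors the four equations are then real, and they say that the symmetric sequence `v, y, z, u, x,
x, u, z, y` on `ℤ/9` has all nontrivial autocorrelations equal to `-1` (`IsCoreSolution`). Scaled to
have sum `-1`, such a sequence generates a circulant matrix that becomes complex Hadamard when
bordered by ones, and `Y_{10A}` is this bordered matrix with rows and columns permuted and rephased
(`hadamardEquiv_y10A`). Every invariant is therefore computed on the bordered circulant.

The solutions can be located because `x, y, z, u, v` are vectors in a plane: Gram determinants of
triples vanish, and elimination leaves one polynomial of degree nine for twice the sum `e` of the
inner products of `x, y, z` (`PlanarRelations.charpoly_eq`). Only two of its roots lie in the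
interval that geometry allows. The value of `e` determines the remaining data up to a common phase,
complex conjugation and cyclic rotation of `x, y, z`, which comes from doubling on `ℤ/9`. With
rigorous error bounds, every solution is thus, up to these symmetries, within `2 / 10 ^ 6` of one of
two explicit tables of symbols. At this accuracy two facts reduce to integer computations: an
approximate left inverse shows that the linear system for phase variations has only trivial
solutions (defect zero), and 99 monomials in the symbols are pairwise separated (`#Λ = 99`).

Isolation follows from defect zero, since a nearby dephased Hadamard matrix has phases `θ` with
`‖θ‖` bounded by a multiple of `‖θ‖ ^ 2`. For the Butson property, suppose `a, b, c, d` are roots of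
unity. Then every field embedding carries the solution to a unimodular solution, so all conjugates
of the algebraic integer `(2e + 1)(2e + 2)` are nonzero and of modulus below one, which contradicts
integrality of the norm. Existence comes from a contracting Newton-type map at a rational base
point. Inequivalence holds because all these properties are invariant under equivalence. -/

/-! ### Equivalence and its invariants -/

theorem hadamardEquiv_iff {N : ℕ} (H₁ H₂ : Matrix (Fin N) (Fin N) ℂ) :
    HadamardEquiv H₁ H₂ ↔ ∃ (u v : Fin N → ℂ) (σ τ : Equiv.Perm (Fin N)),
      (∀ j, ‖u j‖ = 1) ∧ (∀ j, ‖v j‖ = 1) ∧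
        ∀ j k, H₁ j k = u j * H₂ (σ j) (τ k) * v k := by
  have key : ∀ (u v : Fin N → ℂ) (σ τ : Equiv.Perm (Fin N)) (j k : Fin N),
      (Matrix.diagonal u * σ.permMatrix ℂ * H₂ * τ.permMatrix ℂ * Matrix.diagonal v) j k
        = u j * H₂ (σ j) (τ⁻¹ k) * v k := by
    intro u v σ τ j k
    rw [Matrix.mul_diagonal, Matrix.mul_assoc, Matrix.mul_assoc, Matrix.diagonal_mul]
    rw [Equiv.Perm.permMatrix, Equiv.Perm.permMatrix, PEquiv.toMatrix_toPEquiv_mul,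
      PEquiv.mul_toMatrix_toPEquiv]
    rfl
  constructor
  · rintro ⟨u, v, σ, τ, hu, hv, h⟩
    -- A permutation matrix on the right acts on column indices by the inverse permutation.
    refine ⟨u, v, σ, τ⁻¹, hu, hv, fun j k => ?_⟩
    rw [h, key]
  · rintro ⟨u, v, σ, τ, hu, hv, h⟩
    refine ⟨u, v, σ, τ⁻¹, hu, hv, ?_⟩
    ext j k
    rw [h, key, inv_inv]

theorem mul_conj_of_norm_one {z : ℂ} (hz : ‖z‖ = 1) : z * (starRingEnd ℂ) z = 1 := by
  rw [Complex.mul_conj, Complex.normSq_eq_norm_sq, hz]; simp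

theorem conj_mul_of_norm_one {z : ℂ} (hz : ‖z‖ = 1) : (starRingEnd ℂ) z * z = 1 := by
  rw [mul_comm, mul_conj_of_norm_one hz]

theorem isComplexHadamard_iff {N : ℕ} (H : Matrix (Fin N) (Fin N) ℂ) :
    IsComplexHadamard H ↔ (∀ j k, ‖H j k‖ = 1) ∧
      ∀ j l, ∑ k, H j k * (starRingEnd ℂ) (H l k) = if j = l then (N : ℂ) else 0 := by
  unfold IsComplexHadamard
  refine and_congr_right fun _ => ?_
  rw [← Matrix.ext_iff]
  refine forall_congr' fun j => forall_congr' fun l => ?_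
  simp [Matrix.mul_apply, Matrix.one_apply]

/-- The column phases cancel between a row and a conjugate row, and the row phases leave the sum.
The weight `g` lets one identity serve both the Gram matrix (`g = 1`) and the phase variations. -/
theorem sum_equiv_row {N : ℕ} {H₁ H₂ : Matrix (Fin N) (Fin N) ℂ} {u v : Fin N → ℂ}
    {σ τ : Equiv.Perm (Fin N)} (hv : ∀ j, ‖v j‖ = 1)
    (h : ∀ j k, H₁ j k = u j * H₂ (σ j) (τ k) * v k) (j l : Fin N) (g : Fin N → ℂ) :
    ∑ k, H₁ j k * (starRingEnd ℂ) (H₁ l k) * g k = (u j * (starRingEnd ℂ) (u l)) *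
      ∑ k, H₂ (σ j) k * (starRingEnd ℂ) (H₂ (σ l) k) * g (τ.symm k) := by
  symm
  rw [Finset.mul_sum, ← Equiv.sum_comp τ]
  refine Finset.sum_congr rfl fun k _ => ?_
  rw [h, h, Equiv.symm_apply_apply, map_mul, map_mul]
  linear_combination -(u j * (starRingEnd ℂ) (u l)) * H₂ (σ j) (τ k) *
    (starRingEnd ℂ) (H₂ (σ l) (τ k)) * g k * mul_conj_of_norm_one (hv k)

theorem HadamardEquiv.isComplexHadamard {N : ℕ} {H₁ H₂ : Matrix (Fin N) (Fin N) ℂ}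
    (h : HadamardEquiv H₁ H₂) (h₂ : IsComplexHadamard H₂) : IsComplexHadamard H₁ := by
  obtain ⟨u, v, σ, τ, hu, hv, h⟩ := (hadamardEquiv_iff _ _).1 h
  rw [isComplexHadamard_iff] at h₂ ⊢
  refine ⟨fun j k => by rw [h, norm_mul, norm_mul, hu, hv, h₂.1]; simp, fun j l => ?_⟩
  have := sum_equiv_row hv h j l (fun _ => 1)
  simp only [mul_one] at this
  rw [this, h₂.2]
  by_cases hjl : j = l
  · subst hjl
    simp [mul_conj_of_norm_one (hu j)]
  · simp [hjl]

/-- In each product, every row index and every column index occurs once plainly and once conjugated,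
so all phases cancel. -/
theorem HadamardEquiv.haagerupSet_eq {N : ℕ} {H₁ H₂ : Matrix (Fin N) (Fin N) ℂ}
    (h : HadamardEquiv H₁ H₂) : haagerupSet H₁ = haagerupSet H₂ := by
  obtain ⟨u, v, σ, τ, hu, hv, h⟩ := (hadamardEquiv_iff _ _).1 h
  have key : ∀ j k l m, H₁ j k * H₁ l m * (starRingEnd ℂ) (H₁ j m) * (starRingEnd ℂ) (H₁ l k)
      = H₂ (σ j) (τ k) * H₂ (σ l) (τ m) * (starRingEnd ℂ) (H₂ (σ j) (τ m)) *
        (starRingEnd ℂ) (H₂ (σ l) (τ k)) := by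
    intro j k l m
    simp only [h, map_mul]
    have e1 := mul_conj_of_norm_one (hu j)
    have e2 := mul_conj_of_norm_one (hu l)
    have e3 := mul_conj_of_norm_one (hv k)
    have e4 := mul_conj_of_norm_one (hv m)
    generalize (starRingEnd ℂ) (u j) = a1 at *
    generalize (starRingEnd ℂ) (u l) = a2 at *
    generalize (starRingEnd ℂ) (v k) = a3 at *
    generalize (starRingEnd ℂ) (v m) = a4 at *
    calc _ = (u j * a1) * (u l * a2) * (v k * a3) * (v m * a4) *
          (H₂ (σ j) (τ k) * H₂ (σ l) (τ m) * (starRingEnd ℂ) (H₂ (σ j) (τ m)) *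
        (starRingEnd ℂ) (H₂ (σ l) (τ k))) := by ring
      _ = _ := by rw [e1, e2, e3, e4]; ring
  ext z
  constructor
  · rintro ⟨j, k, l, m, rfl⟩
    exact ⟨σ j, τ k, σ l, τ m, key j k l m⟩
  · rintro ⟨j, k, l, m, rfl⟩
    refine ⟨σ.symm j, τ.symm k, σ.symm l, τ.symm m, ?_⟩
    rw [key]
    simp

theorem HadamardEquiv.hadamardDefect_eq {N : ℕ} {H₁ H₂ : Matrix (Fin N) (Fin N) ℂ}
    (h : HadamardEquiv H₁ H₂) : hadamardDefect H₁ = hadamardDefect H₂ := by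
  obtain ⟨u, v, σ, τ, hu, hv, h⟩ := (hadamardEquiv_iff _ _).1 h
  have hmap : phaseVariations H₁ =
      (phaseVariations H₂).map
        (Matrix.reindexLinearEquiv ℝ ℝ σ τ).symm.toLinearMap := by
    ext R
    rw [Submodule.mem_map_equiv, LinearEquiv.symm_symm]
    change (∀ j l, ∑ k, H₁ j k * (starRingEnd ℂ) (H₁ l k) * ((R j k : ℂ) - (R l k : ℂ)) = 0) ↔
      ∀ j l, ∑ k, H₂ j k * (starRingEnd ℂ) (H₂ l k) *
        ((R (σ.symm j) (τ.symm k) : ℂ) - (R (σ.symm l) (τ.symm k) : ℂ)) = 0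
    have hne : ∀ j l, u j * (starRingEnd ℂ) (u l) ≠ 0 := by
      intro j l h0
      have := congrArg norm h0
      simp [hu] at this
    constructor
    · intro hR j l
      have h1 := hR (σ.symm j) (σ.symm l)
      rw [sum_equiv_row hv h (σ.symm j) (σ.symm l)
        (fun k => (R (σ.symm j) k : ℂ) - (R (σ.symm l) k : ℂ))] at h1
      simpa using (mul_eq_zero.1 h1).resolve_left (hne _ _)
    · intro hR j l
      rw [sum_equiv_row hv h j l (fun k => (R j k : ℂ) - (R l k : ℂ))]
      have h1 := hR (σ j) (σ l)
      simp only [Equiv.symm_apply_apply] at h1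
      rw [h1, mul_zero]
  unfold hadamardDefect
  rw [hmap, LinearEquiv.finrank_map_eq]

/-- The entrywise complex conjugate of a matrix. -/
def conjMatrix {N : ℕ} (H : Matrix (Fin N) (Fin N) ℂ) : Matrix (Fin N) (Fin N) ℂ :=
  H.map (starRingEnd ℂ)

/-- Since `R` is real, the two systems are conjugates of each other. -/
theorem phaseVariations_conjMatrix {N : ℕ} (H : Matrix (Fin N) (Fin N) ℂ) :
    phaseVariations (conjMatrix H) = phaseVariations H := by
  ext R
  change (∀ j l, ∑ k, (starRingEnd ℂ) (H j k) * (starRingEnd ℂ) ((starRingEnd ℂ) (H l k)) *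
      ((R j k : ℂ) - (R l k : ℂ)) = 0) ↔
    ∀ j l, ∑ k, H j k * (starRingEnd ℂ) (H l k) * ((R j k : ℂ) - (R l k : ℂ)) = 0
  refine forall_congr' fun j => forall_congr' fun l => ?_
  rw [← map_eq_zero_iff (starRingEnd ℂ) (starRingEnd ℂ).injective, map_sum]
  simp only [map_mul, map_sub, Complex.conj_ofReal, Complex.conj_conj]

theorem hadamardDefect_conjMatrix {N : ℕ} (H : Matrix (Fin N) (Fin N) ℂ) :
    hadamardDefect (conjMatrix H) = hadamardDefect H := by
  unfold hadamardDefect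
  rw [phaseVariations_conjMatrix]

theorem haagerupSet_conjMatrix {N : ℕ} (H : Matrix (Fin N) (Fin N) ℂ) :
    haagerupSet (conjMatrix H) = (starRingEnd ℂ) '' haagerupSet H := by
  ext z
  constructor
  · rintro ⟨j, k, l, m, rfl⟩
    exact ⟨_, ⟨j, k, l, m, rfl⟩, by simp [conjMatrix]⟩
  · rintro ⟨_, ⟨j, k, l, m, rfl⟩, rfl⟩
    exact ⟨j, k, l, m, by simp [conjMatrix]⟩

theorem ncard_haagerupSet_conjMatrix {N : ℕ} (H : Matrix (Fin N) (Fin N) ℂ) :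
    (haagerupSet (conjMatrix H)).ncard = (haagerupSet H).ncard := by
  rw [haagerupSet_conjMatrix, Set.ncard_image_of_injective _ (starRingEnd ℂ).injective]

/-- In a dephased matrix each entry is itself a Haagerup product, so the Butson property can be read
off from an equivalence invariant. -/
theorem isButson_of_haagerupSet {N : ℕ} {q : ℕ} {H : Matrix (Fin (N + 1)) (Fin (N + 1)) ℂ}
    (hH : IsComplexHadamard H) (hrow : ∀ k, H 0 k = 1) (hcol : ∀ j, H j 0 = 1)
    (hq : ∀ z ∈ haagerupSet H, z ^ q = 1) : IsButson q H := by
  refine ⟨hH, fun j k => hq _ ⟨j, k, 0, 0, ?_⟩⟩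
  simp [hrow, hcol]

theorem haagerupSet_pow_of_isButson {N : ℕ} {q : ℕ} {H : Matrix (Fin N) (Fin N) ℂ}
    (hH : IsButson q H) : ∀ z ∈ haagerupSet H, z ^ q = 1 := by
  rintro _ ⟨j, k, l, m, rfl⟩
  simp only [mul_pow, ← map_pow, hH.2, map_one, mul_one]

/-! ### Trivial variations and the defect -/

theorem mem_phaseVariations {N : ℕ} (H : Matrix (Fin N) (Fin N) ℂ) (R : Matrix (Fin N) (Fin N) ℝ) :
    R ∈ phaseVariations H ↔ ∀ j l,
      ∑ k, H j k * (starRingEnd ℂ) (H l k) * ((R j k : ℂ) - (R l k : ℂ)) = 0 :=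
  Iff.rfl

/-- The variations `R j k = x j + y k`, with `y 0 = 0`. -/
def trivialVariation (N : ℕ) :
    ((Fin (N + 1) → ℝ) × (Fin N → ℝ)) →ₗ[ℝ] Matrix (Fin (N + 1)) (Fin (N + 1)) ℝ where
  toFun p := Matrix.of fun j k => p.1 j + (Fin.cons 0 p.2 : Fin (N + 1) → ℝ) k
  map_add' p q := by
    ext j k
    refine Fin.cases ?_ (fun k => ?_) k
    · simp
    · simp only [Prod.fst_add, Prod.snd_add, Pi.add_apply, Matrix.add_apply,
        Matrix.of_apply, Fin.cons_succ]
      ring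
  map_smul' t p := by
    ext j k
    refine Fin.cases ?_ (fun k => ?_) k
    · simp
    · simp only [Prod.smul_fst, Prod.smul_snd, Pi.smul_apply, Matrix.smul_apply, Fin.cons_succ,
        Matrix.of_apply, smul_eq_mul, RingHom.id_apply]
      ring

theorem trivialVariation_injective (N : ℕ) : Function.Injective (trivialVariation N) := by
  rw [← LinearMap.ker_eq_bot, LinearMap.ker_eq_bot']
  rintro ⟨x, y⟩ h
  have h' : ∀ j k, x j + (Fin.cons 0 y : Fin (N + 1) → ℝ) k = 0 := fun j k =>
    congrFun (congrFun h j) k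
  have hx : x = 0 := by
    ext j
    simpa using h' j 0
  have hy : y = 0 := by
    ext k
    simpa [hx] using h' 0 k.succ
  rw [hx, hy]; rfl

theorem trivialVariation_mem {N : ℕ} {H : Matrix (Fin (N + 1)) (Fin (N + 1)) ℂ}
    (hH : IsComplexHadamard H) (p : (Fin (N + 1) → ℝ) × (Fin N → ℝ)) :
    trivialVariation N p ∈ phaseVariations H := by
  rw [mem_phaseVariations]
  intro j l
  have h := ((isComplexHadamard_iff H).1 hH).2 j l
  have : ∀ k, H j k * (starRingEnd ℂ) (H l k) *
      (((trivialVariation N p) j k : ℂ) - ((trivialVariation N p) l k : ℂ)) =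
      H j k * (starRingEnd ℂ) (H l k) * ((p.1 j : ℂ) - p.1 l) := by
    intro k
    change H j k * (starRingEnd ℂ) (H l k) *
      (((p.1 j + (Fin.cons 0 p.2 : Fin (N + 1) → ℝ) k : ℝ) : ℂ) -
        ((p.1 l + (Fin.cons 0 p.2 : Fin (N + 1) → ℝ) k : ℝ) : ℂ)) = _
    push_cast
    ring
  rw [Finset.sum_congr rfl fun k _ => this k, ← Finset.sum_mul, h]
  by_cases hjl : j = l
  · simp [hjl]
  · simp [hjl]

theorem finrank_trivialVariation_domain (N : ℕ) :
    Module.finrank ℝ ((Fin (N + 1) → ℝ) × (Fin N → ℝ)) = 2 * N + 1 := by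
  simp
  ring

theorem range_trivialVariation_le {N : ℕ} {H : Matrix (Fin (N + 1)) (Fin (N + 1)) ℂ}
    (hH : IsComplexHadamard H) : LinearMap.range (trivialVariation N) ≤ phaseVariations H := by
  rintro _ ⟨p, rfl⟩
  exact trivialVariation_mem hH p

theorem finrank_range_trivialVariation (N : ℕ) :
    Module.finrank ℝ (LinearMap.range (trivialVariation N)) = 2 * N + 1 := by
  rw [LinearMap.finrank_range_of_inj (trivialVariation_injective N),
    finrank_trivialVariation_domain]

/-- The trivial variations have dimension `2 * N + 1`, and modulo them every variation can be
normalized to vanish on the first row and column. Defect zero therefore means that no nonzero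
normalized variation exists. -/
theorem hadamardDefect_eq_zero_iff {N : ℕ} {H : Matrix (Fin (N + 1)) (Fin (N + 1)) ℂ}
    (hH : IsComplexHadamard H) : hadamardDefect H = 0 ↔
      ∀ R ∈ phaseVariations H, (∀ k, R 0 k = 0) → (∀ j, R j 0 = 0) → R = 0 := by
  have hdim : hadamardDefect H = 0 ↔ Module.finrank ℝ (phaseVariations H) = 2 * N + 1 := by
    unfold hadamardDefect
    push_cast
    omega
  rw [hdim]
  constructor
  · intro h R hR h0 h1
    have heq : LinearMap.range (trivialVariation N) = phaseVariations H :=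
      Submodule.eq_of_le_of_finrank_eq (range_trivialVariation_le hH)
        (by rw [h, finrank_range_trivialVariation])
    rw [← heq] at hR
    obtain ⟨⟨x, y⟩, rfl⟩ := hR
    have hx : x = 0 := by
      ext j
      have := h1 j
      simpa [trivialVariation] using this
    have hy : y = 0 := by
      ext k
      have := h0 k.succ
      simpa [trivialVariation, hx] using this
    rw [hx, hy]
    exact map_zero (trivialVariation N)
  · intro h
    refine le_antisymm ?_ ?_
    -- The corner entry is recorded only once, with the first column; this makes the target have
    -- dimension `2 * N + 1`.
    · let g : phaseVariations H →ₗ[ℝ] ((Fin (N + 1) → ℝ) × (Fin N → ℝ)) :=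
        { toFun := fun R => (fun j => R.1 j 0, fun k => R.1 0 k.succ)
          map_add' := fun _ _ => rfl
          map_smul' := fun _ _ => rfl }
      have hg : Function.Injective g := by
        rw [← LinearMap.ker_eq_bot, LinearMap.ker_eq_bot']
        rintro ⟨R, hR⟩ h0
        have h1 : ∀ j, R j 0 = 0 := fun j => congrFun (congrArg Prod.fst h0) j
        have h2 : ∀ k : Fin N, R 0 k.succ = 0 := fun k => congrFun (congrArg Prod.snd h0) k
        exact Subtype.ext (h R hR (fun k => Fin.cases (h1 0) h2 k) h1)
      calc _ ≤ _ := LinearMap.finrank_le_finrank_of_injective hg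
        _ = _ := finrank_trivialVariation_domain N
    · rw [← finrank_range_trivialVariation N]
      exact Submodule.finrank_mono (range_trivialVariation_le hH)

/-! ### Defect zero implies isolation -/

/-- First-order variation of the Gram matrix together with the first row and column. -/
noncomputable def dephasedDerivative {N : ℕ} (H : Matrix (Fin (N + 1)) (Fin (N + 1)) ℂ) :
    (Fin (N + 1) → Fin (N + 1) → ℝ) →ₗ[ℝ]
      (Fin (N + 1) → Fin (N + 1) → ℂ) × ((Fin (N + 1) → ℝ) × (Fin (N + 1) → ℝ)) where
  toFun R := (fun j l => ∑ k, H j k * (starRingEnd ℂ) (H l k) * ((R j k : ℂ) - (R l k : ℂ)),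
    (fun k => R 0 k, fun j => R j 0))
  map_add' R S := by
    refine Prod.ext ?_ rfl
    ext j l
    simp only [Pi.add_apply, Prod.fst_add, Complex.ofReal_add, ← Finset.sum_add_distrib]
    exact Finset.sum_congr rfl fun k _ => by ring
  map_smul' t R := by
    refine Prod.ext ?_ rfl
    ext j l
    simp only [Pi.smul_apply, Prod.smul_fst, smul_eq_mul, Complex.ofReal_mul, RingHom.id_apply,
      Complex.real_smul, Finset.mul_sum]
    exact Finset.sum_congr rfl fun k _ => by ring

theorem norm_exp_sub_one_sub_le (s : ℝ) (hs : |s| ≤ 1) :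
    ‖Complex.exp (s * Complex.I) - 1 - s * Complex.I‖ ≤ s ^ 2 := by
  have h := Complex.norm_exp_sub_one_sub_id_le (x := s * Complex.I) (by simpa using hs)
  simpa using h

/-- The Gram equations hold both at `θ` and at `0`, so their difference leaves only the second-order
remainder of the exponential. Each of the `N + 1` summands is at most `(2 * ‖θ‖) ^ 2`. The bound
`‖θ‖ ≤ 1 / 2` keeps the phase differences within the range of `norm_exp_sub_one_sub_le`. -/
theorem norm_dephasedDerivative_le {N : ℕ} {H : Matrix (Fin (N + 1)) (Fin (N + 1)) ℂ}
    (hH : IsComplexHadamard H) (θ : Fin (N + 1) → Fin (N + 1) → ℝ)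
    (h0 : ∀ k, θ 0 k = 0) (h1 : ∀ j, θ j 0 = 0) (hθ : ‖θ‖ ≤ 1 / 2)
    (hK : ∀ j l, ∑ k, H j k * (starRingEnd ℂ) (H l k) *
      Complex.exp (((θ j k - θ l k : ℝ) : ℂ) * Complex.I) =
        if j = l then ((N + 1 : ℕ) : ℂ) else 0) :
    ‖dephasedDerivative H θ‖ ≤ (4 * (N + 1)) * ‖θ‖ ^ 2 := by
  have hnn : 0 ≤ (4 * ((N : ℝ) + 1)) * ‖θ‖ ^ 2 := by positivity
  have hcomp : ∀ j k, |θ j k| ≤ ‖θ‖ := fun j k =>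
    (norm_le_pi_norm (θ j) k).trans (norm_le_pi_norm θ j)
  refine max_le ?_ (max_le ?_ ?_)
  · refine (pi_norm_le_iff_of_nonneg hnn).2 fun j => (pi_norm_le_iff_of_nonneg hnn).2 fun l => ?_
    have hsum := ((isComplexHadamard_iff H).1 hH).2 j l
    have hE := hK j l
    have hz : ∑ k, H j k * (starRingEnd ℂ) (H l k) *
        (Complex.exp (((θ j k - θ l k : ℝ) : ℂ) * Complex.I) - 1) = 0 := by
      simp only [mul_sub, mul_one, Finset.sum_sub_distrib]
      rw [hE, hsum, sub_self]
    have hrew : (dephasedDerivative H θ).1 j l = Complex.I *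
        ∑ k, H j k * (starRingEnd ℂ) (H l k) *
        (Complex.exp (((θ j k - θ l k : ℝ) : ℂ) * Complex.I) - 1 -
          ((θ j k - θ l k : ℝ) : ℂ) * Complex.I) := by
      have e : ∀ k, H j k * (starRingEnd ℂ) (H l k) *
        (Complex.exp (((θ j k - θ l k : ℝ) : ℂ) * Complex.I) - 1 -
          ((θ j k - θ l k : ℝ) : ℂ) * Complex.I) = H j k * (starRingEnd ℂ) (H l k) *
        (Complex.exp (((θ j k - θ l k : ℝ) : ℂ) * Complex.I) - 1) - Complex.I *
          (H j k * (starRingEnd ℂ) (H l k) * ((θ j k : ℂ) - (θ l k : ℂ))) := by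
        intro k
        push_cast
        ring
      rw [Finset.sum_congr rfl fun k _ => e k, Finset.sum_sub_distrib, hz, zero_sub,
        ← Finset.mul_sum, mul_neg, ← mul_assoc, Complex.I_mul_I, neg_one_mul, neg_neg]
      rfl
    rw [hrew, norm_mul]
    simp only [Complex.norm_I, one_mul]
    calc _ ≤ ∑ k : Fin (N + 1), 4 * ‖θ‖ ^ 2 := by
          refine norm_sum_le_of_le _ fun k _ => ?_
          rw [norm_mul, norm_mul, RCLike.norm_conj, hH.1, hH.1, one_mul, one_mul]
          have hb : |θ j k - θ l k| ≤ 2 * ‖θ‖ := by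
            have := abs_sub (θ j k) (θ l k)
            have := hcomp j k
            have := hcomp l k
            linarith
          refine (norm_exp_sub_one_sub_le _ (by linarith)).trans ?_
          rw [← sq_abs]
          calc |θ j k - θ l k| ^ 2 ≤ (2 * ‖θ‖) ^ 2 := by gcongr
            _ = _ := by ring
      _ = _ := by simp; ring
  · have : (dephasedDerivative H θ).2.1 = 0 := by
      ext k; simp [dephasedDerivative, h0]
    rw [this, norm_zero]; exact hnn
  · have : (dephasedDerivative H θ).2.2 = 0 := by
      ext k; simp [dephasedDerivative, h1]
    rw [this, norm_zero]; exact hnn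

/-- The phases of `K` relative to `H`, normalized to be trivial on the first row and column. -/
noncomputable def relPhase {N : ℕ} (H K : Matrix (Fin (N + 1)) (Fin (N + 1)) ℂ)
    (j k : Fin (N + 1)) : ℂ :=
  (K j k * (starRingEnd ℂ) (H j k)) * (starRingEnd ℂ) (K j 0 * (starRingEnd ℂ) (H j 0)) *
    (starRingEnd ℂ) (K 0 k * (starRingEnd ℂ) (H 0 k)) * (K 0 0 * (starRingEnd ℂ) (H 0 0))

theorem tendsto_arg_relPhase {N : ℕ} {H : Matrix (Fin (N + 1)) (Fin (N + 1)) ℂ}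
    (hH : IsComplexHadamard H) :
    Filter.Tendsto (fun K => fun j k => (relPhase H K j k).arg) (𝓝 H)
      (𝓝 (0 : Fin (N + 1) → Fin (N + 1) → ℝ)) := by
  rw [tendsto_pi_nhds]
  intro j
  rw [tendsto_pi_nhds]
  intro k
  have h1 : relPhase H H j k = 1 := by
    simp only [relPhase, mul_conj_of_norm_one (hH.1 _ _), map_one, mul_one]
  have hc : ContinuousAt (fun K => relPhase H K j k) H := by
    have hent : ∀ a b, Continuous fun K : Matrix (Fin (N + 1)) (Fin (N + 1)) ℂ => K a b :=
      fun a b => continuous_id.matrix_elem a b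
    have hconj : Continuous (starRingEnd ℂ) := Complex.continuous_conj
    unfold relPhase
    exact (((((hent j k).mul continuous_const).mul
      (hconj.comp ((hent j 0).mul continuous_const))).mul
      (hconj.comp ((hent 0 k).mul continuous_const))).mul
      ((hent 0 0).mul continuous_const)).continuousAt
  have ha : ContinuousAt Complex.arg (relPhase H H j k) := by
    rw [h1]
    exact Complex.continuousAt_arg (by simp)
  have := ContinuousAt.comp (f := fun K => relPhase H K j k) ha hc
  have h2 := this.tendsto
  simpa [Function.comp_def, h1] using h2

/-- Defect zero makes `dephasedDerivative H` injective, hence bounded below in finite dimension. The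
phases of a nearby Hadamard matrix relative to `H` are mapped to something quadratically small,
which forces them to vanish. -/
theorem isIsolatedHadamard_of_defect_eq_zero {N : ℕ} {H : Matrix (Fin (N + 1)) (Fin (N + 1)) ℂ}
    (hH : IsComplexHadamard H) (hd : hadamardDefect H = 0) : IsIsolatedHadamard H := by
  refine ⟨hH, ?_⟩
  have hker : LinearMap.ker (dephasedDerivative H) = ⊥ := by
    rw [LinearMap.ker_eq_bot']
    intro R hR
    refine (hadamardDefect_eq_zero_iff hH).1 hd R (fun j l => ?_) (fun k => ?_) (fun j => ?_)
    · exact congrFun (congrFun (congrArg Prod.fst hR) j) l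
    · exact congrFun (congrArg (fun p => p.2.1) hR) k
    · exact congrFun (congrArg (fun p => p.2.2) hR) j
  obtain ⟨C, hC0, hC⟩ := (dephasedDerivative H).exists_antilipschitzWith hker
  have hbound : ∀ R, ‖R‖ ≤ C * ‖dephasedDerivative H R‖ := by
    intro R
    have := hC.le_mul_dist R 0
    simpa using this
  -- The first bound serves the exponential estimate; the second makes `C * (4 * (N + 1)) * ‖θ‖ <
  -- 1`.
  set δ : ℝ := min (1 / 2) (1 / (C * (4 * (N + 1)) + 1)) with hδ
  have hδ0 : 0 < δ := by positivity
  filter_upwards [(tendsto_arg_relPhase hH).eventually (Metric.ball_mem_nhds _ hδ0)] with K hK hKH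
  set θ : Fin (N + 1) → Fin (N + 1) → ℝ := fun j k => (relPhase H K j k).arg with hθ
  have hθδ : ‖θ‖ < δ := by simpa [Metric.ball, dist_zero_right] using hK
  have hnorm : ∀ j k, ‖relPhase H K j k‖ = 1 := by
    intro j k
    simp [relPhase, hH.1, hKH.1]
  have hexp : ∀ j k, relPhase H K j k = Complex.exp (θ j k * Complex.I) := by
    intro j k
    have := Complex.norm_mul_exp_arg_mul_I (relPhase H K j k)
    rw [hnorm, Complex.ofReal_one, one_mul] at this
    exact this.symm
  have hr : ∀ j k, K j k * (starRingEnd ℂ) (H j k) *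
      (starRingEnd ℂ) (K j k * (starRingEnd ℂ) (H j k)) = 1 := fun j k =>
    mul_conj_of_norm_one (by simp [hH.1, hKH.1])
  have hrow : ∀ k, relPhase H K 0 k = 1 := by
    intro k
    unfold relPhase
    linear_combination (K 0 0 * (starRingEnd ℂ) (H 0 0)) *
      (starRingEnd ℂ) (K 0 0 * (starRingEnd ℂ) (H 0 0)) * hr 0 k + hr 0 0
  have hcol : ∀ j, relPhase H K j 0 = 1 := by
    intro j
    unfold relPhase
    linear_combination (K 0 0 * (starRingEnd ℂ) (H 0 0)) *
      (starRingEnd ℂ) (K 0 0 * (starRingEnd ℂ) (H 0 0)) * hr j 0 + hr 0 0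
  have hK2 : ∀ j l, ∑ k, H j k * (starRingEnd ℂ) (H l k) *
      Complex.exp (((θ j k - θ l k : ℝ) : ℂ) * Complex.I) =
        if j = l then ((N + 1 : ℕ) : ℂ) else 0 := by
    intro j l
    -- Normalizing by the first row introduces phases that depend on the column alone and cancel
    -- here; normalizing by the first column gives a factor independent of `k`. Orthogonality of the
    -- rows of `K` therefore transfers.
    have hterm : ∀ k, H j k * (starRingEnd ℂ) (H l k) *
        Complex.exp (((θ j k - θ l k : ℝ) : ℂ) * Complex.I) =
        ((starRingEnd ℂ) (K j 0 * (starRingEnd ℂ) (H j 0)) *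
          (K l 0 * (starRingEnd ℂ) (H l 0))) * (K j k * (starRingEnd ℂ) (K l k)) := by
      intro k
      have hconj : Complex.exp (-(θ l k * Complex.I)) = (starRingEnd ℂ) (relPhase H K l k) := by
        rw [hexp, ← Complex.exp_conj]
        simp
      have : Complex.exp (((θ j k - θ l k : ℝ) : ℂ) * Complex.I) =
          relPhase H K j k * (starRingEnd ℂ) (relPhase H K l k) := by
        rw [← hconj, hexp, ← Complex.exp_add]
        congr 1
        push_cast
        ring
      rw [this]
      have a1 := mul_conj_of_norm_one (hH.1 j k)
      have a2 := mul_conj_of_norm_one (hH.1 l k)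
      have a3 := hr 0 k
      have a4 := hr 0 0
      simp only [relPhase, map_mul, Complex.conj_conj] at a1 a2 a3 a4 ⊢
      generalize (starRingEnd ℂ) (H j k) = b1 at *
      generalize (starRingEnd ℂ) (H l k) = b2 at *
      generalize (starRingEnd ℂ) (H 0 k) = b3 at *
      generalize (starRingEnd ℂ) (K 0 k) = b4 at *
      generalize (starRingEnd ℂ) (H 0 0) = b5 at *
      generalize (starRingEnd ℂ) (K 0 0) = b6 at *
      calc _ = (H j k * b1) * (H l k * b2) * (K 0 k * b3 * (b4 * H 0 k)) *
            (K 0 0 * b5 * (b6 * H 0 0)) *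
            ((starRingEnd ℂ) (K j 0) * H j 0 * (K l 0 * (starRingEnd ℂ) (H l 0)) *
              (K j k * (starRingEnd ℂ) (K l k))) := by ring
        _ = _ := by rw [a1, a2, a3, a4]; ring
    rw [Finset.sum_congr rfl fun k _ => hterm k, ← Finset.mul_sum,
      ((isComplexHadamard_iff K).1 hKH).2]
    by_cases hjl : j = l
    · subst hjl
      rw [if_pos rfl, mul_comm ((starRingEnd ℂ) _), hr, one_mul]
    · simp [hjl]
  have hle := norm_dephasedDerivative_le hH θ (fun k => by simp [hθ, hrow])
    (fun j => by simp [hθ, hcol]) (hθδ.le.trans (min_le_left _ _)) hK2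
  have hzero : θ = 0 := by
    by_contra hne
    have hpos : 0 < ‖θ‖ := norm_pos_iff.2 hne
    have h1 : ‖θ‖ ≤ C * ((4 * (N + 1)) * ‖θ‖ ^ 2) :=
      (hbound θ).trans (mul_le_mul_of_nonneg_left hle C.2)
    have h2 : 1 ≤ C * (4 * (N + 1)) * ‖θ‖ := by
      have : ‖θ‖ * 1 ≤ ‖θ‖ * (C * (4 * (N + 1)) * ‖θ‖) := by nlinarith
      exact le_of_mul_le_mul_left this hpos
    have h3 : ‖θ‖ < 1 / (C * (4 * (N + 1)) + 1) := hθδ.trans_le (min_le_right _ _)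
    have h4 : (0 : ℝ) < C * (4 * (N + 1)) + 1 := by positivity
    rw [lt_div_iff₀ h4] at h3
    nlinarith
  rw [hadamardEquiv_iff]
  refine ⟨fun j => K j 0 * (starRingEnd ℂ) (H j 0),
    fun k => K 0 k * (starRingEnd ℂ) (H 0 k) * (starRingEnd ℂ) (K 0 0 * (starRingEnd ℂ) (H 0 0)),
    1, 1, fun j => by simp [hH.1, hKH.1], fun j => by simp [hH.1, hKH.1], fun j k => ?_⟩
  have hz : relPhase H K j k = 1 := by
    rw [hexp, hzero]; simp
  have a1 := mul_conj_of_norm_one (hH.1 j k)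
  have a2 := hr j 0
  have a3 := hr 0 k
  have a4 := hr 0 0
  simp only [Equiv.Perm.coe_one, id_eq]
  unfold relPhase at hz
  generalize K j 0 * (starRingEnd ℂ) (H j 0) = r1 at *
  generalize K 0 k * (starRingEnd ℂ) (H 0 k) = r2 at *
  generalize K 0 0 * (starRingEnd ℂ) (H 0 0) = r3 at *
  generalize (starRingEnd ℂ) (H j k) = b1 at *
  generalize (starRingEnd ℂ) r1 = s1 at *
  generalize (starRingEnd ℂ) r2 = s2 at *
  generalize (starRingEnd ℂ) r3 = s3 at *
  calc K j k = K j k * (H j k * b1) * (r1 * s1) * (r2 * s2) * (r3 * s3) := by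
        rw [a1, a2, a3, a4]; ring
    _ = (K j k * b1 * s1 * s2 * r3) * (r1 * H j k * (r2 * s3)) := by ring
    _ = _ := by rw [hz, one_mul]

/-! ### Excluding roots of unity by a norm argument -/

/-- The norm is a rational integer and equals the product of all conjugates, so it has absolute
value below one and is zero. -/
theorem eq_zero_of_forall_embedding_norm_lt_one {K : Type*} [Field K] [NumberField K] (x : K)
    (hx : IsIntegral ℤ x) (h : ∀ φ : K →ₐ[ℚ] ℂ, ‖φ x‖ < 1) : x = 0 := by
  have hint : IsIntegral ℤ (Algebra.norm ℚ x) := Algebra.isIntegral_norm ℚ hx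
  obtain ⟨n, hn⟩ := IsIntegrallyClosed.isIntegral_iff.1 hint
  have hprod : ‖((Algebra.norm ℚ x : ℚ) : ℂ)‖ < 1 := by
    have := Algebra.norm_eq_prod_embeddings ℚ ℂ x
    have h2 : ((Algebra.norm ℚ x : ℚ) : ℂ) = ∏ φ : K →ₐ[ℚ] ℂ, φ x := by
      rw [← this]; rfl
    rw [h2, norm_prod]
    classical
    -- One embedding is split off because strictness of the product bound needs a nonempty index
    -- set.
    have φ₀ : K →ₐ[ℚ] ℂ := IsAlgClosed.lift
    rw [← Finset.mul_prod_erase Finset.univ _ (Finset.mem_univ φ₀)]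
    have h3 : ∏ φ ∈ Finset.univ.erase φ₀, ‖φ x‖ ≤ 1 :=
      Finset.prod_le_one (fun _ _ => norm_nonneg _) fun φ _ => (h φ).le
    calc ‖φ₀ x‖ * ∏ φ ∈ Finset.univ.erase φ₀, ‖φ x‖ ≤ ‖φ₀ x‖ * 1 :=
          mul_le_mul_of_nonneg_left h3 (norm_nonneg _)
      _ < 1 := by rw [mul_one]; exact h φ₀
  rw [← hn] at hprod
  have h4 : |(n : ℝ)| < 1 := by
    simpa using hprod
  have h5 : n = 0 := by
    have : |n| < 1 := by exact_mod_cast h4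
    exact Int.abs_lt_one_iff.1 this
  rw [h5, map_zero] at hn
  exact Algebra.norm_eq_zero_iff.1 hn.symm

/-- The system has rational coefficients, so it descends along `ψ` to `K` and is carried on by `φ`.
A field embedding need not preserve modulus one, but it does on roots of unity. -/
theorem isUnimodularY10ASolution_map {K : Type*} [Field K] (φ ψ : K →+* ℂ) {a b c d : K} {q : ℕ}
    (hq : 1 ≤ q) (ha : a ^ q = 1) (hb : b ^ q = 1) (hc : c ^ q = 1) (hd : d ^ q = 1)
    (h : Y10ASystem (ψ a) (ψ b) (ψ c) (ψ d)) :
    IsUnimodularY10ASolution (φ a) (φ b) (φ c) (φ d) := by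
  have hn : ∀ x : K, x ^ q = 1 → ‖φ x‖ = 1 := fun x hx =>
    Complex.norm_eq_one_of_pow_eq_one (by rw [← map_pow, hx, map_one]) (by omega)
  refine ⟨hn a ha, hn b hb, hn c hc, hn d hd, ?_⟩
  obtain ⟨h1, h2, h3, h4⟩ := h
  have t : ∀ x : K, ψ x = 0 → φ x = 0 := fun x hx => by
    rw [(map_eq_zero_iff ψ ψ.injective).1 hx, map_zero]
  refine ⟨?_, ?_, ?_, ?_⟩
  · have h := t (1 + a + c * d / b + a * d * (2 + 1 / c + c + d) + a ^ 2 * d * (b + c * d) / c)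
      (by simpa only [map_add, map_mul, map_div₀, map_pow, map_one, map_ofNat] using h1)
    simpa only [map_add, map_mul, map_div₀, map_pow, map_one, map_ofNat] using h
  · have h := t (2 + 1 / b + b + a / c + c / a + 1 / d + 1 / c / d + d + c * d)
      (by simpa only [map_add, map_mul, map_div₀, map_pow, map_one, map_ofNat] using h2)
    simpa only [map_add, map_mul, map_div₀, map_pow, map_one, map_ofNat] using h
  · have h := t (a ^ 2 * b * c * d * (1 + b + d) + c * (b + d + b * d) + a * b * (1 + c * d) ^ 2)
      (by simpa only [map_add, map_mul, map_div₀, map_pow, map_one, map_ofNat] using h3)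
    simpa only [map_add, map_mul, map_div₀, map_pow, map_one, map_ofNat] using h
  · have h := t (c + b * d * ((1 + a) * (1 + c) * (a + c) + a ^ 2 * b * c * d))
      (by simpa only [map_add, map_mul, map_div₀, map_pow, map_one, map_ofNat] using h4)
    simpa only [map_add, map_mul, map_div₀, map_pow, map_one, map_ofNat] using h

/-- Sum of the six ratios of `1, a, c`. -/
noncomputable def ratioSum {K : Type*} [Field K] (a c : K) : K :=
  a + 1 / a + c + 1 / c + a / c + c / a

/-- In the number field generated by the solution, `(s + 1) * (s + 2)` with `s = ratioSum a c` is an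
algebraic integer. Each of its conjugates comes from another unimodular solution, so `hbound`
controls all of them at once. -/
theorem not_roots_of_unity
    (hbound : ∀ a b c d : ℂ, IsUnimodularY10ASolution a b c d →
      (ratioSum a c + 1) * (ratioSum a c + 2) ≠ 0 ∧
        ‖(ratioSum a c + 1) * (ratioSum a c + 2)‖ < 1)
    {a b c d : ℂ} (h : IsUnimodularY10ASolution a b c d) {q : ℕ} (hq : 1 ≤ q)
    (ha : a ^ q = 1) (hb : b ^ q = 1) (hc : c ^ q = 1) (hd : d ^ q = 1) : False := by
  have hint : ∀ x : ℂ, x ^ q = 1 → IsIntegral ℚ x := fun x hx =>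
    ⟨Polynomial.X ^ q - 1, Polynomial.monic_X_pow_sub_C 1 (by omega), by simp [hx]⟩
  let F := IntermediateField.adjoin ℚ ({a, b, c, d} : Set ℂ)
  have : FiniteDimensional ℚ F := by
    refine IntermediateField.finiteDimensional_adjoin (S := ({a, b, c, d} : Set ℂ)) ?_
    intro x hx
    simp only [Set.mem_insert_iff, Set.mem_singleton_iff] at hx
    rcases hx with rfl | rfl | rfl | rfl
    exacts [hint _ ha, hint _ hb, hint _ hc, hint _ hd]
  have : NumberField F := ⟨⟩
  have hmem : ∀ x ∈ ({a, b, c, d} : Set ℂ), x ∈ F := fun x hx =>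
    IntermediateField.subset_adjoin ℚ _ hx
  let a' : F := ⟨a, hmem a (by simp)⟩
  let b' : F := ⟨b, hmem b (by simp)⟩
  let c' : F := ⟨c, hmem c (by simp)⟩
  let d' : F := ⟨d, hmem d (by simp)⟩
  have ha' : a' ^ q = 1 := Subtype.ext ha
  have hb' : b' ^ q = 1 := Subtype.ext hb
  have hc' : c' ^ q = 1 := Subtype.ext hc
  have hd' : d' ^ q = 1 := Subtype.ext hd
  have hi : ∀ x : F, x ^ q = 1 → IsIntegral ℤ x := fun x hx =>
    ⟨Polynomial.X ^ q - 1, Polynomial.monic_X_pow_sub_C 1 (by omega), by simp [hx]⟩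
  have hi' : ∀ x : F, x ^ q = 1 → IsIntegral ℤ (1 / x) := fun x hx => by
    refine hi _ ?_
    rw [div_pow, hx, one_pow, div_one]
  have hs : IsIntegral ℤ (ratioSum a' c') := by
    unfold ratioSum
    rw [← mul_one_div a' c', ← mul_one_div c' a']
    exact (((((hi _ ha').add (hi' _ ha')).add (hi _ hc')).add (hi' _ hc')).add
      ((hi _ ha').mul (hi' _ hc'))).add ((hi _ hc').mul (hi' _ ha'))
  have h1 : IsIntegral ℤ (1 : F) := isIntegral_one
  have hu : IsIntegral ℤ ((ratioSum a' c' + 1) * (ratioSum a' c' + 2)) := by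
    rw [← one_add_one_eq_two]
    exact (hs.add h1).mul (hs.add (h1.add h1))
  have hmap : ∀ φ : F →ₐ[ℚ] ℂ, φ ((ratioSum a' c' + 1) * (ratioSum a' c' + 2)) =
      (ratioSum (φ a') (φ c') + 1) * (ratioSum (φ a') (φ c') + 2) := by
    intro φ
    simp only [ratioSum, map_add, map_mul, map_div₀, map_one, map_ofNat]
  have hzero := eq_zero_of_forall_embedding_norm_lt_one _ hu fun φ => by
    rw [hmap]
    exact (hbound _ _ _ _
        (isUnimodularY10ASolution_map φ.toRingHom F.val.toRingHom hq ha' hb' hc' hd'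
      h.2.2.2.2)).2
  refine (hbound a b c d h).1 ?_
  have := congrArg F.val hzero
  rw [map_zero] at this
  exact (hmap F.val).symm.trans this

/-! ### The system as autocorrelation equations for plane vectors -/

/-- Real inner product of complex numbers. -/
def ip (p q : ℂ) : ℝ := p.re * q.re + p.im * q.im

theorem ip_comm (p q : ℂ) : ip p q = ip q p := by unfold ip; ring

theorem ip_add_left (p q r : ℂ) : ip (p + q) r = ip p r + ip q r := by
  simp only [ip, Complex.add_re, Complex.add_im]; ring

theorem ip_sub_left (p q r : ℂ) : ip (p - q) r = ip p r - ip q r := by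
  simp only [ip, Complex.sub_re, Complex.sub_im]; ring

theorem ip_add_right (p q r : ℂ) : ip r (p + q) = ip r p + ip r q := by
  simp only [ip, Complex.add_re, Complex.add_im]; ring

theorem ip_sub_right (p q r : ℂ) : ip r (p - q) = ip r p - ip r q := by
  simp only [ip, Complex.sub_re, Complex.sub_im]; ring

theorem ip_self (p : ℂ) : ip p p = ‖p‖ ^ 2 := by
  rw [← Complex.normSq_eq_norm_sq, Complex.normSq_apply]; rfl

theorem ip_self_of_norm_one {p : ℂ} (h : ‖p‖ = 1) : ip p p = 1 := by
  rw [ip_self, h, one_pow]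

/-- The Gram determinant of two triples of plane vectors vanishes. -/
theorem gram_det (p₁ p₂ p₃ q₁ q₂ q₃ : ℂ) :
    ip p₁ q₁ * (ip p₂ q₂ * ip p₃ q₃ - ip p₂ q₃ * ip p₃ q₂) -
      ip p₁ q₂ * (ip p₂ q₁ * ip p₃ q₃ - ip p₂ q₃ * ip p₃ q₁) +
      ip p₁ q₃ * (ip p₂ q₁ * ip p₃ q₂ - ip p₂ q₂ * ip p₃ q₁) = 0 := by
  unfold ip; ring

/-- Five unimodular numbers such that the sequence `v, y, z, u, x, x, u, z, y` on `ℤ/9` has all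
nontrivial autocorrelations equal to `-1`. -/
structure IsCoreSolution (x y z u v : ℂ) : Prop where
  hx : ‖x‖ = 1
  hy : ‖y‖ = 1
  hz : ‖z‖ = 1
  hu : ‖u‖ = 1
  hv : ‖v‖ = 1
  r₁ : 1 + ip x u + ip z u + ip y z + ip y v = 0
  r₂ : 1 + ip y u + ip x u + ip z x + ip z v = 0
  r₃ : 1 + ip y u + ip z u + ip x y + ip x v = 0
  r₄ : 1 + ip x y + ip y z + ip z x + ip u v = 0

theorem two_ip {p q : ℂ} (hp : ‖p‖ = 1) (hq : ‖q‖ = 1) :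
    ((2 * ip p q : ℝ) : ℂ) = p / q + q / p := by
  have h1 : (starRingEnd ℂ) p = 1 / p := eq_one_div_of_mul_eq_one_right (mul_conj_of_norm_one hp)
  have h2 : (starRingEnd ℂ) q = 1 / q := eq_one_div_of_mul_eq_one_right (mul_conj_of_norm_one hq)
  have h3 : ((2 * ip p q : ℝ) : ℂ) = p * (starRingEnd ℂ) q + q * (starRingEnd ℂ) p := by
    apply Complex.ext <;> simp [ip] <;> ring
  rw [h3, h1, h2]; ring

/-- Each equation of the system is a unimodular monomial times twice one of the real relations `r₁`,
…, `r₄`, by `s₁`, …, `s₄`. -/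
theorem isUnimodularY10ASolution_iff {x y z u v : ℂ} (hx : ‖x‖ = 1) (hy : ‖y‖ = 1) (hz : ‖z‖ = 1)
    (hu : ‖u‖ = 1) (hv : ‖v‖ = 1) :
    IsUnimodularY10ASolution (x / y) (y / v) (x / z) (u / x) ↔ IsCoreSolution x y z u v := by
  have nx : x ≠ 0 := norm_ne_zero_iff.1 (by rw [hx]; norm_num)
  have ny : y ≠ 0 := norm_ne_zero_iff.1 (by rw [hy]; norm_num)
  have nz : z ≠ 0 := norm_ne_zero_iff.1 (by rw [hz]; norm_num)
  have nu : u ≠ 0 := norm_ne_zero_iff.1 (by rw [hu]; norm_num)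
  have nv : v ≠ 0 := norm_ne_zero_iff.1 (by rw [hv]; norm_num)
  have cast0 : ∀ r : ℝ, r = 0 ↔ ((2 * r : ℝ) : ℂ) = 0 := by
    intro r
    rw [Complex.ofReal_eq_zero, mul_eq_zero]
    simp
  have e₁ : ((2 * (1 + ip x u + ip z u + ip y z + ip y v) : ℝ) : ℂ) =
      2 + (x / u + u / x) + (z / u + u / z) + (y / z + z / y) + (y / v + v / y) := by
    rw [← two_ip hx hu, ← two_ip hz hu, ← two_ip hy hz, ← two_ip hy hv]; push_cast; ring
  have e₂ : ((2 * (1 + ip y u + ip x u + ip z x + ip z v) : ℝ) : ℂ) =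
      2 + (y / u + u / y) + (x / u + u / x) + (z / x + x / z) + (z / v + v / z) := by
    rw [← two_ip hy hu, ← two_ip hx hu, ← two_ip hz hx, ← two_ip hz hv]; push_cast; ring
  have e₃ : ((2 * (1 + ip y u + ip z u + ip x y + ip x v) : ℝ) : ℂ) =
      2 + (y / u + u / y) + (z / u + u / z) + (x / y + y / x) + (x / v + v / x) := by
    rw [← two_ip hy hu, ← two_ip hz hu, ← two_ip hx hy, ← two_ip hx hv]; push_cast; ring
  have e₄ : ((2 * (1 + ip x y + ip y z + ip z x + ip u v) : ℝ) : ℂ) =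
      2 + (x / y + y / x) + (y / z + z / y) + (z / x + x / z) + (u / v + v / u) := by
    rw [← two_ip hx hy, ← two_ip hy hz, ← two_ip hz hx, ← two_ip hu hv]; push_cast; ring
  have s₂ : 1 + x / y + (x / z) * (u / x) / (y / v) + (x / y) * (u / x) *
      (2 + 1 / (x / z) + x / z + u / x) + (x / y) ^ 2 * (u / x) * (y / v + (x / z) * (u / x)) /
        (x / z) = (u / y) * (2 + (y / u + u / y) + (x / u + u / x) + (z / x + x / z) +
          (z / v + v / z)) := by field_simp; ring
  have s₁ : 2 + 1 / (y / v) + y / v + (x / y) / (x / z) + (x / z) / (x / y) + 1 / (u / x) +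
      1 / (x / z) / (u / x) + u / x + (x / z) * (u / x) =
      2 + (x / u + u / x) + (z / u + u / z) + (y / z + z / y) + (y / v + v / y) := by
    field_simp; ring
  have s₃ : (x / y) ^ 2 * (y / v) * (x / z) * (u / x) * (1 + y / v + u / x) +
      (x / z) * (y / v + u / x + (y / v) * (u / x)) +
      (x / y) * (y / v) * (1 + (x / z) * (u / x)) ^ 2 = (x * u / (v * z)) *
      (2 + (y / u + u / y) + (z / u + u / z) + (x / y + y / x) + (x / v + v / x)) := by
    field_simp; ring
  have s₄ : x / z + (y / v) * (u / x) * ((1 + x / y) * (1 + x / z) * (x / y + x / z) +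
      (x / y) ^ 2 * (y / v) * (x / z) * (u / x)) = (x * u / (z * v)) *
      (2 + (x / y + y / x) + (y / z + z / y) + (z / x + x / z) + (u / v + v / u)) := by
    field_simp; ring
  have t : ∀ p q : ℂ, p ≠ 0 → (p * q = 0 ↔ q = 0) := fun p q hp => by simp [hp]
  constructor
  · rintro ⟨-, -, -, -, h1, h2, h3, h4⟩
    rw [s₂, t _ _ (div_ne_zero nu ny), ← e₂, ← cast0] at h1
    rw [s₁, ← e₁, ← cast0] at h2
    rw [s₃, t _ _ (div_ne_zero (mul_ne_zero nx nu) (mul_ne_zero nv nz)), ← e₃, ← cast0] at h3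
    rw [s₄, t _ _ (div_ne_zero (mul_ne_zero nx nu) (mul_ne_zero nz nv)), ← e₄, ← cast0] at h4
    exact ⟨hx, hy, hz, hu, hv, h2, h1, h3, h4⟩
  · rintro ⟨-, -, -, -, -, h1, h2, h3, h4⟩
    refine ⟨by simp [hx, hy], by simp [hy, hv], by simp [hx, hz], by simp [hu, hx], ?_, ?_, ?_, ?_⟩
    · rw [s₂, t _ _ (div_ne_zero nu ny), ← e₂, ← cast0]; exact h2
    · rw [s₁, ← e₁, ← cast0]; exact h1
    · rw [s₃, t _ _ (div_ne_zero (mul_ne_zero nx nu) (mul_ne_zero nv nz)), ← e₃, ← cast0]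
      exact h3
    · rw [s₄, t _ _ (div_ne_zero (mul_ne_zero nx nu) (mul_ne_zero nz nv)), ← e₄, ← cast0]
      exact h4

/-! ### Elimination down to one unknown -/

/-- Polynomial consequences, in terms of inner products `A, B, C` of `y z`, `z x`, `x y` and of
`w = 1 + ip u (x + y + z)`. -/
structure PlanarRelations (A B C w : ℝ) : Prop where
  hK : 1 + 2 * A * B * C - A ^ 2 - B ^ 2 - C ^ 2 = 0
  rowx : (1 - A ^ 2) * (w + C) + (A * B - C) * (w + A) + (A * C - B) * (w + B) = 0
  rowy : (1 - B ^ 2) * (w + A) + (B * C - A) * (w + B) + (B * A - C) * (w + C) = 0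
  rowz : (1 - C ^ 2) * (w + B) + (C * A - B) * (w + C) + (C * B - A) * (w + A) = 0
  gxy : (1 - C ^ 2) * (4 + 2 * (A + B + C)) - (w + C) ^ 2 - (w + A) ^ 2 +
    2 * C * (w + C) * (w + A) = 0
  gyz : (1 - A ^ 2) * (4 + 2 * (A + B + C)) - (w + A) ^ 2 - (w + B) ^ 2 +
    2 * A * (w + A) * (w + B) = 0
  gzx : (1 - B ^ 2) * (4 + 2 * (A + B + C)) - (w + B) ^ 2 - (w + C) ^ 2 +
    2 * B * (w + B) * (w + C) = 0
  hU : 2 * (A + B + C) ^ 3 - 2 * (A + B + C) ^ 2 * w + 10 * (A + B + C) ^ 2 -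
    4 * (A + B + C) * w ^ 2 + 4 * (A + B + C) * w + 12 * (A + B + C) + w ^ 2 + 4 * w + 4 = 0

namespace IsCoreSolution

variable {x y z u v : ℂ}

/-- With `t = u - v`, the relations `r₁, r₂, r₃` give the inner products of `t` with `x, y, z` as
one common constant plus an inner product among `x, y, z`. The relation `r₄` gives `ip t t` and `ip
u t`. -/
theorem diff_x (h : IsCoreSolution x y z u v) :
    ip (u - v) x = ip u (x + y + z) + 1 + ip x y := by
  have := h.r₃
  rw [ip_sub_left, ip_add_right, ip_add_right, ip_comm v x, ip_comm u x, ip_comm u y, ip_comm u z]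
  linarith

theorem diff_y (h : IsCoreSolution x y z u v) :
    ip (u - v) y = ip u (x + y + z) + 1 + ip y z := by
  have := h.r₁
  rw [ip_sub_left, ip_add_right, ip_add_right, ip_comm v y, ip_comm u x, ip_comm u y, ip_comm u z]
  linarith

theorem diff_z (h : IsCoreSolution x y z u v) :
    ip (u - v) z = ip u (x + y + z) + 1 + ip z x := by
  have := h.r₂
  rw [ip_sub_left, ip_add_right, ip_add_right, ip_comm v z, ip_comm u x, ip_comm u y, ip_comm u z]
  linarith

theorem diff_self (h : IsCoreSolution x y z u v) :
    ip (u - v) (u - v) = 4 + 2 * (ip y z + ip z x + ip x y) := by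
  have := h.r₄
  rw [ip_sub_left, ip_sub_right, ip_sub_right, ip_self_of_norm_one h.hu, ip_self_of_norm_one h.hv,
    ip_comm v u]
  linarith

theorem diff_u (h : IsCoreSolution x y z u v) :
    ip u (u - v) = 2 + (ip y z + ip z x + ip x y) := by
  have := h.r₄
  rw [ip_sub_right, ip_self_of_norm_one h.hu]
  linarith

/-- Because `‖u - v‖ ≤ 2`. -/
theorem sum_nonpos (h : IsCoreSolution x y z u v) : ip y z + ip z x + ip x y ≤ 0 := by
  have h1 := h.diff_self
  have h2 : ip (u - v) (u - v) ≤ 4 := by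
    rw [ip_self]
    have := norm_sub_le u v
    rw [h.hu, h.hv] at this
    nlinarith [norm_nonneg (u - v)]
  linarith

/-- Because `‖x + y + z‖ ^ 2 ≥ 0`. -/
theorem sum_ge (h : IsCoreSolution x y z u v) : -(3 / 2) ≤ ip y z + ip z x + ip x y := by
  have h2 : 0 ≤ ip (x + y + z) (x + y + z) := by rw [ip_self]; positivity
  simp only [ip_add_left, ip_add_right, ip_self_of_norm_one h.hx, ip_self_of_norm_one h.hy,
    ip_self_of_norm_one h.hz] at h2
  rw [ip_comm x z, ip_comm y x, ip_comm z y] at h2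
  linarith

/-- Any three plane vectors are dependent. With `t = u - v`, the relations are the Gram determinants
of `x, y, z`, of `x, y, z` against the triples in which `t` replaces one of them, of two of `x, y,
z` together with `t`, and of `u, x + y + z, t`. -/
theorem planarRelations (h : IsCoreSolution x y z u v) :
    PlanarRelations (ip y z) (ip z x) (ip x y) (ip u (x + y + z) + 1) := by
  have tx := h.diff_x
  have ty := h.diff_y
  have tz := h.diff_z
  have tt := h.diff_self
  have ut := h.diff_u
  have nx := ip_self_of_norm_one h.hx
  have ny := ip_self_of_norm_one h.hy
  have nz := ip_self_of_norm_one h.hz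
  have nu := ip_self_of_norm_one h.hu
  have cyx := ip_comm y x
  have czy := ip_comm z y
  have cxz := ip_comm x z
  have gg : ip (x + y + z) (x + y + z) = 3 + 2 * (ip y z + ip z x + ip x y) := by
    simp only [ip_add_left, ip_add_right, nx, ny, nz, cyx, czy, cxz]; ring
  have tg : ip (u - v) (x + y + z) =
      3 * (ip u (x + y + z) + 1) + (ip y z + ip z x + ip x y) := by
    rw [ip_add_right, ip_add_right, tx, ty, tz]; ring
  have xt := (ip_comm x (u - v)).trans tx
  have yt := (ip_comm y (u - v)).trans ty
  have zt := (ip_comm z (u - v)).trans tz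
  have gt := (ip_comm (x + y + z) (u - v)).trans tg
  have tu := (ip_comm (u - v) u).trans ut
  have gu := ip_comm (x + y + z) u
  have g1 := gram_det x y z x y z
  have g2 := gram_det x y z (u - v) y z
  have g3 := gram_det y z x (u - v) z x
  have g4 := gram_det z x y (u - v) x y
  have g5 := gram_det x y (u - v) x y (u - v)
  have g6 := gram_det y z (u - v) y z (u - v)
  have g7 := gram_det z x (u - v) z x (u - v)
  have g8 := gram_det u (x + y + z) (u - v) u (x + y + z) (u - v)
  simp only [gg, tg, gt, tu, ut, gu, nu, xt, yt, zt, tx, ty, tz, tt, nx, ny, nz, cyx, czy, cxz]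
    at g1 g2 g3 g4 g5 g6 g7 g8
  constructor
  · linear_combination g1
  · linear_combination g2
  · linear_combination g3
  · linear_combination g4
  · linear_combination g5
  · linear_combination g6
  · linear_combination g7
  · linear_combination -g8

end IsCoreSolution

namespace PlanarRelations

variable {A B C w : ℝ}

/-- The left side equals `-(A - B) * (B - C) * (C - A)`. The identity removes the antisymmetric part
during elimination, and its sign later decides the cyclic order of `A, B, C`. -/
theorem cyclic (h : PlanarRelations A B C w) :
    A ^ 2 * B + B ^ 2 * C + C ^ 2 * A - A ^ 2 * C - B ^ 2 * A - C ^ 2 * B =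
      (w - 1 / 2) * ((A + B + C) ^ 2 + 2 * (A + B + C) - 3 - 4 * (A * B + B * C + C * A)) := by
  linear_combination h.rowx + h.rowy + h.rowz - 3 / 2 * h.hK

/-- Cyclic combinations of the relations involve only `e`, `f`, `A * B * C`, the antisymmetric
product and `w`. The last relation `hK` of `x, y, z` removes `A * B * C`, and `cyclic` removes the
antisymmetric product. -/
theorem symm_eqs (h : PlanarRelations A B C w) {e f : ℝ} (he : e = A + B + C)
    (hf : f = A * B + B * C + C * A) :
    (-2 * e ^ 3 + 3 * e ^ 2 * w - 8 * e ^ 2 + 5 * e * f + 2 * e * w ^ 2 - 2 * e * w + 5 * e -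
      6 * f * w + 17 * f - 6 * w ^ 2 - 3 * w + 15 = 0) ∧
    (e ^ 4 - 3 / 2 * e ^ 3 * w + 2 * e ^ 3 - 2 * e ^ 2 * w ^ 2 + 2 * e ^ 2 * w - 15 / 2 * e ^ 2 +
      2 * e * w ^ 2 + 17 / 2 * e * w - 39 / 2 * e + 12 * w ^ 2 - 3 * w - 9 =
      1 / 2 * (e - 3) * (e + 2) * f) := by
  have hd := h.cyclic
  have hN : -2 * e ^ 3 + 3 * e ^ 2 * w - 8 * e ^ 2 + 5 * e * f + 2 * e * w ^ 2 - 2 * e * w + 5 * e -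
      6 * f * w + 17 * f - 6 * w ^ 2 - 3 * w + 15 = 0 := by
    subst he hf
    linear_combination h.gxy + h.gyz + h.gzx - hd + 3 / 2 * h.hK
  have hB : -2 * e ^ 3 - e ^ 2 * w ^ 2 + e ^ 2 * w - 3 * e ^ 2 + 5 * e * f - 2 * e * w ^ 2 +
      2 * e * w + e + f ^ 2 + 4 * f * w ^ 2 - 4 * f * w + 7 * f + 3 * w ^ 2 - 3 * w + 3 = 0 := by
    subst he hf
    linear_combination B * h.rowx + C * h.rowy + A * h.rowz + w * hd +
      (A + B + C - 3 / 2 * w + 3) * h.hK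
  have hC : -2 * e ^ 4 + 3 * e ^ 3 * w - 9 * e ^ 3 + 7 * e ^ 2 * f + 3 * e ^ 2 * w ^ 2 +
      3 / 2 * e ^ 2 * w - 6 * e ^ 2 - 9 * e * f * w + 47 / 2 * e * f - 3 * e * w + 17 / 2 * e -
      2 * f ^ 2 - 8 * f * w ^ 2 - f * w + 29 / 2 * f - 3 * w ^ 2 - 3 / 2 * w + 15 / 2 = 0 := by
    subst he hf
    linear_combination C * h.gxy + A * h.gyz + B * h.gzx - (A + B + C + w + 1 / 2) * hd +
      (7 / 2 * (A + B + C) - 3 / 2 * w + 27 / 4) * h.hK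
  refine ⟨hN, ?_⟩
  -- The combination cancels `f ^ 2` and all mixed terms in `f` and `w`, so that `f` occurs linearly
  -- with a coefficient depending on `e` alone.
  linear_combination hC - e * hN + 2 * hB - 1 / 2 * (e + 3) * hN

/-- Eliminating `f` between the two equations of `symm_eqs` gives a cubic in `w`; its remainder
modulo `hU`, which is quadratic in `w`, is linear. The factor `(e - 3) * (e + 2)` splits off. -/
theorem linear_eq (h : PlanarRelations A B C w) {e : ℝ} (he : e = A + B + C) (h3 : e ≠ 3)
    (h2 : e ≠ -2) :
    (48 * e ^ 4 - 8 * e ^ 3 - 28 * e ^ 2 + 74 * e - 302) * w =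
      16 * e ^ 5 - 48 * e ^ 4 - 476 * e ^ 3 - 492 * e ^ 2 + 405 * e + 385 := by
  obtain ⟨hN, hH⟩ := h.symm_eqs he rfl
  have hU := h.hU
  rw [← he] at hU
  generalize A * B + B * C + C * A = f at hN hH
  have h0 : (e - 3) * (e + 2) ≠ 0 :=
    mul_ne_zero (sub_ne_zero.2 h3) (by intro h; exact h2 (by linarith))
  have := mul_left_cancel₀ (a := (e - 3) * (e + 2)) (b := (48 * e ^ 4 - 8 * e ^ 3 - 28 * e ^ 2 +
    74 * e - 302) * w - (16 * e ^ 5 - 48 * e ^ 4 - 476 * e ^ 3 - 492 * e ^ 2 + 405 * e + 385))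
    (c := 0) h0 ?_
  · linarith
  -- The factor `(-4 * e + 1) ^ 2` is the pseudo-division multiplier: `1 - 4 * e` is the leading
  -- coefficient of `hU` in `w`.
  · linear_combination
      (-4 * e + 1) ^ 2 * (-1 / 2 * (e - 3) * (e + 2) * hN - (5 * e - 6 * w + 17) * hH) -
      (-24 * e ^ 4 + 48 * e ^ 3 * w - 88 * e ^ 3 - 60 * e ^ 2 * w + 344 * e ^ 2 - 276 * e * w +
        584 * e + 72 * w - 528) * hU

/-- This is the resultant in `w` of `linear_eq` and `hU`, freed of the factor `(1 - 2 * s) ^ 2`,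
which is nonzero for `s ≤ 0`. -/
theorem charpoly_eq (h : PlanarRelations A B C w) {s : ℝ} (hs : s = 2 * (A + B + C)) (h0 : s ≤ 0)
    (h2 : -3 ≤ s) :
    s ^ 9 + 36 * s ^ 8 + 239 * s ^ 7 - 593 * s ^ 6 - 11218 * s ^ 5 - 37091 * s ^ 4 - 7618 * s ^ 3 +
      187541 * s ^ 2 + 355884 * s + 191844 = 0 := by
  have hl := h.linear_eq (e := s / 2) (by linarith) (by linarith) (by linarith)
  have hU := h.hU
  rw [show A + B + C = s / 2 by linarith] at hU
  have h1 : (1 - 2 * s) ^ 2 ≠ 0 := pow_ne_zero _ (by linarith)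
  refine mul_left_cancel₀ h1 ?_
  generalize hal : 48 * (s / 2) ^ 4 - 8 * (s / 2) ^ 3 - 28 * (s / 2) ^ 2 + 74 * (s / 2) - 302 = al
    at hl
  generalize hbe : 16 * (s / 2) ^ 5 - 48 * (s / 2) ^ 4 - 476 * (s / 2) ^ 3 - 492 * (s / 2) ^ 2 +
    405 * (s / 2) + 385 = be at hl
  have hr : (1 - 4 * (s / 2)) * be ^ 2 + (-2 * (s / 2) ^ 2 + 4 * (s / 2) + 4) * al * be +
      (2 * (s / 2) ^ 3 + 10 * (s / 2) ^ 2 + 12 * (s / 2) + 4) * al ^ 2 = 0 := by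
    linear_combination al ^ 2 * hU - ((1 - 4 * (s / 2)) * (al * w + be) +
      (-2 * (s / 2) ^ 2 + 4 * (s / 2) + 4) * al) * hl
  rw [← hal, ← hbe] at hr
  linear_combination 4 * hr

end PlanarRelations

/-! ### Bordered circulant matrices -/

/-- Positions of the five symbols `1, …, 5` in the symmetric sequence on `ℤ/9`. -/
def seqIdx : Fin 9 → Fin 6 := ![5, 2, 3, 4, 1, 1, 4, 3, 2]

/-- Symbol pattern of a bordered circulant matrix of order ten; the border has symbol `0`. -/
def coreIdx (j k : Fin 10) : Fin 6 :=
  Fin.cases 0 (fun j' : Fin 9 => Fin.cases 0 (fun k' : Fin 9 => seqIdx (j' - k')) k) j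

/-- The bordered circulant matrix with symbols `g`. -/
def coreMatrix (g : Fin 6 → ℂ) : Matrix (Fin 10) (Fin 10) ℂ :=
  Matrix.of fun j k => g (coreIdx j k)

theorem coreMatrix_apply (g : Fin 6 → ℂ) (j k : Fin 10) : coreMatrix g j k = g (coreIdx j k) := rfl

theorem coreMatrix_zero_left (g : Fin 6 → ℂ) (k : Fin 10) : coreMatrix g 0 k = g 0 := rfl

theorem coreMatrix_zero_right (g : Fin 6 → ℂ) (j : Fin 10) : coreMatrix g j 0 = g 0 := by
  refine Fin.cases rfl (fun j => rfl) j

theorem coreMatrix_succ (g : Fin 6 → ℂ) (j k : Fin 9) :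
    coreMatrix g j.succ k.succ = g (seqIdx (j - k)) := rfl

/-- The border contributes `1` to the product of any two distinct rows, and the core sum `-1`
cancels it. -/
theorem isComplexHadamard_coreMatrix {g : Fin 6 → ℂ} (h0 : g 0 = 1) (hg : ∀ i, ‖g i‖ = 1)
    (hsum : ∑ d, g (seqIdx d) = -1)
    (hauto : ∀ r : Fin 9, r ≠ 0 →
      ∑ d, g (seqIdx (d + r)) * (starRingEnd ℂ) (g (seqIdx d)) = -1) :
    IsComplexHadamard (coreMatrix g) := by
  rw [isComplexHadamard_iff]
  have hrow : ∀ j : Fin 9, ∑ k, g (seqIdx (j - k)) = -1 := fun j => by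
    rw [← hsum]
    exact Equiv.sum_comp (Equiv.subLeft j) (fun d => g (seqIdx d))
  refine ⟨fun j k => hg _, fun j l => ?_⟩
  rw [Fin.sum_univ_succ, coreMatrix_zero_right, coreMatrix_zero_right, h0, map_one, mul_one]
  refine Fin.cases ?_ (fun j => ?_) j <;> refine Fin.cases ?_ (fun l => ?_) l
  · simp only [coreMatrix_zero_left, h0]
    norm_num
  · simp only [coreMatrix_zero_left, h0, coreMatrix_succ, one_mul]
    rw [← map_sum, hrow]
    simp [(Fin.succ_ne_zero l).symm]
  · simp only [coreMatrix_zero_left, h0, coreMatrix_succ, map_one, mul_one]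
    rw [hrow]
    simp
  · simp only [coreMatrix_succ]
    by_cases hjl : j = l
    · subst hjl
      simp only [mul_conj_of_norm_one (hg _)]
      norm_num
    · have h1 : ∑ k, g (seqIdx (j - k)) * (starRingEnd ℂ) (g (seqIdx (l - k))) = -1 := by
        rw [← hauto (j - l) (sub_ne_zero.2 hjl)]
        have := Equiv.sum_comp (Equiv.subLeft l)
          (fun d => g (seqIdx (d + (j - l))) * (starRingEnd ℂ) (g (seqIdx d)))
        rw [← this]
        refine Finset.sum_congr rfl fun k _ => ?_
        simp only [Equiv.subLeft_apply]
        rw [show l - k + (j - l) = j - k by abel]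
      rw [h1]
      simp [hjl]

/-- The symbols belonging to five unimodular numbers, normalized so that each core row sums to
`-1`. -/
noncomputable def coreSymbols (x y z u v : ℂ) : Fin 6 → ℂ :=
  let f := -(starRingEnd ℂ) (v + 2 * (x + y + z + u))
  ![1, f * x, f * y, f * z, f * u, f * v]

namespace IsCoreSolution

variable {x y z u v : ℂ}

/-- The squared modulus of the sum of the sequence is the sum of all its autocorrelations, `9 - 8 =
1`. -/
theorem norm_sum (h : IsCoreSolution x y z u v) : ‖v + 2 * (x + y + z + u)‖ = 1 := by
  have h1 : ip (v + (x + y + z + u) + (x + y + z + u)) (v + (x + y + z + u) + (x + y + z + u)) =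
      1 := by
    simp only [ip_add_left, ip_add_right, ip_self_of_norm_one h.hx, ip_self_of_norm_one h.hy,
      ip_self_of_norm_one h.hz, ip_self_of_norm_one h.hu, ip_self_of_norm_one h.hv]
    rw [ip_comm v x, ip_comm v y, ip_comm v z, ip_comm v u, ip_comm x z, ip_comm y x, ip_comm z y,
      ip_comm u x, ip_comm u y, ip_comm u z]
    linear_combination 4 * (h.r₁ + h.r₂ + h.r₃ + h.r₄)
  rw [show v + 2 * (x + y + z + u) = v + (x + y + z + u) + (x + y + z + u) by ring]
  rw [ip_self] at h1
  exact (pow_eq_one_iff_of_nonneg (norm_nonneg _) two_ne_zero).1 h1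

theorem norm_coreSymbols (h : IsCoreSolution x y z u v) (i : Fin 6) :
    ‖coreSymbols x y z u v i‖ = 1 := by
  have hS := h.norm_sum
  have hf : ‖-(starRingEnd ℂ) (v + 2 * (x + y + z + u))‖ = 1 := by
    rw [norm_neg, RCLike.norm_conj, hS]
  unfold coreSymbols
  fin_cases i <;> simp only [Fin.zero_eta, Fin.mk_one, Fin.reduceFinMk, Matrix.cons_val, norm_mul,
    hf, h.hx, h.hy, h.hz, h.hu, h.hv, one_mul, norm_one]

theorem ofReal_two_ip (p q : ℂ) :
    p * (starRingEnd ℂ) q + q * (starRingEnd ℂ) p = ((2 * ip p q : ℝ) : ℂ) := by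
  apply Complex.ext <;> simp [ip] <;> ring

theorem isComplexHadamard (h : IsCoreSolution x y z u v) :
    IsComplexHadamard (coreMatrix (coreSymbols x y z u v)) := by
  have hS := conj_mul_of_norm_one h.norm_sum
  have hff : ∀ p q : ℂ, (-(starRingEnd ℂ) (v + 2 * (x + y + z + u)) * p) *
      (starRingEnd ℂ) (-(starRingEnd ℂ) (v + 2 * (x + y + z + u)) * q) =
        p * (starRingEnd ℂ) q := by
    intro p q
    rw [map_mul, map_neg, Complex.conj_conj]
    linear_combination p * (starRingEnd ℂ) q * hS
  have c1 := congrArg (fun r : ℝ => ((2 * r : ℝ) : ℂ)) h.r₁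
  have c2 := congrArg (fun r : ℝ => ((2 * r : ℝ) : ℂ)) h.r₂
  have c3 := congrArg (fun r : ℝ => ((2 * r : ℝ) : ℂ)) h.r₃
  have c4 := congrArg (fun r : ℝ => ((2 * r : ℝ) : ℂ)) h.r₄
  simp only [mul_add, Complex.ofReal_add, ← ofReal_two_ip] at c1 c2 c3 c4
  norm_num at c1 c2 c3 c4
  have nx := mul_conj_of_norm_one h.hx
  have ny := mul_conj_of_norm_one h.hy
  have nz := mul_conj_of_norm_one h.hz
  have nu := mul_conj_of_norm_one h.hu
  refine isComplexHadamard_coreMatrix rfl h.norm_coreSymbols ?_ ?_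
  · simp only [seqIdx, coreSymbols, Fin.sum_univ_succ, Fin.sum_univ_zero]
    simp [Fin.succ_one_eq_two]
    simp at hS
    linear_combination -hS
  · intro r hr
    have hp : ∀ d, coreSymbols x y z u v (seqIdx d) =
        -(starRingEnd ℂ) (v + 2 * (x + y + z + u)) * (![v, y, z, u, x, x, u, z,
            y] : Fin 9 → ℂ) d := by
      intro d
      fin_cases d <;> rfl
    simp only [hp, hff]
    simp only [Fin.sum_univ_succ, Fin.sum_univ_zero]
    fin_cases r
    · exact absurd rfl hr
    all_goals simp
    -- Shifts `r` and `-r` give the same equation, and the fixed pair of equal symbols supplies the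
    -- extra `1`. Shift three belongs to `r₄` and shift four to `r₃`.
    · linear_combination c1 + nx
    · linear_combination c2 + ny
    · linear_combination c4 + nu
    · linear_combination c3 + nz
    · linear_combination c3 + nz
    · linear_combination c4 + nu
    · linear_combination c2 + ny
    · linear_combination c1 + nx

end IsCoreSolution

/-! ### Symmetries: rotation, conjugation and common phase -/

/-- The permutation `j ↦ 2 j` of the core indices. -/
def doublePerm : Equiv.Perm (Fin 10) where
  toFun := ![0, 1, 3, 5, 7, 9, 2, 4, 6, 8]
  invFun := ![0, 1, 6, 2, 7, 3, 8, 4, 9, 5]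
  left_inv := by decide
  right_inv := by decide

/-- Doubling on `ℤ/9` fixes the classes of `0` and `±3` and permutes `±1, ±2, ±4` cyclically, so it
rotates `x, y, z` and keeps `u, v`. -/
theorem coreIdx_doublePerm : ∀ j k, coreIdx (doublePerm j) (doublePerm k) =
    (![0, 2, 3, 1, 4, 5] : Fin 6 → Fin 6) (coreIdx j k) := by
  decide

theorem coreSymbols_rotate (x y z u v : ℂ) (i : Fin 6) :
    coreSymbols y z x u v i = coreSymbols x y z u v ((![0, 2, 3, 1, 4, 5] : Fin 6 → Fin 6) i) := by
  have : y + z + x + u = x + y + z + u := by ring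
  unfold coreSymbols
  rw [this]
  fin_cases i <;> rfl

theorem hadamardEquiv_coreMatrix_rotate (x y z u v : ℂ) :
    HadamardEquiv (coreMatrix (coreSymbols y z x u v)) (coreMatrix (coreSymbols x y z u v)) := by
  rw [hadamardEquiv_iff]
  refine ⟨fun _ => 1, fun _ => 1, doublePerm, doublePerm, by simp, by simp, fun j k => ?_⟩
  rw [coreMatrix_apply, coreMatrix_apply, coreIdx_doublePerm, coreSymbols_rotate]
  simp

theorem coreMatrix_conj (x y z u v : ℂ) :
    coreMatrix (coreSymbols ((starRingEnd ℂ) x) ((starRingEnd ℂ) y) ((starRingEnd ℂ) z)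
      ((starRingEnd ℂ) u) ((starRingEnd ℂ) v)) = conjMatrix (coreMatrix (coreSymbols x y z u v)) :=
          by
  ext j k
  simp only [conjMatrix, Matrix.map_apply, coreMatrix_apply]
  generalize coreIdx j k = i
  unfold coreSymbols
  fin_cases i <;> simp [map_ofNat (starRingEnd ℂ) 2]

/-- The normalizing factor is conjugate-linear in the sequence and absorbs the phase. -/
theorem coreSymbols_smul {t : ℂ} (ht : ‖t‖ = 1) (x y z u v : ℂ) :
    coreSymbols (t * x) (t * y) (t * z) (t * u) (t * v) = coreSymbols x y z u v := by
  have h := conj_mul_of_norm_one ht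
  have key : ∀ p : ℂ, -(starRingEnd ℂ) (t * v + 2 * (t * x + t * y + t * z + t * u)) * (t * p) =
      -(starRingEnd ℂ) (v + 2 * (x + y + z + u)) * p := by
    intro p
    rw [show t * v + 2 * (t * x + t * y + t * z + t * u) = t * (v + 2 * (x + y + z + u)) by ring,
      map_mul]
    linear_combination -(starRingEnd ℂ) (v + 2 * (x + y + z + u)) * p * h
  simp only [coreSymbols, key]

theorem ip_mul_left {t : ℂ} (ht : ‖t‖ = 1) (p q : ℂ) : ip (t * p) (t * q) = ip p q := by
  have h := ip_self_of_norm_one ht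
  unfold ip at *
  simp only [Complex.mul_re, Complex.mul_im]
  linear_combination (p.re * q.re + p.im * q.im) * h

theorem ip_conj (p q : ℂ) : ip ((starRingEnd ℂ) p) ((starRingEnd ℂ) q) = ip p q := by
  simp [ip]

namespace IsCoreSolution

variable {x y z u v : ℂ}

theorem rotate (h : IsCoreSolution x y z u v) : IsCoreSolution y z x u v where
  hx := h.hy
  hy := h.hz
  hz := h.hx
  hu := h.hu
  hv := h.hv
  r₁ := by linear_combination h.r₂
  r₂ := by linear_combination h.r₃
  r₃ := by linear_combination h.r₁
  r₄ := by linear_combination h.r₄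

theorem conj (h : IsCoreSolution x y z u v) :
    IsCoreSolution ((starRingEnd ℂ) x) ((starRingEnd ℂ) y) ((starRingEnd ℂ) z)
      ((starRingEnd ℂ) u) ((starRingEnd ℂ) v) where
  hx := by rw [RCLike.norm_conj, h.hx]
  hy := by rw [RCLike.norm_conj, h.hy]
  hz := by rw [RCLike.norm_conj, h.hz]
  hu := by rw [RCLike.norm_conj, h.hu]
  hv := by rw [RCLike.norm_conj, h.hv]
  r₁ := by simpa only [ip_conj] using h.r₁
  r₂ := by simpa only [ip_conj] using h.r₂
  r₃ := by simpa only [ip_conj] using h.r₃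
  r₄ := by simpa only [ip_conj] using h.r₄

theorem smul (h : IsCoreSolution x y z u v) {t : ℂ} (ht : ‖t‖ = 1) :
    IsCoreSolution (t * x) (t * y) (t * z) (t * u) (t * v) where
  hx := by rw [norm_mul, ht, h.hx, one_mul]
  hy := by rw [norm_mul, ht, h.hy, one_mul]
  hz := by rw [norm_mul, ht, h.hz, one_mul]
  hu := by rw [norm_mul, ht, h.hu, one_mul]
  hv := by rw [norm_mul, ht, h.hv, one_mul]
  r₁ := by simpa only [ip_mul_left ht] using h.r₁
  r₂ := by simpa only [ip_mul_left ht] using h.r₂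
  r₃ := by simpa only [ip_mul_left ht] using h.r₃
  r₄ := by simpa only [ip_mul_left ht] using h.r₄

end IsCoreSolution

/-! ### Identification of the matrix with a bordered circulant -/

/-- Row correspondence between `Y_{10A}` and the bordered circulant matrix. -/
def rowPerm : Equiv.Perm (Fin 10) where
  toFun := ![2, 0, 4, 1, 6, 8, 7, 5, 9, 3]
  invFun := ![1, 3, 0, 9, 2, 7, 4, 6, 5, 8]
  left_inv := by decide
  right_inv := by decide

/-- Column correspondence between `Y_{10A}` and the bordered circulant matrix. -/
def colPerm : Equiv.Perm (Fin 10) where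
  toFun := ![7, 0, 5, 8, 3, 1, 2, 4, 9, 6]
  invFun := ![1, 5, 6, 4, 7, 2, 9, 0, 3, 8]
  left_inv := by decide
  right_inv := by decide

theorem coreIdx_rowPerm_colPerm : ∀ j k, coreIdx (rowPerm j) (colPerm k) =
    (![![1, 0, 4, 4, 2, 2, 5, 3, 3, 1], ![0, 0, 0, 0, 0, 0, 0, 0, 0, 0],
      ![4, 0, 2, 1, 2, 4, 3, 5, 1, 3], ![4, 0, 1, 3, 3, 5, 2, 4, 2, 1],
      ![2, 0, 2, 3, 4, 1, 1, 3, 4, 5], ![2, 0, 4, 5, 1, 3, 4, 1, 2, 3],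
      ![5, 0, 3, 2, 1, 4, 1, 4, 3, 2], ![3, 0, 5, 4, 3, 1, 4, 2, 1, 2],
      ![3, 0, 1, 2, 4, 2, 3, 1, 5, 4], ![1, 0, 3, 1, 5, 3, 2, 2, 4, 4]] :
        Fin 10 → Fin 10 → Fin 6) j k := by
  decide

set_option maxHeartbeats 4000000 in
theorem hadamardEquiv_y10A {a b c d : ℂ} (h : IsUnimodularY10ASolution a b c d) :
    IsCoreSolution 1 (1 / a) (1 / c) d (1 / (a * b)) ∧
      HadamardEquiv (y10A a b c d)
        (coreMatrix (coreSymbols 1 (1 / a) (1 / c) d (1 / (a * b)))) := by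
  obtain ⟨ha, hb, hc, hd, -⟩ := id h
  have na : a ≠ 0 := norm_ne_zero_iff.1 (by rw [ha]; norm_num)
  have nb : b ≠ 0 := norm_ne_zero_iff.1 (by rw [hb]; norm_num)
  have nc : c ≠ 0 := norm_ne_zero_iff.1 (by rw [hc]; norm_num)
  have nd : d ≠ 0 := norm_ne_zero_iff.1 (by rw [hd]; norm_num)
  have hsol : IsCoreSolution 1 (1 / a) (1 / c) d (1 / (a * b)) := by
    rw [← isUnimodularY10ASolution_iff (by simp) (by simp [ha]) (by simp [hc]) hd
      (by simp [ha, hb])]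
    convert h using 1 <;> field_simp
  refine ⟨hsol, ?_⟩
  have hci : ∀ p : ℂ, ‖p‖ = 1 → (starRingEnd ℂ) p = 1 / p := fun p hp =>
    eq_one_div_of_mul_eq_one_right (mul_conj_of_norm_one hp)
  have hf : -(starRingEnd ℂ) (1 / (a * b) + 2 * (1 + 1 / a + 1 / c + d)) =
      -a * (2 + b) - 2 * (1 + d + c * d) / d := by
    simp only [map_add, map_mul, map_div₀, map_one, map_ofNat, hci a ha, hci b hb, hci c hc,
      hci d hd]
    field_simp
    ring
  have hnf : ‖-(starRingEnd ℂ) (1 / (a * b) + 2 * (1 + 1 / a + 1 / c + d))‖ = 1 := by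
    rw [norm_neg, RCLike.norm_conj]
    exact hsol.norm_sum
  rw [hadamardEquiv_iff]
  unfold y10A coreSymbols
  rw [← hf]
  generalize -(starRingEnd ℂ) (1 / (a * b) + 2 * (1 + 1 / a + 1 / c + d)) = f at hnf
  have nf : f ≠ 0 := norm_ne_zero_iff.1 (by rw [hnf]; norm_num)
  -- The border of ones corresponds to the second row and column of `Y_{10A}`. Hence the row phases
  -- are its second column, and the column phases are its second row divided by `f`.
  refine ⟨![1, f, 1 / d, 1 / d, a, a, b * a, c, c, 1],
    ![1 / f, 1, 1 / (d * f), 1 / (d * f), a / f, a / f, b * a / f, c / f, c / f, 1 / f],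
    rowPerm, colPerm, ?_, ?_, ?_⟩
  · intro j
    fin_cases j <;> simp [ha, hb, hc, hd, hnf]
  · intro j
    fin_cases j <;> simp [ha, hb, hc, hd, hnf]
  · intro j k
    rw [coreMatrix_apply, coreIdx_rowPerm_colPerm]
    fin_cases j <;> fin_cases k <;> simp [y10AShape] <;> field_simp

/-! ### Defect zero by an approximate left inverse -/

section Weights

/-- Summation by shifting: collects the coefficient of each unknown `Q d l` in a weighted family of
convolution equations. -/
theorem weighted_sum_regroup (s : Fin 10 → Fin 9) (χ : Fin 10 → ℝ) (w G : Fin 10 → Fin 9 → ℝ)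
    (Q : Fin 9 → Fin 9 → ℝ) :
    ∑ t, ∑ l, w t l * ∑ d, G t d * (Q (d + s t) (l + s t) - χ t * Q d l) =
      ∑ d, ∑ l, (∑ t, (w t (l - s t) * G t (d - s t) - χ t * (w t l * G t d))) * Q d l := by
  have h1 : ∀ t, ∑ l, w t l * ∑ d, G t d * (Q (d + s t) (l + s t) - χ t * Q d l) =
      ∑ d, ∑ l, (w t (l - s t) * G t (d - s t) - χ t * (w t l * G t d)) * Q d l := by
    intro t
    have e1 : ∑ l, w t l * ∑ d, G t d * Q (d + s t) (l + s t) =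
        ∑ d, ∑ l, w t (l - s t) * G t (d - s t) * Q d l := by
      simp only [Finset.mul_sum]
      rw [← Equiv.sum_comp (Equiv.subRight (s t)), Finset.sum_comm,
        ← Equiv.sum_comp (Equiv.subRight (s t))]
      refine Finset.sum_congr rfl fun d _ => Finset.sum_congr rfl fun l _ => ?_
      simp only [Equiv.subRight_apply, sub_add_cancel]
      ring
    have e2 : ∑ l, w t l * ∑ d, G t d * (χ t * Q d l) =
        ∑ d, ∑ l, χ t * (w t l * G t d) * Q d l := by
      simp only [Finset.mul_sum]
      rw [Finset.sum_comm]
      exact Finset.sum_congr rfl fun d _ => Finset.sum_congr rfl fun l _ => by ring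
    simp only [mul_sub, sub_mul, Finset.sum_sub_distrib]
    rw [e1, e2]
  rw [Finset.sum_congr rfl fun t _ => h1 t, Finset.sum_comm]
  refine Finset.sum_congr rfl fun d _ => ?_
  rw [Finset.sum_comm]
  exact Finset.sum_congr rfl fun l _ => (Finset.sum_mul ..).symm

/-- If weighted combinations of approximate convolution equations nearly isolate each unknown, then
the exact equations have only the zero solution. -/
theorem eq_zero_of_approx_inverse (s : Fin 10 → Fin 9) (χ : Fin 10 → ℤ) (hχ : ∀ t, |χ t| ≤ 1)
    (K : Fin 10 → Fin 9 → ℝ) (G : Fin 10 → Fin 9 → ℤ)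
    (hG : ∀ t d, |K t d - G t d / 10 ^ 12| ≤ 6 / 10 ^ 6)
    (w : Fin 9 → Fin 10 → Fin 9 → ℤ)
    (hw : ∀ i, ∑ t, ∑ l, (w i t l).natAbs ≤ 40000)
    (hc : ∀ i, ∑ d, ∑ l, ((∑ t, (w i t (l - s t) * G t (d - s t) - χ t * (w i t l * G t d))) -
      if d = i ∧ l = 0 then 10 ^ 15 else 0).natAbs ≤ 3 * 10 ^ 14)
    (Q : Fin 9 → Fin 9 → ℝ)
    (hQ : ∀ t l, ∑ d, K t d * (Q (d + s t) (l + s t) - χ t * Q d l) = 0) : Q = 0 := by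
  obtain ⟨⟨i, m⟩, -, hmax⟩ := Finset.exists_max_image (Finset.univ : Finset (Fin 9 × Fin 9))
    (fun p => |Q p.1 p.2|) Finset.univ_nonempty
  set M := |Q i m| with hM
  have hle : ∀ d l, |Q d l| ≤ M := fun d l => hmax (d, l) (Finset.mem_univ _)
  have hM0 : 0 ≤ M := abs_nonneg _
  -- The coefficients do not depend on `l`, so the maximal entry may be shifted to `l = 0`. This is
  -- why nine families of weights suffice for 81 unknowns.
  set P : Fin 9 → Fin 9 → ℝ := fun d l => Q d (l + m) with hP
  have hPQ : ∀ t l, ∑ d, K t d * (P (d + s t) (l + s t) - χ t * P d l) = 0 := by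
    intro t l
    rw [← hQ t (l + m)]
    refine Finset.sum_congr rfl fun d _ => ?_
    simp only [hP]
    rw [add_right_comm l (s t) m]
  have hPle : ∀ d l, |P d l| ≤ M := fun d l => hle _ _
  have hdiff : ∀ t d l, |P (d + s t) (l + s t) - χ t * P d l| ≤ 2 * M := by
    intro t d l
    have h1 : |(χ t : ℝ)| ≤ 1 := by exact_mod_cast hχ t
    have h2 : |(χ t : ℝ) * P d l| ≤ M := by
      rw [abs_mul]
      calc |(χ t : ℝ)| * |P d l| ≤ 1 * M := by
            gcongr
            exact hPle d l
        _ = M := one_mul M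
    have := abs_sub (P (d + s t) (l + s t)) (χ t * P d l)
    linarith [hPle (d + s t) (l + s t)]
  -- Nine terms, each with coefficient error `10 ^ 12 * (6 / 10 ^ 6)` and variable part at most `2 *
  -- M`.
  have hE : ∀ t l, |∑ d, (G t d : ℝ) * (P (d + s t) (l + s t) - χ t * P d l)| ≤ 108 * 10 ^ 6 * M :=
      by
    intro t l
    have h1 : ∑ d, (G t d : ℝ) * (P (d + s t) (l + s t) - χ t * P d l) =
        ∑ d, -10 ^ 12 * (K t d - G t d / 10 ^ 12) * (P (d + s t) (l + s t) - χ t * P d l) := by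
      have h2 := hPQ t l
      rw [← sub_zero (∑ d, (G t d : ℝ) * _), ← mul_zero (10 ^ 12 : ℝ), ← h2, Finset.mul_sum,
        ← Finset.sum_sub_distrib]
      exact Finset.sum_congr rfl fun d _ => by ring
    rw [h1]
    refine (Finset.abs_sum_le_sum_abs _ _).trans ?_
    calc _ ≤ ∑ _d : Fin 9, 12 * 10 ^ 6 * M := by
          refine Finset.sum_le_sum fun d _ => ?_
          rw [abs_mul, abs_mul, abs_neg, abs_of_pos (by positivity : (0 : ℝ) < 10 ^ 12)]
          calc _ ≤ 10 ^ 12 * (6 / 10 ^ 6) * (2 * M) := by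
                gcongr
                · exact hG t d
                · exact hdiff t d l
            _ = _ := by ring
      _ = _ := by simp; ring
  have hsum : |∑ t, ∑ l, (w i t l : ℝ) * ∑ d, (G t d : ℝ) *
      (P (d + s t) (l + s t) - χ t * P d l)| ≤ 40000 * (108 * 10 ^ 6 * M) := by
    refine (Finset.abs_sum_le_sum_abs _ _).trans ?_
    have h1 : ∑ t, ∑ l, |(w i t l : ℝ)| ≤ 40000 := by
      have h2 := hw i
      have h3 : ((∑ t, ∑ l, (w i t l).natAbs : ℕ) : ℝ) ≤ 40000 := by exact_mod_cast h2
      rw [Nat.cast_sum] at h3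
      simp only [Nat.cast_sum, Nat.cast_natAbs, Int.cast_abs] at h3
      exact h3
    calc _ ≤ ∑ t, ∑ l, |(w i t l : ℝ)| * (108 * 10 ^ 6 * M) := by
          refine Finset.sum_le_sum fun t _ => (Finset.abs_sum_le_sum_abs _ _).trans ?_
          refine Finset.sum_le_sum fun l _ => ?_
          rw [abs_mul]
          exact mul_le_mul_of_nonneg_left (hE t l) (abs_nonneg _)
      _ = (∑ t, ∑ l, |(w i t l : ℝ)|) * (108 * 10 ^ 6 * M) := by
          simp only [Finset.sum_mul]
      _ ≤ _ := by gcongr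
  rw [weighted_sum_regroup s (fun t => χ t) (fun t l => w i t l) (fun t d => G t d) P] at hsum
  set c : Fin 9 → Fin 9 → ℤ := fun d l =>
    ∑ t, (w i t (l - s t) * G t (d - s t) - χ t * (w i t l * G t d)) with hcdef
  have hcast : ∀ d l, ∑ t, ((w i t (l - s t) : ℝ) * G t (d - s t) - χ t * (w i t l * G t d)) =
      (c d l : ℝ) := by
    intro d l
    simp only [hcdef]
    push_cast
    rfl
  simp only [hcast] at hsum
  have hsplit : ∑ d, ∑ l, (c d l : ℝ) * P d l = 10 ^ 15 * P i 0 +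
      ∑ d, ∑ l, ((c d l - if d = i ∧ l = 0 then 10 ^ 15 else 0 : ℤ) : ℝ) * P d l := by
    have h1 : ∑ d, ∑ l, ((if d = i ∧ l = 0 then 10 ^ 15 else 0 : ℤ) : ℝ) * P d l =
        10 ^ 15 * P i 0 := by
      rw [Finset.sum_eq_single i, Finset.sum_eq_single 0]
      · simp only [and_self, if_true]
        norm_num
      · intro l _ hl
        simp [hl]
      · simp
      · intro d _ hd
        simp [hd]
      · simp
    rw [← h1, ← Finset.sum_add_distrib]
    refine Finset.sum_congr rfl fun d _ => ?_
    rw [← Finset.sum_add_distrib]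
    refine Finset.sum_congr rfl fun l _ => ?_
    rw [Int.cast_sub]
    ring
  have herr : |∑ d, ∑ l, ((c d l - if d = i ∧ l = 0 then 10 ^ 15 else 0 : ℤ) : ℝ) * P d l| ≤
      3 * 10 ^ 14 * M := by
    refine (Finset.abs_sum_le_sum_abs _ _).trans ?_
    have h1 : ∑ d, ∑ l, |((c d l - if d = i ∧ l = 0 then 10 ^ 15 else 0 : ℤ) : ℝ)| ≤
        3 * 10 ^ 14 := by
      have h2 := hc i
      have h3 : ((∑ d, ∑ l, (c d l - if d = i ∧ l = 0 then 10 ^ 15 else 0).natAbs : ℕ) : ℝ) ≤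
          3 * 10 ^ 14 := by exact_mod_cast h2
      rw [Nat.cast_sum] at h3
      simp only [Nat.cast_sum, Nat.cast_natAbs, Int.cast_abs] at h3
      exact h3
    calc _ ≤ ∑ d, ∑ l, |((c d l - if d = i ∧ l = 0 then 10 ^ 15 else 0 : ℤ) : ℝ)| * M := by
          refine Finset.sum_le_sum fun d _ => (Finset.abs_sum_le_sum_abs _ _).trans ?_
          refine Finset.sum_le_sum fun l _ => ?_
          rw [abs_mul]
          exact mul_le_mul_of_nonneg_left (hPle d l) (abs_nonneg _)
      _ = (∑ d, ∑ l, |((c d l - if d = i ∧ l = 0 then 10 ^ 15 else 0 : ℤ) : ℝ)|) * M := by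
          simp only [Finset.sum_mul]
      _ ≤ _ := by gcongr
  rw [hsplit] at hsum
  have hP0 : |P i 0| = M := by simp [hP, hM]
  -- The total error is about `0.31 * 10 ^ 15 * M`, so the near-identity is diagonally dominant and
  -- `M = 0`.
  have hfin : 10 ^ 15 * M ≤ 40000 * (108 * 10 ^ 6 * M) + 3 * 10 ^ 14 * M := by
    rw [← hP0, ← abs_of_pos (by positivity : (0 : ℝ) < 10 ^ 15), ← abs_mul, hP0]
    have := abs_sub_abs_le_abs_sub (10 ^ 15 * P i 0 + ∑ d, ∑ l,
      ((c d l - if d = i ∧ l = 0 then 10 ^ 15 else 0 : ℤ) : ℝ) * P d l) (∑ d, ∑ l,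
      ((c d l - if d = i ∧ l = 0 then 10 ^ 15 else 0 : ℤ) : ℝ) * P d l)
    have h4 := abs_sub (10 ^ 15 * P i 0 + ∑ d, ∑ l,
      ((c d l - if d = i ∧ l = 0 then 10 ^ 15 else 0 : ℤ) : ℝ) * P d l) (∑ d, ∑ l,
      ((c d l - if d = i ∧ l = 0 then 10 ^ 15 else 0 : ℤ) : ℝ) * P d l)
    rw [add_sub_cancel_right] at h4
    linarith
  have hMz : M = 0 := by nlinarith
  ext d l
  have := hle d l
  rw [hMz] at this
  simpa using this

end Weights

/-- Shift belonging to a real equation: two real equations for each complex one. -/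
def eqShift (t : Fin 10) : Fin 9 := ⟨t / 2, by omega⟩

/-- Equations with shift zero contain a single term. -/
def eqSign (t : Fin 10) : ℤ := if eqShift t = 0 then 0 else 1

/-- Integer approximations (scaled by `10 ^ 12`) of the coefficients of the real equations. -/
def eqCoeff (p q : Fin 6 → ℤ) (t : Fin 10) (d : Fin 9) : ℤ :=
  let r := eqShift t
  if r = 0 then 10 ^ 6 * (if t.val % 2 = 0 then p (seqIdx d) else q (seqIdx d))
  else if t.val % 2 = 0 then
    p (seqIdx (d + r)) * p (seqIdx d) + q (seqIdx (d + r)) * q (seqIdx d)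
  else q (seqIdx (d + r)) * p (seqIdx d) - p (seqIdx (d + r)) * q (seqIdx d)

/-- `p i + q i * I`, divided by `10 ^ 6`, is within `2 / 10 ^ 6` of `g i`. -/
def ApproxSymbols (g : Fin 6 → ℂ) (p q : Fin 6 → ℤ) : Prop :=
  ∀ i, ‖g i - ((p i : ℂ) + q i * Complex.I) / 10 ^ 6‖ ≤ 2 / 10 ^ 6

/-- Indexing the core variation by the difference `d = j - k` and the row `l` turns the
orthogonality of rows `l + r` and `l` into convolution equations. The border row gives the case `r =
0`. Shifts up to four already determine the system, since the others are conjugate to these. -/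
theorem hadamardDefect_coreMatrix_eq_zero {g : Fin 6 → ℂ} (h0 : g 0 = 1) (hg : ∀ i, ‖g i‖ = 1)
    (hH : IsComplexHadamard (coreMatrix g)) {p q : Fin 6 → ℤ} (hpq : ApproxSymbols g p q)
    (w : Fin 9 → Fin 10 → Fin 9 → ℤ)
    (hw : ∀ i, ∑ t, ∑ l, (w i t l).natAbs ≤ 40000)
    (hc : ∀ i, ∑ d, ∑ l, ((∑ t, (w i t (l - eqShift t) * eqCoeff p q t (d - eqShift t) -
      eqSign t * (w i t l * eqCoeff p q t d))) -
      if d = i ∧ l = 0 then 10 ^ 15 else 0).natAbs ≤ 3 * 10 ^ 14) :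
    hadamardDefect (coreMatrix g) = 0 := by
  rw [hadamardDefect_eq_zero_iff hH]
  intro R hR hrow hcol
  rw [mem_phaseVariations] at hR
  set c : Fin 9 → ℂ := fun d => g (seqIdx d) with hcd
  set G : Fin 10 → Fin 9 → ℂ := fun t d =>
    if eqShift t = 0 then c d else c (d + eqShift t) * (starRingEnd ℂ) (c d) with hG
  set Q : Fin 9 → Fin 9 → ℝ := fun d l => R l.succ (l - d).succ with hQ
  have hE : ∀ t l, ∑ d, G t d * ((Q (d + eqShift t) (l + eqShift t) - eqSign t * Q d l : ℝ) : ℂ)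
      = 0 := by
    intro t l
    by_cases ht : eqShift t = 0
    · have h1 := hR l.succ 0
      rw [Fin.sum_univ_succ] at h1
      simp only [coreMatrix_zero_left, coreMatrix_zero_right, coreMatrix_succ, hrow, hcol, h0,
        map_one, mul_one, Complex.ofReal_zero, sub_zero, mul_zero, zero_add] at h1
      rw [← h1, ← Equiv.sum_comp (Equiv.subLeft l)]
      refine Finset.sum_congr rfl fun d _ => ?_
      simp [hG, hQ, hcd, ht, eqSign]
    · have h1 := hR (l + eqShift t).succ l.succ
      rw [Fin.sum_univ_succ] at h1
      simp only [coreMatrix_zero_right, coreMatrix_succ, hcol, Complex.ofReal_zero, sub_zero,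
        mul_zero, zero_add] at h1
      rw [← h1, ← Equiv.sum_comp (Equiv.subLeft l)]
      refine Finset.sum_congr rfl fun d _ => ?_
      simp only [hG, hQ, hcd, ht, eqSign, if_false, Equiv.subLeft_apply, Int.cast_one, one_mul]
      have e1 : l - d + eqShift t = l + eqShift t - d := by abel
      have e2 : l + eqShift t - (l + eqShift t - d) = d := by abel
      have e3 : l - (l - d) = d := by abel
      rw [e1, e2, e3]
      push_cast
      ring
  set K : Fin 10 → Fin 9 → ℝ := fun t d => if t.val % 2 = 0 then (G t d).re else (G t d).im with hK
  have hKE : ∀ t l, ∑ d, K t d * (Q (d + eqShift t) (l + eqShift t) - eqSign t * Q d l) = 0 := by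
    intro t l
    have h1 := hE t l
    by_cases ht : t.val % 2 = 0
    · have h2 := congrArg Complex.re h1
      rw [Complex.re_sum] at h2
      simp only [Complex.re_mul_ofReal, Complex.zero_re] at h2
      simpa [hK, ht] using h2
    · have h2 := congrArg Complex.im h1
      rw [Complex.im_sum] at h2
      simp only [Complex.im_mul_ofReal, Complex.zero_im] at h2
      simpa [hK, ht] using h2
  set a : Fin 6 → ℂ := fun i => ((p i : ℂ) + q i * Complex.I) / 10 ^ 6 with ha
  have ha' : ∀ i, a i = ⟨p i / 10 ^ 6, q i / 10 ^ 6⟩ := by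
    intro i
    apply Complex.ext <;> simp [ha, Complex.div_re, Complex.div_im, Complex.normSq] <;> norm_num <;>
      ring
  have hga : ∀ i, ‖g i - a i‖ ≤ 2 / 10 ^ 6 := hpq
  have hna : ∀ i, ‖a i‖ ≤ 1 + 2 / 10 ^ 6 := by
    intro i
    have h1 := norm_sub_norm_le (a i) (g i)
    rw [norm_sub_rev, hg] at h1
    linarith [hga i]
  -- Two factors with errors `2 / 10 ^ 6` would give slightly more than `4 / 10 ^ 6`; the bound is
  -- rounded up.
  have hprod : ∀ i j, ‖g i * (starRingEnd ℂ) (g j) - a i * (starRingEnd ℂ) (a j)‖ ≤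
      6 / 10 ^ 6 := by
    intro i j
    have e : g i * (starRingEnd ℂ) (g j) - a i * (starRingEnd ℂ) (a j) =
        (g i - a i) * (starRingEnd ℂ) (g j) + a i * (starRingEnd ℂ) (g j - a j) := by
      rw [map_sub]; ring
    rw [e]
    refine (norm_add_le _ _).trans ?_
    rw [norm_mul, norm_mul, RCLike.norm_conj, RCLike.norm_conj, hg]
    have h1 := mul_le_mul (hna i) (hga j) (norm_nonneg _) (by norm_num)
    have h2 := hga i
    norm_num at h1 h2 ⊢
    linarith
  have hKG : ∀ t d, |K t d - eqCoeff p q t d / 10 ^ 12| ≤ 6 / 10 ^ 6 := by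
    intro t d
    by_cases ht : eqShift t = 0
    · have hb := hga (seqIdx d)
      rw [ha'] at hb
      by_cases hp : t.val % 2 = 0
      · have h1 := (Complex.abs_re_le_norm _).trans hb
        simp only [hK, hG, eqCoeff, ht, hp, hcd, if_true, Complex.sub_re] at h1 ⊢
        push_cast
        rw [show (1000000 * (p (seqIdx d) : ℝ)) / 10 ^ 12 = p (seqIdx d) / 10 ^ 6 by ring]
        exact h1.trans (by norm_num)
      · have h1 := (Complex.abs_im_le_norm _).trans hb
        simp only [hK, hG, eqCoeff, ht, hp, hcd, if_true, if_false, Complex.sub_im] at h1 ⊢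
        push_cast
        rw [show (1000000 * (q (seqIdx d) : ℝ)) / 10 ^ 12 = q (seqIdx d) / 10 ^ 6 by ring]
        exact h1.trans (by norm_num)
    · have hb := hprod (seqIdx (d + eqShift t)) (seqIdx d)
      rw [ha', ha'] at hb
      by_cases hp : t.val % 2 = 0
      · have h1 := (Complex.abs_re_le_norm _).trans hb
        simp only [hK, hG, eqCoeff, ht, hp, hcd, if_true, if_false, Complex.sub_re] at h1 ⊢
        refine le_of_eq_of_le (congrArg _ ?_) h1
        congr 1
        simp only [Complex.mul_re, Complex.conj_re, Complex.conj_im]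
        push_cast
        ring
      · have h1 := (Complex.abs_im_le_norm _).trans hb
        simp only [hK, hG, eqCoeff, ht, hp, hcd, if_false, Complex.sub_im] at h1 ⊢
        refine le_of_eq_of_le (congrArg _ ?_) h1
        congr 1
        simp only [Complex.mul_im, Complex.conj_re, Complex.conj_im]
        push_cast
        ring
  have hQ0 := eq_zero_of_approx_inverse eqShift eqSign
    (fun t => by unfold eqSign; split <;> simp) K (eqCoeff p q) hKG w hw hc Q hKE
  ext j k
  refine Fin.cases (hrow k) (fun j => ?_) j
  refine Fin.cases (hcol _) (fun k => ?_) k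
  have := congrFun (congrFun hQ0 (j - k)) j
  simpa [hQ] using this

/-- Real parts of the symbols of the first solution, scaled by `10 ^ 6`. -/
def symbolReFirst : Fin 6 → ℤ := ![1000000, -439002, 122267, 925358, -999889, -217471]

/-- Imaginary parts of the symbols of the first solution, scaled by `10 ^ 6`. -/
def symbolImFirst : Fin 6 → ℤ := ![0, 898486, -992497, -379093, -14929, 976067]

/-- Weights for the first solution, scaled by `10 ^ 3`. -/
def weightTableFirst : List (List (List ℤ)) :=
  [[[9, 39, 38, -275, -307, -307, -275, 38, 39], [241, 31, 25, -63, -29, -29, -63, 25, 31], [83,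
  -186, -197, -201, 0, 201, 197, 186, -83], [4, 160, 147, 18, -233, 18, 147, 160, 4], [334, 250,
  101, 66, -66, -101, -250, -334, 0], [259, 51, -208, -368, -368, -208, 51, 259, 237], [-65, -25,
  112, 0, -112, 25, 65, 114, -114], [-49, -1, -119, -243, -119, -1, -49, -60, -60], [152, 102, 55,
  -55, -102, -152, -96, 0, 96], [63, 251, 340, 340, 251, 63, -194, -517, -194]], [[204, 86, -299,
  183, -165, -727, 301, -114, -469], [504, 89, -558, 789, -6, -730, 460, -86, -603], [167, 150,
  -519, 239, 440, -371, 302, 168, -728], [-197, 70, 71, -221, 180, 186, -177, 391, -75], [55, 107,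
  193, -320, -26, 84, -422, 176, 126], [-7, 36, -418, -167, 111, -102, 175, 272, -193], [198,
  -155, 128, -49, -86, 124, 109, -54, 19], [403, -147, -730, 494, 161, -335, 594, -108, -695],
  [166, 142, 54, 35, -48, -175, -80, -69, -63], [502, -448, 47, 900, -346, 301, 356, -803, 60]],
  [[390, -277, 21, -54, -630, -159, -56, -201, -33], [412, -191, 193, 381, -561, -201, 205, -310,
  110], [240, -286, -43, 419, 59, 89, 277, -175, -396], [-52, 64, -328, 226, -31, 14, 127, 312,
  90], [166, 341, -159, -6, -84, -17, 14, 103, 68], [-141, -253, -453, -87, 20, 18, 359, 126,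
  -121], [108, -241, -52, -6, -122, 66, -121, 42, 21], [-37, -580, -90, 361, -94, 168, 495, -419,
  -294], [333, 168, 135, -7, -132, -128, -92, -41, 48], [-1, -144, 626, 367, -48, 121, 60, -635,
  218]], [[-225, -77, -132, -342, 10, -354, -15, 131, 4], [-47, 313, -118, -60, -24, -299, 50,
  235, -144], [-126, 33, -1, -35, 341, 51, 1, 95, -314], [202, -81, 83, -63, -113, 303, -90, 178,
  -88], [318, 19, 154, 34, -140, 186, -116, 157, 185], [-120, -125, -235, -182, 35, 92, 169, 103,
  -11], [15, -251, -46, -118, -36, -35, -102, -100, -139], [-148, 56, -188, 6, 233, -124, 130, 40,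
  -278], [209, 126, 51, -53, -78, -100, 45, 77, 139], [129, 392, 21, 418, -188, -336, 119, -207,
  -39]], [[360, -124, -718, 339, -307, -663, 433, 188, -508], [1098, 106, -926, 750, -221, -884,
  907, 130, -748], [246, 340, -597, 465, 449, -603, 241, 224, -902], [-306, 219, -224, -242, 321,
  202, -184, 301, 5], [-413, 58, 8, -376, 21, 67, -339, 27, 196], [-298, 34, -446, -45, 339, -113,
  128, 308, -410], [280, -147, 68, 132, -70, 202, -5, -32, 117], [645, -84, -744, 852, 148, -691,
  698, -136, -1032], [220, 41, -82, -136, -162, -146, 6, 71, 6], [890, -504, 284, 825, -719, -64,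
  710, -937, 56]], [[360, -508, 188, 433, -663, -307, 339, -718, -124], [1098, -748, 130, 907,
  -884, -221, 750, -926, 106], [902, -224, -241, 603, -449, -465, 597, -340, -246], [5, 301, -184,
  202, 321, -242, -224, 219, -306], [-27, 339, -67, -21, 376, -8, -58, 413, -196], [308, 128,
  -113, 339, -45, -446, 34, -298, -410], [5, -202, 70, -132, -68, 147, -280, -117, 32], [698,
  -691, 148, 852, -744, -84, 645, -1032, -136], [146, 162, 136, 82, -41, -220, -6, -71, -6], [-64,
  -719, 825, 284, -504, 890, 56, -937, 710]], [[-225, 4, 131, -15, -354, 10, -342, -132, -77],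
  [-47, -144, 235, 50, -299, -24, -60, -118, 313], [314, -95, -1, -51, -341, 35, 1, -33, 126],
  [-88, 178, -90, 303, -113, -63, 83, -81, 202], [-157, 116, -186, 140, -34, -154, -19, -318,
  -185], [103, 169, 92, 35, -182, -235, -125, -120, -11], [102, 35, 36, 118, 46, 251, -15, 139,
  100], [130, -124, 233, 6, -188, 56, -148, -278, 40], [100, 78, 53, -51, -126, -209, -139, -77,
  -45], [-336, -188, 418, 21, 392, 129, -39, -207, 119]], [[390, -33, -201, -56, -159, -630, -54,
  21, -277], [412, 110, -310, 205, -201, -561, 381, 193, -191], [396, 175, -277, -89, -59, -419,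
  43, 286, -240], [90, 312, 127, 14, -31, 226, -328, 64, -52], [-103, -14, 17, 84, 6, 159, -341,
  -166, -68], [126, 359, 18, 20, -87, -453, -253, -141, -121], [121, -66, 122, 6, 52, 241, -108,
  -21, -42], [495, 168, -94, 361, -90, -580, -37, -294, -419], [128, 132, 7, -135, -168, -333,
  -48, 41, 92], [121, -48, 367, 626, -144, -1, 218, -635, 60]], [[204, -469, -114, 301, -727,
  -165, 183, -299, 86], [504, -603, -86, 460, -730, -6, 789, -558, 89], [728, -168, -302, 371,
  -440, -239, 519, -150, -167], [-75, 391, -177, 186, 180, -221, 71, 70, -197], [-176, 422, -84,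
  26, 320, -193, -107, -55, -126], [272, 175, -102, 111, -167, -418, 36, -7, -193], [-109, -124,
  86, 49, -128, 155, -198, -19, 54], [594, -335, 161, 494, -730, -147, 403, -695, -108], [175, 48,
  -35, -54, -142, -166, 63, 69, 80], [301, -346, 900, 47, -448, 502, 60, -803, 356]]]

/-- Access to `weightTableFirst`. -/
def weightFirst (i : Fin 9) (t : Fin 10) (l : Fin 9) : ℤ :=
  ((weightTableFirst.getD i []).getD t []).getD l 0

theorem sum_weightFirst_le : ∀ i, ∑ t, ∑ l, (weightFirst i t l).natAbs ≤ 40000 := by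
  decide +kernel

theorem weightFirst_approx_inverse : ∀ i, ∑ d, ∑ l,
    ((∑ t, (weightFirst i t (l - eqShift t) * eqCoeff symbolReFirst symbolImFirst t
        (d - eqShift t) -
      eqSign t * (weightFirst i t l * eqCoeff symbolReFirst symbolImFirst t d))) -
      if d = i ∧ l = 0 then 10 ^ 15 else 0).natAbs ≤ 3 * 10 ^ 14 := by
  decide +kernel

/-- Real parts of the symbols of the second solution, scaled by `10 ^ 6`. -/
def symbolReSecond : Fin 6 → ℤ := ![1000000, 50239, -477362, -932117, 969373, -220265]

/-- Imaginary parts of the symbols of the second solution, scaled by `10 ^ 6`. -/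
def symbolImSecond : Fin 6 → ℤ := ![0, 998737, -878707, -362158, -245593, 975440]

/-- Weights for the second solution, scaled by `10 ^ 3`. -/
def weightTableSecond : List (List (List ℤ)) :=
  [[[-197, -75, -46, 16, -296, -296, 16, -46, -75], [71, -164, -90, 95, 212, 212, 95, -90, -164],
  [114, -18, 71, 72, 0, -72, -71, 18, -114], [199, 52, -58, -160, -158, -160, -58, 52, 199], [428,
  402, 407, 208, -208, -407, -402, -428, 0], [-67, 10, -16, -61, -61, -16, 10, -67, -67], [-9,
  -59, -22, 0, 22, 59, 9, 17, -17], [207, -30, -215, -239, -215, -30, 207, 36, 36], [-132, -178,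
  -109, 109, 178, 132, 91, 0, -91], [195, 59, -324, -324, 59, 195, 180, 269, 180]], [[-282, -87,
  92, -174, -340, -27, -29, -14, -139], [-80, -33, -113, 248, 163, -85, -37, -186, -37], [151,
  168, -211, 161, 108, -289, 104, 127, -379], [200, -115, -92, 8, 18, -149, -9, 26, 294], [137,
  280, 301, -274, 35, 0, -492, 40, 279], [-15, 90, -46, -90, 6, -63, -11, 9, -96], [140, -101,
  125, -32, -207, 175, 111, -90, -106], [27, -47, -27, -301, -123, 106, -68, -29, 176], [2, -106,
  25, 145, 90, -60, -13, -51, -33], [30, 189, -195, -282, 369, -5, -63, 306, 132]], [[-318, -19,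
  -142, -37, -6, -168, -54, -108, -150], [-46, 67, 134, 66, -75, -70, -177, 58, -5], [-6, -1, 69,
  -105, 124, 95, -122, 75, 40], [-71, -26, 79, -2, 94, -46, -31, 46, -52], [253, -108, -38, 136,
  -97, 69, 96, -197, 70], [48, 6, 61, -43, -55, -5, -112, 21, 12], [151, 11, -79, -9, -6, -33, 67,
  -36, -96], [138, 2, -32, 3, -160, -139, -102, -17, -6], [140, 65, 63, 9, -18, -54, -41, 0, -43],
  [-43, 23, 140, -75, -70, 214, -21, 74, 196]], [[12, -200, -172, 0, -251, -172, -124, -22, -71],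
  [-82, 186, 133, 29, 44, -112, -5, -133, -171], [48, 187, -27, -76, 158, -86, -78, 172, -169],
  [27, -47, -212, -189, 76, 33, 170, 65, 139], [513, 168, 234, -232, -353, -8, -77, -50, 470],
  [-95, -2, 10, -76, -36, -17, -71, 116, -27], [-43, -179, -30, 179, -81, -32, -103, -19, -95],
  [-23, -217, -112, -120, -187, 64, 58, 49, 43], [98, 76, 77, 113, 101, -74, -48, -178, -113],
  [-136, -27, -16, -195, 250, 404, 88, 234, 88]], [[-255, -164, 116, -113, -80, -144, -140, -164,
  -56], [307, 104, -98, -18, -180, -9, 31, -22, 12], [39, 73, -204, 119, 138, -159, 110, 47,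
  -346], [106, 13, 38, 33, 107, -35, -58, -214, 125], [-215, 11, 29, -226, 157, 140, -200, -207,
  22], [102, 35, 1, -58, -52, -107, -36, -26, -60], [118, -145, 193, 51, -112, -3, 1, 47, -3],
  [-98, 31, 83, -197, -183, -41, -144, -91, 185], [220, -16, -19, -58, -41, -32, -21, 28, 74],
  [-67, 227, -43, -141, 200, 24, -82, 248, 48]], [[-255, -56, -164, -140, -144, -80, -113, 116,
  -164], [307, 12, -22, 31, -9, -180, -18, -98, 104], [346, -47, -110, 159, -138, -119, 204, -73,
  -39], [125, -214, -58, -35, 107, 33, 38, 13, 106], [207, 200, -140, -157, 226, -29, -11, 215,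
  -22], [-26, -36, -107, -52, -58, 1, 35, 102, -60], [-1, 3, 112, -51, -193, 145, -118, 3, -47],
  [-144, -41, -183, -197, 83, 31, -98, 185, -91], [32, 41, 58, 19, 16, -220, -74, -28, 21], [24,
  200, -141, -43, 227, -67, 48, 248, -82]], [[12, -71, -22, -124, -172, -251, 0, -172, -200],
  [-82, -171, -133, -5, -112, 44, 29, 133, 186], [169, -172, 78, 86, -158, 76, 27, -187, -48],
  [139, 65, 170, 33, 76, -189, -212, -47, 27], [50, 77, 8, 353, 232, -234, -168, -513, -470],
  [116, -71, -17, -36, -76, 10, -2, -95, -27], [103, 32, 81, -179, 30, 179, 43, 95, 19], [58, 64,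
  -187, -120, -112, -217, -23, 43, 49], [74, -101, -113, -77, -76, -98, 113, 178, 48], [404, 250,
  -195, -16, -27, -136, 88, 234, 88]], [[-318, -150, -108, -54, -168, -6, -37, -142, -19], [-46,
  -5, 58, -177, -70, -75, 66, 134, 67], [-40, -75, 122, -95, -124, 105, -69, 1, 6], [-52, 46, -31,
  -46, 94, -2, 79, -26, -71], [197, -96, -69, 97, -136, 38, 108, -253, -70], [21, -112, -5, -55,
  -43, 61, 6, 48, 12], [-67, 33, 6, 9, 79, -11, -151, 96, 36], [-102, -139, -160, 3, -32, 2, 138,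
  -6, -17], [54, 18, -9, -63, -65, -140, 43, 0, 41], [214, -70, -75, 140, 23, -43, 196, 74, -21]],
  [[-282, -139, -14, -29, -27, -340, -174, 92, -87], [-80, -37, -186, -37, -85, 163, 248, -113,
  -33], [379, -127, -104, 289, -108, -161, 211, -168, -151], [294, 26, -9, -149, 18, 8, -92, -115,
  200], [-40, 492, 0, -35, 274, -301, -280, -137, -279], [9, -11, -63, 6, -90, -46, 90, -15, -96],
  [-111, -175, 207, 32, -125, 101, -140, 106, 90], [-68, 106, -123, -301, -27, -47, 27, 176, -29],
  [60, -90, -145, -25, 106, -2, 33, 51, 13], [-5, 369, -282, -195, 189, 30, 132, 306, -63]]]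

/-- Access to `weightTableSecond`. -/
def weightSecond (i : Fin 9) (t : Fin 10) (l : Fin 9) : ℤ :=
  ((weightTableSecond.getD i []).getD t []).getD l 0

theorem sum_weightSecond_le : ∀ i, ∑ t, ∑ l, (weightSecond i t l).natAbs ≤ 40000 := by
  decide +kernel

theorem weightSecond_approx_inverse : ∀ i, ∑ d, ∑ l,
    ((∑ t, (weightSecond i t (l - eqShift t) * eqCoeff symbolReSecond symbolImSecond t
        (d - eqShift t) -
      eqSign t * (weightSecond i t l * eqCoeff symbolReSecond symbolImSecond t d))) -
      if d = i ∧ l = 0 then 10 ^ 15 else 0).natAbs ≤ 3 * 10 ^ 14 := by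
  decide +kernel

/-! ### Counting the Haagerup set -/

/-- The symbol product attached to rows `j, l` and columns `k, m` of `coreMatrix g`. -/
def quadValue (g : Fin 6 → ℂ) (j k l m : Fin 10) : ℂ :=
  g (coreIdx j k) * g (coreIdx l m) * (starRingEnd ℂ) (g (coreIdx j m)) *
    (starRingEnd ℂ) (g (coreIdx l k))

theorem haagerupSet_coreMatrix (g : Fin 6 → ℂ) :
    haagerupSet (coreMatrix g) = {z | ∃ j k l m, z = quadValue g j k l m} := rfl

/-- Base five weights of the symbols. -/
def symbolWeight : Fin 6 → ℕ := ![0, 1, 5, 25, 125, 625]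

/-- Code of the exponents with which the symbols occur in `quadValue`. -/
def quadCode (j k l m : Fin 10) : ℕ :=
  2000 + symbolWeight (coreIdx j k) + symbolWeight (coreIdx l m) - symbolWeight (coreIdx j m) -
    symbolWeight (coreIdx l k)

/-- Exponent of the symbol `i` in a product of two symbols and two inverse symbols. -/
def symbolExp (a b c d i : Fin 6) : ℤ :=
  (if a = i then 1 else 0) + (if b = i then 1 else 0) - (if c = i then 1 else 0) -
    (if d = i then 1 else 0)

theorem symbol_prod_eq {g : Fin 6 → ℂ} (hg : ∀ i, ‖g i‖ = 1) (a b c d : Fin 6) :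
    g a * g b * (starRingEnd ℂ) (g c) * (starRingEnd ℂ) (g d) =
      ∏ i, g i ^ symbolExp a b c d i := by
  have h0 : ∀ i, g i ≠ 0 := fun i => norm_ne_zero_iff.1 (by rw [hg]; norm_num)
  have hc : ∀ i, (starRingEnd ℂ) (g i) = (g i)⁻¹ := fun i => by
    rw [Complex.inv_def, Complex.normSq_eq_norm_sq, hg]; simp
  have h1 : ∀ a : Fin 6, ∏ i, g i ^ (if a = i then (1 : ℤ) else 0) = g a := fun a => by
    rw [Finset.prod_eq_single a]
    · simp
    · intro b _ hb; simp [hb.symm]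
    · simp
  simp only [symbolExp, zpow_sub₀ (h0 _), zpow_add₀ (h0 _), Finset.prod_div_distrib,
    Finset.prod_mul_distrib, h1, hc]
  rw [div_eq_mul_inv, div_eq_mul_inv]

/-- All exponents lie between `-2` and `2`, so the code is a balanced base-five expansion and
determines them. The offset `2000` keeps natural subtraction from truncating. Symbol `0` has weight
zero because its value is `1`. -/
theorem symbolExp_eq_of_weight {a b c d a' b' c' d' : Fin 6}
    (h : 2000 + symbolWeight a + symbolWeight b - symbolWeight c - symbolWeight d =
      2000 + symbolWeight a' + symbolWeight b' - symbolWeight c' - symbolWeight d')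
    (i : Fin 6) (hi : i ≠ 0) : symbolExp a b c d i = symbolExp a' b' c' d' i := by
  have hw : ∀ a : Fin 6, (symbolWeight a : ℤ) = (if a = 1 then 1 else 0) +
      5 * (if a = 2 then 1 else 0) + 25 * (if a = 3 then 1 else 0) +
      125 * (if a = 4 then 1 else 0) + 625 * (if a = 5 then 1 else 0) := by decide
  have hle : ∀ a : Fin 6, symbolWeight a ≤ 625 := by decide
  have hb : ∀ a i : Fin 6, 0 ≤ (if a = i then (1 : ℤ) else 0) ∧
      (if a = i then (1 : ℤ) else 0) ≤ 1 := by decide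
  have key : ∀ a b c d i : Fin 6, -2 ≤ symbolExp a b c d i ∧ symbolExp a b c d i ≤ 2 := by
    intro a b c d i
    have := hb a i; have := hb b i; have := hb c i; have := hb d i
    unfold symbolExp
    omega
  have hs : ∀ a b c d : Fin 6,
      ((2000 + symbolWeight a + symbolWeight b - symbolWeight c - symbolWeight d : ℕ) : ℤ) =
      2000 + symbolExp a b c d 1 + 5 * symbolExp a b c d 2 + 25 * symbolExp a b c d 3 +
        125 * symbolExp a b c d 4 + 625 * symbolExp a b c d 5 := by
    intro a b c d
    have h1 := hle a; have h2 := hle b; have h3 := hle c; have h4 := hle d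
    have e1 := hw a; have e2 := hw b; have e3 := hw c; have e4 := hw d
    unfold symbolExp
    omega
  have e := congrArg (Nat.cast : ℕ → ℤ) h
  rw [hs, hs] at e
  have k := key a b c d
  have k' := key a' b' c' d'
  have k1 := k 1; have k2 := k 2; have k3 := k 3; have k4 := k 4; have k5 := k 5
  have l1 := k' 1; have l2 := k' 2; have l3 := k' 3; have l4 := k' 4; have l5 := k' 5
  fin_cases i
  · exact absurd rfl hi
  all_goals simp only [Fin.mk_one, Fin.reduceFinMk]; omega

theorem quadValue_eq_of_code {g : Fin 6 → ℂ} (h0 : g 0 = 1) (hg : ∀ i, ‖g i‖ = 1)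
    {j k l m j' k' l' m' : Fin 10} (h : quadCode j k l m = quadCode j' k' l' m') :
    quadValue g j k l m = quadValue g j' k' l' m' := by
  unfold quadValue
  rw [symbol_prod_eq hg, symbol_prod_eq hg]
  refine Finset.prod_congr rfl fun i _ => ?_
  by_cases hi : i = 0
  · rw [hi, h0, one_zpow, one_zpow]
  · rw [symbolExp_eq_of_weight h i hi]

/-- All codes of quadruples, in order of decreasing frequency. -/
def quadCodes : List ℕ :=
  [2000, 2020, 1996, 1980, 1976, 2024, 2004, 2120, 2100, 1900, 1880, 1876, 2124, 1380, 1400, 1376,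
   2620, 2600, 2624, 1500, 2500, 2520, 2744, 2496, 2720, 2480, 2724, 2476, 2504, 2524, 1280, 1504,
   1256, 1480, 2104, 1904, 1856, 2144, 1896, 1524, 1276, 1520, 2096, 1476, 1496, 2005, 2025, 2125,
   2001, 1995, 1975, 1875, 1999, 2640, 2576, 2628, 1360, 1960, 1984, 1956, 1760, 1884, 1780, 2008,
   2028, 1756, 2080, 1920, 2040, 1424, 2044, 2016, 1800, 2048, 2148, 1776, 2224, 2200, 2244, 2240,
   2220, 2116, 2248, 1752, 1852, 1952, 1972, 1992, 1372, 2625, 1375, 3240, 3200, 3000, 3248, 760,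
   800, 1000, 752]

/-- Quadruples `j k l m`, as decimal numbers, with the codes `quadCodes`. -/
def quadReps : List ℕ :=
  [0, 124, 126, 132, 137, 153, 154, 125, 136, 142, 143, 148, 152, 112, 113, 115, 122, 133, 155,
   114, 144, 1124, 1125, 1127, 1128, 1134, 1136, 1137, 1145, 1146, 1224, 1225, 1227, 1228, 1263,
   1264, 1283, 1325, 1327, 1336, 1337, 1339, 1438, 1448, 1449, 12, 13, 14, 15, 120, 130, 140, 150,
   1129, 1138, 1156, 1223, 1243, 1245, 1248, 1254, 1256, 1257, 1265, 1275, 1284, 1293, 1324, 1329,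
   1335, 1346, 1349, 1364, 1375, 1385, 1394, 1425, 1428, 1436, 1439, 1458, 1459, 1485, 1527, 1537,
   1538, 1548, 1549, 1559, 11, 110, 1122, 1133, 1144, 1155, 1221, 1331, 1441, 1551]

/-- Decimal digits of a quadruple. -/
def quadDigit (n i : ℕ) : Fin 10 := Fin.ofNat 10 (n / 10 ^ i)

/-- The quadruples from `quadReps`. -/
def quadRep (t : Fin 99) (i : ℕ) : Fin 10 := quadDigit (quadReps.getD t 0) i

theorem quadCode_mem : ∀ j k l m, quadCodes.contains (quadCode j k l m) = true := by
  decide +kernel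

theorem quadCodes_eq : ∀ t : Fin 99, quadCodes.getD t 0 =
    quadCode (quadRep t 3) (quadRep t 2) (quadRep t 1) (quadRep t 0) := by
  decide +kernel

theorem exists_quadRep (j k l m : Fin 10) : ∃ t, quadCode j k l m =
    quadCode (quadRep t 3) (quadRep t 2) (quadRep t 1) (quadRep t 0) := by
  have h := quadCode_mem j k l m
  rw [List.contains_iff_mem, List.mem_iff_getElem] at h
  obtain ⟨n, hn, h⟩ := h
  refine ⟨⟨n, hn⟩, ?_⟩
  rw [← quadCodes_eq, ← h]
  simp [hn]

/-- Real and imaginary parts of the symbol products of `quadReps` for integral approximate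
symbols. -/
def quadApprox (p q : Fin 6 → ℤ) (t : Fin 99) : ℤ × ℤ :=
  let a := coreIdx (quadRep t 3) (quadRep t 2)
  let b := coreIdx (quadRep t 1) (quadRep t 0)
  let c := coreIdx (quadRep t 3) (quadRep t 0)
  let d := coreIdx (quadRep t 1) (quadRep t 2)
  let r := p a * p b - q a * q b
  let s := p a * q b + q a * p b
  let r' := p c * p d - q c * q d
  let s' := p c * q d + q c * p d
  (r * r' + s * s', s * r' - r * s')

/-- Each of the four factors contributes about `ε`, so the total is close to `8 / 10 ^ 6`. -/
theorem norm_prod_sub_prod_le {a b c d a' b' c' d' : ℂ} {ε : ℝ} (hε : ε ≤ 2 / 10 ^ 6)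
    (ha : ‖a‖ = 1) (hb : ‖b‖ = 1) (hc : ‖c‖ = 1) (hd : ‖d‖ = 1) (ha' : ‖a - a'‖ ≤ ε)
    (hb' : ‖b - b'‖ ≤ ε) (hc' : ‖c - c'‖ ≤ ε) (hd' : ‖d - d'‖ ≤ ε) :
    ‖a * b * c * d - a' * b' * c' * d'‖ ≤ 1 / 10 ^ 5 := by
  have step : ∀ {x y x' y' : ℂ} {δ : ℝ}, ‖x‖ = 1 → ‖y‖ = 1 → ‖x - x'‖ ≤ δ → ‖y - y'‖ ≤ ε →
      ‖x * y - x' * y'‖ ≤ δ + (1 + δ) * ε := by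
    intro x y x' y' δ hx hy h1 h2
    have hx' : ‖x'‖ ≤ 1 + δ := by
      have := norm_sub_rev x x' ▸ norm_le_norm_add_norm_sub' x' x
      linarith
    have e : x * y - x' * y' = (x - x') * y + x' * (y - y') := by ring
    rw [e]
    refine (norm_add_le _ _).trans ?_
    rw [norm_mul, norm_mul, hy, mul_one]
    exact add_le_add h1 (mul_le_mul hx' h2 (norm_nonneg _) ((norm_nonneg _).trans hx'))
  have hε0 : 0 ≤ ε := (norm_nonneg _).trans ha'
  have h1 := step ha hb ha' hb'
  have h2 := step (by rw [norm_mul, ha, hb, one_mul]) hc h1 hc'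
  have h3 := step (by rw [norm_mul, norm_mul, ha, hb, hc, one_mul, one_mul]) hd h2 hd'
  refine h3.trans ?_
  have e2 : ε ^ 2 ≤ ε * 1 := by nlinarith
  have e3 : ε ^ 3 ≤ ε * (1 / 10 ^ 3) := by nlinarith
  have e4 : ε ^ 4 ≤ ε * (1 / 10 ^ 3) := by nlinarith
  nlinarith

theorem norm_quadValue_sub_le {g : Fin 6 → ℂ} {p q : Fin 6 → ℤ} (hg : ∀ i, ‖g i‖ = 1)
    (hpq : ApproxSymbols g p q) (t : Fin 99) :
    ‖quadValue g (quadRep t 3) (quadRep t 2) (quadRep t 1) (quadRep t 0) -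
      (((quadApprox p q t).1 : ℂ) + (quadApprox p q t).2 * Complex.I) / 10 ^ 24‖ ≤ 1 / 10 ^ 5 := by
  have hconj : ∀ i, ‖(starRingEnd ℂ) (g i) - ((p i : ℂ) - q i * Complex.I) / 10 ^ 6‖ ≤
      2 / 10 ^ 6 := by
    intro i
    have h := hpq i
    rw [← RCLike.norm_conj] at h
    refine le_of_eq_of_le (congrArg _ ?_) h
    simp only [map_sub, map_div₀, map_add, map_mul, map_pow, map_intCast, map_ofNat, Complex.conj_I]
    ring
  have h := norm_prod_sub_prod_le le_rfl (hg (coreIdx (quadRep t 3) (quadRep t 2)))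
    (hg (coreIdx (quadRep t 1) (quadRep t 0)))
    ((RCLike.norm_conj _).trans (hg (coreIdx (quadRep t 3) (quadRep t 0))))
    ((RCLike.norm_conj _).trans (hg (coreIdx (quadRep t 1) (quadRep t 2))))
    (hpq _) (hpq _) (hconj _) (hconj _)
  refine le_of_eq_of_le (congrArg _ ?_) h
  unfold quadValue
  congr 1
  simp only [quadApprox]
  push_cast
  ring_nf
  simp only [Complex.I_sq, show Complex.I ^ 3 = -Complex.I by rw [pow_succ, Complex.I_sq]; ring,
    show Complex.I ^ 4 = 1 from Complex.I_pow_four]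
  ring

/-- Equal codes give equal values, so 99 representatives exhaust the set. They are distinct because
their approximations differ by more than `1 / 10 ^ 4` in some coordinate while each is accurate to
`1 / 10 ^ 5`. -/
theorem ncard_haagerupSet_coreMatrix {g : Fin 6 → ℂ} {p q : Fin 6 → ℤ} (h0 : g 0 = 1)
    (hg : ∀ i, ‖g i‖ = 1) (hpq : ApproxSymbols g p q)
    (hsep : ∀ s t, s < t → 10 ^ 20 < ((quadApprox p q s).1 - (quadApprox p q t).1).natAbs ∨
      10 ^ 20 < ((quadApprox p q s).2 - (quadApprox p q t).2).natAbs) :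
    (haagerupSet (coreMatrix g)).ncard = 99 := by
  set F : Fin 99 → ℂ := fun t =>
    quadValue g (quadRep t 3) (quadRep t 2) (quadRep t 1) (quadRep t 0) with hF
  have hset : haagerupSet (coreMatrix g) = Set.range F := by
    rw [haagerupSet_coreMatrix]
    ext z
    constructor
    · rintro ⟨j, k, l, m, rfl⟩
      obtain ⟨t, ht⟩ := exists_quadRep j k l m
      exact ⟨t, (quadValue_eq_of_code h0 hg ht).symm⟩
    · rintro ⟨t, rfl⟩
      exact ⟨_, _, _, _, rfl⟩
  have hne : ∀ s t, s < t → F s ≠ F t := by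
    intro s t hst he
    have h1 := norm_quadValue_sub_le hg hpq s
    have h2 := norm_quadValue_sub_le hg hpq t
    change ‖F s - _‖ ≤ _ at h1
    change ‖F t - _‖ ≤ _ at h2
    rw [he] at h1
    set P := quadApprox p q s
    set Q := quadApprox p q t
    have h3 : ‖(((P.1 - Q.1 : ℤ) : ℂ) + ((P.2 - Q.2 : ℤ) : ℂ) * Complex.I) / 10 ^ 24‖ ≤
        2 / 10 ^ 5 := by
      have := norm_sub_le (F t - ((Q.1 : ℂ) + Q.2 * Complex.I) / 10 ^ 24)
        (F t - ((P.1 : ℂ) + P.2 * Complex.I) / 10 ^ 24)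
      refine le_of_eq_of_le (congrArg _ ?_) (this.trans (by linarith))
      push_cast
      ring
    rw [norm_div, div_le_iff₀ (by simp)] at h3
    have h4 := (Complex.abs_re_le_norm _).trans h3
    have h5 := (Complex.abs_im_le_norm _).trans h3
    simp only [Complex.add_re, Complex.add_im, Complex.mul_re, Complex.mul_im, Complex.intCast_re,
      Complex.intCast_im, Complex.I_re, Complex.I_im, mul_zero, mul_one, zero_add, add_zero,
      sub_zero, norm_pow, RCLike.norm_ofNat] at h4 h5
    norm_num only at h4 h5
    have h6 : |P.1 - Q.1| ≤ 20000000000000000000 := by exact_mod_cast h4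
    have h7 : |P.2 - Q.2| ≤ 20000000000000000000 := by exact_mod_cast h5
    have h8 := hsep s t hst
    change 10 ^ 20 < (P.1 - Q.1).natAbs ∨ 10 ^ 20 < (P.2 - Q.2).natAbs at h8
    rw [abs_le] at h6 h7
    omega
  have hinj : Function.Injective F := by
    intro s t he
    rcases lt_trichotomy s t with h | h | h
    · exact absurd he (hne s t h)
    · exact h
    · exact absurd he.symm (hne t s h)
  rw [hset, ← Set.image_univ, Set.ncard_image_of_injective _ hinj, Set.ncard_univ]
  simp

theorem quadApproxFirst_separated : ∀ s t, s < t →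
    10 ^ 20 < ((quadApprox symbolReFirst symbolImFirst s).1 -
      (quadApprox symbolReFirst symbolImFirst t).1).natAbs ∨
    10 ^ 20 < ((quadApprox symbolReFirst symbolImFirst s).2 -
      (quadApprox symbolReFirst symbolImFirst t).2).natAbs := by
  decide +kernel

theorem quadApproxSecond_separated : ∀ s t, s < t →
    10 ^ 20 < ((quadApprox symbolReSecond symbolImSecond s).1 -
      (quadApprox symbolReSecond symbolImSecond t).1).natAbs ∨
    10 ^ 20 < ((quadApprox symbolReSecond symbolImSecond s).2 -
      (quadApprox symbolReSecond symbolImSecond t).2).natAbs := by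
  decide +kernel

theorem coreMatrix_invariants_of_approx {g : Fin 6 → ℂ} (h0 : g 0 = 1) (hg : ∀ i, ‖g i‖ = 1)
    (hH : IsComplexHadamard (coreMatrix g))
    (h : ApproxSymbols g symbolReFirst symbolImFirst ∨
      ApproxSymbols g symbolReSecond symbolImSecond) :
    hadamardDefect (coreMatrix g) = 0 ∧ (haagerupSet (coreMatrix g)).ncard = 99 := by
  rcases h with h | h
  · exact ⟨hadamardDefect_coreMatrix_eq_zero h0 hg hH h _ sum_weightFirst_le
      weightFirst_approx_inverse, ncard_haagerupSet_coreMatrix h0 hg h quadApproxFirst_separated⟩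
  · exact ⟨hadamardDefect_coreMatrix_eq_zero h0 hg hH h _ sum_weightSecond_le
      weightSecond_approx_inverse, ncard_haagerupSet_coreMatrix h0 hg h quadApproxSecond_separated⟩

/-! ### Fixed-point interval arithmetic -/

/-- `x` agrees with `a / 10 ^ 14` up to an error of `ε / 10 ^ 14`. -/
def Near (x : ℝ) (a : ℤ) (ε : ℕ) : Prop := |x * 10 ^ 14 - a| ≤ (ε : ℝ)

namespace Near

variable {x y n : ℝ} {a b c : ℤ} {ε δ : ℕ}

theorem congr (h : Near x a ε) (e : x = y) : Near y a ε := e ▸ h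

theorem bounds (h : Near x a ε) : (a - ε : ℝ) ≤ x * 10 ^ 14 ∧ x * 10 ^ 14 ≤ a + ε := by
  have := abs_le.1 h
  constructor <;> linarith [this.1, this.2]

theorem int (k : ℤ) : Near (k : ℝ) (k * 10 ^ 14) 0 := by
  have e : (k : ℝ) * 10 ^ 14 - ((k * 10 ^ 14 : ℤ) : ℝ) = 0 := by push_cast; ring
  rw [Near, e, abs_zero, Nat.cast_zero]

theorem natAbs_cast_le {m : ℤ} {k : ℕ} (h : m.natAbs ≤ k) : |(m : ℝ)| ≤ k := by
  rw [← Int.cast_abs, Int.abs_eq_natAbs]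
  exact_mod_cast h

theorem abs_cast_le (m : ℤ) : |(m : ℝ)| ≤ m.natAbs := natAbs_cast_le le_rfl

theorem add (hx : Near x a ε) (hy : Near y b δ) : Near (x + y) (a + b) (ε + δ) := by
  unfold Near at *
  push_cast
  have := abs_add_le (x * 10 ^ 14 - a) (y * 10 ^ 14 - b)
  rw [show (x + y) * 10 ^ 14 - (a + b : ℝ) = (x * 10 ^ 14 - a) + (y * 10 ^ 14 - b) by ring]
  linarith

theorem neg (hx : Near x a ε) : Near (-x) (-a) ε := by
  unfold Near at *
  push_cast
  rwa [show -x * 10 ^ 14 - (-a : ℝ) = -(x * 10 ^ 14 - a) by ring, abs_neg]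

theorem sub (hx : Near x a ε) (hy : Near y b δ) : Near (x - y) (a - b) (ε + δ) :=
  (hx.add hy.neg).congr (sub_eq_add_neg x y).symm

/-- The integer `c` is a rounded value of the product. The condition adds the rounding error to the
propagated errors and involves integers only, so it can be decided by computation. -/
theorem mul (hx : Near x a ε) (hy : Near y b δ) (c : ℤ) (η : ℕ)
    (h : (a * b - c * 10 ^ 14).natAbs + a.natAbs * δ + b.natAbs * ε + ε * δ ≤ η * 10 ^ 14) :
    Near (x * y) c η := by
  unfold Near at *
  have h0 := abs_cast_le (a * b - c * 10 ^ 14)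
  have ha := abs_cast_le a
  have hb := abs_cast_le b
  have h1 : ((a * b - c * 10 ^ 14).natAbs + a.natAbs * δ + b.natAbs * ε + ε * δ : ℝ) ≤
      η * 10 ^ 14 := by exact_mod_cast h
  have e : (x * y * 10 ^ 14 - c) * 10 ^ 14 = ((a * b - c * 10 ^ 14 : ℤ) : ℝ) +
      (a * (y * 10 ^ 14 - b) + b * (x * 10 ^ 14 - a) +
        (x * 10 ^ 14 - a) * (y * 10 ^ 14 - b)) := by push_cast; ring
  have h2 : |(x * y * 10 ^ 14 - c) * 10 ^ 14| ≤ (η * 10 ^ 14 : ℝ) := by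
    rw [e]
    have t1 := abs_add_le ((a * b - c * 10 ^ 14 : ℤ) : ℝ) (a * (y * 10 ^ 14 - b) +
      b * (x * 10 ^ 14 - a) + (x * 10 ^ 14 - a) * (y * 10 ^ 14 - b))
    have t2 := abs_add_le (a * (y * 10 ^ 14 - b) + b * (x * 10 ^ 14 - a))
      ((x * 10 ^ 14 - a) * (y * 10 ^ 14 - b))
    have t3 := abs_add_le (a * (y * 10 ^ 14 - b)) (b * (x * 10 ^ 14 - a))
    rw [abs_mul, abs_mul (b : ℝ)] at t3
    rw [abs_mul (x * 10 ^ 14 - a)] at t2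
    have u1 := mul_le_mul ha hy (abs_nonneg _) (Nat.cast_nonneg _)
    have u2 := mul_le_mul hb hx (abs_nonneg _) (Nat.cast_nonneg _)
    have u3 := mul_le_mul hx hy (abs_nonneg _) (Nat.cast_nonneg _)
    linarith
  rw [abs_mul, abs_of_pos (by norm_num : (0 : ℝ) < 10 ^ 14)] at h2
  exact le_of_mul_le_mul_right h2 (by norm_num)

theorem half (h : Near (2 * x) a ε) (c : ℤ) (η : ℕ) (hc : (a - 2 * c).natAbs + ε ≤ 2 * η) :
    Near x c η := by
  unfold Near at *
  have h0 := abs_cast_le (a - 2 * c)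
  have h1 : ((a - 2 * c).natAbs + ε : ℝ) ≤ 2 * η := by exact_mod_cast hc
  push_cast at h0
  rw [abs_le] at *
  constructor <;> linarith [h.1, h.2, h0.1, h0.2]

/-- The quotient is given by `x * y = n`. The error is controlled after multiplication by `y`, whose
modulus is at least `b.natAbs - δ` in scaled units. -/
theorem div (hn : Near n c ε) (hy : Near y b δ) (hxy : x * y = n) (a : ℤ) (η : ℕ)
    (hb : δ < b.natAbs)
    (h : (c * 10 ^ 14 - a * b).natAbs + ε * 10 ^ 14 + a.natAbs * δ ≤ η * (b.natAbs - δ)) :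
    Near x a η := by
  unfold Near at *
  have h0 := abs_cast_le (c * 10 ^ 14 - a * b)
  have ha := abs_cast_le a
  have h1 : ((c * 10 ^ 14 - a * b).natAbs + ε * 10 ^ 14 + a.natAbs * δ : ℝ) ≤
      η * (b.natAbs - δ) := by
    have := (Nat.cast_le (α := ℝ)).2 h
    rw [Nat.cast_mul η, Nat.cast_sub hb.le] at this
    exact_mod_cast this
  have hyb : (b.natAbs - δ : ℝ) ≤ |y * 10 ^ 14| := by
    have h3 : (b.natAbs : ℝ) = |(b : ℝ)| := by
      rw [← Int.cast_abs, Int.abs_eq_natAbs]; rfl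
    have h4 := abs_sub_abs_le_abs_sub (b : ℝ) (y * 10 ^ 14)
    rw [abs_sub_comm] at h4
    linarith
  have hpos : (0 : ℝ) < b.natAbs - δ := by
    have : (δ : ℝ) < b.natAbs := by exact_mod_cast hb
    linarith
  have e : (x * 10 ^ 14 - a) * (y * 10 ^ 14) = ((c * 10 ^ 14 - a * b : ℤ) : ℝ) +
      ((n * 10 ^ 14 - c) * 10 ^ 14 - a * (y * 10 ^ 14 - b)) := by
    push_cast
    linear_combination 10 ^ 28 * hxy
  have h2 : |x * 10 ^ 14 - a| * |y * 10 ^ 14| ≤ (η : ℝ) * (b.natAbs - δ) := by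
    rw [← abs_mul, e]
    have t1 := abs_add_le ((c * 10 ^ 14 - a * b : ℤ) : ℝ)
      ((n * 10 ^ 14 - c) * 10 ^ 14 - a * (y * 10 ^ 14 - b))
    have t2 := abs_sub ((n * 10 ^ 14 - c) * 10 ^ 14) (a * (y * 10 ^ 14 - b))
    rw [abs_mul, abs_mul (a : ℝ), abs_of_pos (by norm_num : (0 : ℝ) < 10 ^ 14)] at t2
    have u1 := mul_le_mul ha hy (abs_nonneg _) (Nat.cast_nonneg _)
    linarith
  have h3 := (mul_le_mul_of_nonneg_left hyb (abs_nonneg (x * 10 ^ 14 - a))).trans h2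
  exact le_of_mul_le_mul_right h3 hpos

/-- Factor `x ^ 2 - a ^ 2`, in scaled units; since `x ≥ 0`, the factor `x + a` is at least `a`. -/
theorem sqrt (hn : Near n c ε) (hx : 0 ≤ x) (hxx : x * x = n) (a : ℕ) (η : ℕ) (ha : 0 < a)
    (h : (c * 10 ^ 14 - a * a).natAbs + ε * 10 ^ 14 ≤ η * a) : Near x a η := by
  unfold Near at *
  have h0 := abs_cast_le (c * 10 ^ 14 - a * a)
  have h1 : ((c * 10 ^ 14 - a * a).natAbs + ε * 10 ^ 14 : ℝ) ≤ η * a := by exact_mod_cast h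
  have hpos : (0 : ℝ) < a := by exact_mod_cast ha
  have e : (x * 10 ^ 14 - a) * (x * 10 ^ 14 + a) = ((c * 10 ^ 14 - a * a : ℤ) : ℝ) +
      (n * 10 ^ 14 - c) * 10 ^ 14 := by
    push_cast
    linear_combination 10 ^ 28 * hxx
  have h2 : |x * 10 ^ 14 - a| * |x * 10 ^ 14 + a| ≤ (η : ℝ) * a := by
    rw [← abs_mul, e]
    have t1 := abs_add_le ((c * 10 ^ 14 - a * a : ℤ) : ℝ) ((n * 10 ^ 14 - c) * 10 ^ 14)
    rw [abs_mul, abs_of_pos (by norm_num : (0 : ℝ) < 10 ^ 14)] at t1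
    linarith
  have h4 : (a : ℝ) ≤ |x * 10 ^ 14 + a| := le_trans (by linarith [mul_nonneg hx (by norm_num :
    (0 : ℝ) ≤ 10 ^ 14)]) (le_abs_self _)
  have h3 := (mul_le_mul_of_nonneg_left h4 (abs_nonneg (x * 10 ^ 14 - a))).trans h2
  rw [Int.cast_natCast]
  exact le_of_mul_le_mul_right h3 hpos

end Near

/-! ### Numerical location of all solutions -/

/-- A real number in `[-1, 1]` whose value under a cubic with separated roots is small is close to
one of the roots. -/
theorem near_root_of_cubic {T a b c g κ η : ℝ} (hg : 0 < g) (h1 : 2 * g ≤ |a - b|)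
    (h2 : 2 * g ≤ |b - c|) (h3 : 2 * g ≤ |a - c|) (h : |(T - a) * (T - b) * (T - c)| ≤ η)
    (hη : η < g ^ 2 * κ) : |T - a| ≤ κ ∨ |T - b| ≤ κ ∨ |T - c| ≤ κ := by
  by_contra! hcon
  obtain ⟨ha, hb, hc⟩ := hcon
  have tri : ∀ p q : ℝ, |p - q| ≤ |T - p| + |T - q| := fun p q => by
    have := abs_sub_le p T q
    rwa [abs_sub_comm p T] at this
  have t1 := tri a b
  have t2 := tri b c
  have t3 := tri a c
  rw [abs_mul, abs_mul] at h
  have key : ∀ p q r : ℝ, 0 ≤ p → κ < p → g ≤ q → g ≤ r → g ^ 2 * κ ≤ p * q * r := by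
    intro p q r hp0 hp hq hr
    calc g ^ 2 * κ ≤ g ^ 2 * p := by gcongr
      _ = p * (g * g) := by ring
      _ ≤ p * (q * r) := by have := mul_le_mul hq hr hg.le (hg.le.trans hq); gcongr
      _ = p * q * r := by ring
  -- As the roots are `2 * g` apart, `T` can be closer than `g` to at most one of them. The product
  -- then exceeds `g ^ 2 * κ`.
  by_cases ca : g ≤ |T - a|
  · by_cases cb : g ≤ |T - b|
    · have := key _ _ _ (abs_nonneg (T - c)) hc ca cb
      nlinarith
    · have cc : g ≤ |T - c| := by linarith
      have := key _ _ _ (abs_nonneg (T - b)) hb ca cc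
      nlinarith
  · have cb : g ≤ |T - b| := by linarith
    have cc : g ≤ |T - c| := by linarith
    have := key _ _ _ (abs_nonneg (T - a)) ha cb cc
    nlinarith

/-- The degree nine polynomial of `PlanarRelations.charpoly_eq` has two roots in `[-3, 0]`. -/
theorem near_half_root {s : ℝ} (h0 : s ≤ 0) (h3 : -3 ≤ s)
    (h : s ^ 9 + 36 * s ^ 8 + 239 * s ^ 7 - 593 * s ^ 6 - 11218 * s ^ 5 - 37091 * s ^ 4 -
      7618 * s ^ 3 + 187541 * s ^ 2 + 355884 * s + 191844 = 0) :
    Near (s / 2) (-120287464584835) 20 ∨ Near (s / 2) (-54691982323974) 20 := by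
  -- The polynomial is `m * Q` up to tiny coefficients, where `m` carries the two roots in question
  -- and `Q` is a rounded cofactor bounded away from zero on `[-3, 0]`.
  set m : ℝ := (s + 240574929169670 / 10 ^ 14) * (s + 109383964647948 / 10 ^ 14) with hm
  set Q : ℝ := s ^ 7 + 3250041106182382 / 10 ^ 14 * s ^ 6 +
      12263041700711483 / 10 ^ 14 * s ^ 5 - 110768101108214894 / 10 ^ 14 * s ^ 4 - 766427421391569672 / 10 ^ 14 * s ^ 3 - 735432378056999831 / 10 ^ 14 * s ^ 2 + 3828767805443936154 / 10 ^ 14 * s + 7290279752529870395 / 10 ^ 14 with hQ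
  have hQ770 : 770 ≤ Q := by
    obtain ⟨b, rfl⟩ : ∃ b, s = b - 3 := ⟨s + 3, by ring⟩
    have hb : 0 ≤ b := by linarith
    have h1 : 0 ≤ b ^ 4 * (3 - b) := mul_nonneg (by positivity) (by linarith)
    have h2 : 0 ≤ b ^ 3 * ((3 - b) * (3 + b)) :=
      mul_nonneg (by positivity) (mul_nonneg (by linarith) (by linarith))
    have p2 : 0 ≤ b ^ 2 := by positivity
    have p3 : 0 ≤ b ^ 3 := by positivity
    have p4 : 0 ≤ b ^ 4 := by positivity
    have p6 : 0 ≤ b ^ 6 := by positivity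
    have p7 : 0 ≤ b ^ 7 := by positivity
    rw [hQ]
    linarith
  have hmQ : |m * Q| ≤ 12 / 10 ^ 11 := by
    have hpow : ∀ n : ℕ, |s ^ n| ≤ 3 ^ n := fun n => by
      rw [abs_pow]
      exact pow_le_pow_left₀ (abs_nonneg _) (abs_le.2 ⟨h3, by linarith⟩) n
    have q1 := abs_le.1 (hpow 1)
    have q2 := abs_le.1 (hpow 2)
    have q3 := abs_le.1 (hpow 3)
    have q4 := abs_le.1 (hpow 4)
    have q5 := abs_le.1 (hpow 5)
    have q6 := abs_le.1 (hpow 6)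
    have q7 := abs_le.1 (hpow 7)
    rw [hm, hQ, abs_le]
    constructor <;> linarith [q1.1, q1.2, q2.1, q2.2, q3.1, q3.2, q4.1, q4.2, q5.1, q5.2, q6.1,
      q6.2, q7.1, q7.2]
  have hm' : |m| ≤ 16 / 10 ^ 14 := by
    rw [abs_mul] at hmQ
    have h1 : 770 ≤ |Q| := hQ770.trans (le_abs_self _)
    have h2 := mul_le_mul_of_nonneg_left h1 (abs_nonneg m)
    linarith
  rw [hm, abs_mul] at hm'
  -- The roots are more than `1` apart, so one factor of `m` has modulus at least `1 / 2` and the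
  -- other must be tiny.
  by_cases hs : 1 / 2 ≤ |s + 109383964647948 / 10 ^ 14|
  · left
    have h1 := mul_le_mul_of_nonneg_left hs (abs_nonneg (s + 240574929169670 / 10 ^ 14))
    have h2 := abs_le.1 (show |s + 240574929169670 / 10 ^ 14| ≤ 32 / 10 ^ 14 by linarith)
    unfold Near
    rw [abs_le]
    push_cast
    constructor <;> linarith [h2.1, h2.2]
  · right
    have hs' : 1 / 2 ≤ |s + 240574929169670 / 10 ^ 14| := by
      rw [not_le, abs_lt] at hs
      exact le_trans (by linarith [hs.1, hs.2]) (le_abs_self _)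
    have h1 := mul_le_mul_of_nonneg_right hs' (abs_nonneg (s + 109383964647948 / 10 ^ 14))
    have h2 := abs_le.1 (show |s + 109383964647948 / 10 ^ 14| ≤ 32 / 10 ^ 14 by linarith)
    unfold Near
    rw [abs_le]
    push_cast
    constructor <;> linarith [h2.1, h2.2]

theorem IsCoreSolution.near_sum {x y z u v : ℂ} (h : IsCoreSolution x y z u v) :
    Near (ip y z + ip z x + ip x y) (-120287464584835) 20 ∨
      Near (ip y z + ip z x + ip x y) (-54691982323974) 20 := by
  have h0 := h.sum_nonpos
  have h1 := h.sum_ge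
  have := near_half_root (s := 2 * (ip y z + ip z x + ip x y)) (by linarith) (by linarith)
    (h.planarRelations.charpoly_eq rfl (by linarith) (by linarith))
  rwa [mul_div_cancel_left₀ _ (two_ne_zero' ℝ)] at this

/-- Here `ratioSum a c = 2 * e`, which is near `-2.406` or near `-1.094`. The product is near
`0.570` in the first case and near `-0.085` in the second. -/
theorem ratioSum_bound {a b c d : ℂ} (h : IsUnimodularY10ASolution a b c d) :
    (ratioSum a c + 1) * (ratioSum a c + 2) ≠ 0 ∧
      ‖(ratioSum a c + 1) * (ratioSum a c + 2)‖ < 1 := by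
  have hc := (hadamardEquiv_y10A h).1
  have na : a ≠ 0 := norm_ne_zero_iff.1 (by rw [h.1]; norm_num)
  have nc : c ≠ 0 := norm_ne_zero_iff.1 (by rw [h.2.2.1]; norm_num)
  set e := ip (1 / a) (1 / c) + ip (1 / c) 1 + ip 1 (1 / a) with he
  have hs : ratioSum a c = ((2 * e : ℝ) : ℂ) := by
    have h1 := two_ip hc.hy hc.hz
    have h2 := two_ip hc.hz hc.hx
    have h3 := two_ip hc.hx hc.hy
    rw [he, mul_add, mul_add, Complex.ofReal_add, Complex.ofReal_add, h1, h2, h3, ratioSum]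
    field_simp
    ring
  have hv : (ratioSum a c + 1) * (ratioSum a c + 2) =
      (((2 * e + 1) * (2 * e + 2) : ℝ) : ℂ) := by
    rw [hs]; push_cast; ring
  rw [hv, Complex.norm_real, Complex.ofReal_ne_zero, Real.norm_eq_abs, abs_lt]
  rcases hc.near_sum with hn | hn <;>
  · have hb := hn.bounds
    rw [← he] at hb
    norm_num at hb
    refine ⟨(mul_ne_zero (by intro h0; linarith [hb.1, hb.2]) (by intro h0; linarith [hb.1, hb.2])),
      by nlinarith [hb.1, hb.2], by nlinarith [hb.1, hb.2]⟩

theorem near_iff {x : ℝ} {a : ℤ} {ε : ℕ} : Near x a ε ↔ |x - a / 10 ^ 14| ≤ (ε : ℝ) / 10 ^ 14 := by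
  have e : x * 10 ^ 14 - a = (x - a / 10 ^ 14) * 10 ^ 14 := by ring
  rw [Near, e, abs_mul, abs_of_pos (by norm_num : (0 : ℝ) < 10 ^ 14), le_div_iff₀ (by norm_num)]

/-- The cubic of `T` differs from the one with roots `a, b, c` by at most `3 * η` on `[-1, 1]`. A
first use of the gaps places `T` within `κ` of a root. The distances to the other two roots are then
known accurately, and their product, at least `M`, sharpens `κ` to `κ'`. -/
theorem near_three_roots {a b c e f k η g κ : ℝ} (h1 : 2 * g ≤ |a - b|) (h2 : 2 * g ≤ |b - c|)
    (h3 : 2 * g ≤ |a - c|) (he : |e - (a + b + c)| ≤ η) (hf : |f - (a * b + b * c + c * a)| ≤ η)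
    (hk : |k - a * b * c| ≤ η) (hg : 0 < g ∧ 3 * η < g ^ 2 * κ) {M κ' : ℝ}
    (hM : 0 < M ∧ 3 * η ≤ M * κ') (m1 : M ≤ (|a - b| - κ) * (|a - c| - κ))
    (m2 : M ≤ (|a - b| - κ) * (|b - c| - κ)) (m3 : M ≤ (|a - c| - κ) * (|b - c| - κ))
    (hκ : κ < 2 * g) (T : ℝ) (hT : |T| ≤ 1)
    (h : T ^ 3 - e * T ^ 2 + f * T - k = 0) : |T - a| ≤ κ' ∨ |T - b| ≤ κ' ∨ |T - c| ≤ κ' := by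
  suffices hη : |(T - a) * (T - b) * (T - c)| ≤ 3 * η by
    have tri : ∀ p q : ℝ, |T - p| ≤ κ → |p - q| - κ ≤ |T - q| := fun p q hp => by
      have := abs_sub_le p T q
      rw [abs_sub_comm p T] at this
      linarith
    rw [abs_mul, abs_mul] at hη
    have fin : ∀ p q r s t : ℝ, 0 ≤ p → p * q * r ≤ 3 * η → 0 ≤ s → 0 ≤ t → s ≤ q → t ≤ r →
        M ≤ s * t → p ≤ κ' := by
      intro p q r s t hp h1 hs ht hq hr hst
      have h2 : s * t ≤ q * r := mul_le_mul hq hr ht (hs.trans hq)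
      have h3 : p * M ≤ p * (q * r) := mul_le_mul_of_nonneg_left (hst.trans h2) hp
      refine le_of_mul_le_mul_left ?_ hM.1
      linarith
    have ba := abs_sub_comm b a
    have ca := abs_sub_comm c a
    have cb := abs_sub_comm c b
    rcases near_root_of_cubic hg.1 h1 h2 h3 (by rwa [abs_mul, abs_mul]) hg.2 with h | h | h
    · exact Or.inl (fin _ _ _ _ _ (abs_nonneg _) hη (by linarith) (by linarith) (tri a b h)
        (tri a c h) m1)
    · refine Or.inr (Or.inl (fin _ _ _ _ _ (abs_nonneg _) (by linarith) (by linarith) (by linarith)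
        (tri b a h) (tri b c h) (by rwa [ba])))
    · refine Or.inr (Or.inr (fin _ _ _ _ _ (abs_nonneg _) (by linarith) (by linarith) (by linarith)
        (tri c a h) (tri c b h) (by rwa [ca, cb])))
  have e1 : (T - a) * (T - b) * (T - c) = (e - (a + b + c)) * T ^ 2 -
      (f - (a * b + b * c + c * a)) * T + (k - a * b * c) := by linear_combination h
  have η0 : 0 ≤ η := (abs_nonneg _).trans he
  have hT2 : |T ^ 2| ≤ 1 := by rw [abs_pow]; exact pow_le_one₀ (abs_nonneg _) hT
  have t1 := mul_le_mul he hT2 (abs_nonneg _) η0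
  have t2 := mul_le_mul hf hT (abs_nonneg _) η0
  rw [← abs_mul] at t1 t2
  rw [e1]
  refine (abs_add_le _ _).trans ((add_le_add (abs_sub _ _) le_rfl).trans ?_)
  linarith

/-- Three numbers close to roots `a, b, c`, with the same sum and the same cyclic order, are close
to a cyclic permutation of `a, b, c`. -/
theorem near_perm {A B C a b c κ : ℝ} (hA : |A - a| ≤ κ ∨ |A - b| ≤ κ ∨ |A - c| ≤ κ)
    (hB : |B - a| ≤ κ ∨ |B - b| ≤ κ ∨ |B - c| ≤ κ) (hC : |C - a| ≤ κ ∨ |C - b| ≤ κ ∨ |C - c| ≤ κ)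
    (hcyc : (A - B) * (B - C) * (C - A) < 0) (hbc : 4 * κ < b - c)
    (hs : |A + B + C - (a + b + c)| ≤ κ) (hd : 4 * κ < (a - b) - (b - c)) :
    (|A - a| ≤ κ ∧ |B - b| ≤ κ ∧ |C - c| ≤ κ) ∨ (|B - a| ≤ κ ∧ |C - b| ≤ κ ∧ |A - c| ≤ κ) ∨
      (|C - a| ≤ κ ∧ |A - b| ≤ κ ∧ |B - c| ≤ κ) := by
  have odd : ∀ {p q r : ℝ}, |p - a| ≤ κ → |q - b| ≤ κ → |r - c| ≤ κ →
      0 < (p - q) * (q - r) * (p - r) := by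
    intro p q r hp hq hr
    rw [abs_le] at hp hq hr
    exact mul_pos (mul_pos (by linarith) (by linarith)) (by linarith)
  have hs' := abs_le.1 hs
  have bd : ∀ {p q : ℝ}, |p - q| ≤ κ → q - κ ≤ p ∧ p ≤ q + κ := fun h => by
    rw [abs_le] at h; constructor <;> linarith [h.1, h.2]
  -- Of the 27 cases, three are the cyclic arrangements, the odd arrangements have the wrong sign,
  -- and repetitions contradict the sum. The hypothesis `hd` is what excludes all three lying near
  -- `b`.
  rcases hA with hA | hA | hA <;> rcases hB with hB | hB | hB <;> rcases hC with hC | hC | hC <;>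
    first
    | exact Or.inl ⟨hA, hB, hC⟩
    | exact Or.inr (Or.inl ⟨hB, hC, hA⟩)
    | exact Or.inr (Or.inr ⟨hC, hA, hB⟩)
    | (have h1 := bd hA; have h2 := bd hB; have h3 := bd hC
       exfalso; linarith [h1.1, h1.2, h2.1, h2.2, h3.1, h3.2, hs'.1, hs'.2])
    | (have := odd hA hC hB; linarith)
    | (have := odd hB hA hC; linarith)
    | (have := odd hC hB hA; linarith)

/-- The sum `e` yields `w` by `linear_eq`, then `f` by `symm_eqs`, then `A * B * C` by `hK`. So `A,
B, C` are roots of a known cubic, and `cyclic` orders them up to rotation. Polynomials in `e` are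
evaluated by Horner's rule. -/
theorem PlanarRelations.near_first {A B C w : ℝ} (h : PlanarRelations A B C w) (hA : |A| ≤ 1)
    (hB : |B| ≤ 1) (hC : |C| ≤ 1) (he : Near (A + B + C) (-120287464584835) 20) :
    Near w 39850695380179 81 ∧
      ((Near A 48938990594000 9025 ∧ Near B (-74684396505393) 9025 ∧
        Near C (-94542058673443) 9025) ∨
      (Near B 48938990594000 9025 ∧ Near C (-74684396505393) 9025 ∧
        Near A (-94542058673443) 9025) ∨
      (Near C 48938990594000 9025 ∧ Near A (-74684396505393) 9025 ∧
        Near B (-94542058673443) 9025)) := by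
  generalize hee : A + B + C = e at he
  generalize hf : A * B + B * C + C * A = f
  have heb := he.bounds
  norm_num at heb
  have hl := h.linear_eq hee.symm (by linarith [heb.1, heb.2]) (by linarith [heb.1, heb.2])
  have hH := (h.symm_eqs hee.symm hf.symm).2
  have n1 := (Near.int 48).mul he (-5773798300072080) 960 (by decide +kernel)
  have n2 := (n1.sub (Near.int 8)).mul he 7907455302077688 2471 (by decide +kernel)
  have n3 := (n2.sub (Near.int 28)).mul he (-6143628487672976) 3995 (by decide +kernel)
  have n4 := (n3.add (Near.int 74)).mul he (-1511257437944325) 5057 (by decide +kernel)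
  have n5 : Near (48 * e ^ 4 - 8 * e ^ 3 - 28 * e ^ 2 + 74 * e - 302) (-31711257437944325) 5057 :=
    (n4.sub (Near.int 302)).congr (by push_cast; ring)
  have n6 := (Near.int 16).mul he (-1924599433357360) 320 (by decide +kernel)
  have n7 := (n6.sub (Near.int 48)).mul he 8088850161871749 1731 (by decide +kernel)
  have n8 := (n7.sub (Near.int 476)).mul he 47526960368599611 9985 (by decide +kernel)
  have n9 := (n8.sub (Near.int 492)).mul he 2012456954110997 12346 (by decide +kernel)
  have n10 := (n9.add (Near.int 405)).mul he (-51137156602819490) 23354 (by decide +kernel)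
  have n11 : Near (16 * e ^ 5 - 48 * e ^ 4 - 476 * e ^ 3 - 492 * e ^ 2 + 405 * e + 385)
      (-12637156602819490) 23354 :=
    (n10.add (Near.int 385)).congr (by push_cast; ring)
  have n12 : Near w 39850695380179 81 :=
    Near.div n11 n5 ((mul_comm _ _).trans hl) 39850695380179 81 (by decide +kernel)
    (by decide +kernel)
  have n13 := (Near.int (-4)).mul he 481149858339340 80 (by decide +kernel)
  have n14 := (n13.add (Near.int 4)).mul he (-1059912823789257) 273 (by decide +kernel)
  have n15 := (Near.int (-3)).mul he 360862393754505 60 (by decide +kernel)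
  have n16 := (n15.add (Near.int 4)).mul he (-915222082426778) 225 (by decide +kernel)
  have n17 := (n16.add (Near.int 17)).mul he (-943989459670495) 428 (by decide +kernel)
  have n18 := (Near.int 2).mul he (-240574929169670) 40 (by decide +kernel)
  have n19 := (n18.add (Near.int 4)).mul he (-191768375614381) 81 (by decide +kernel)
  have n20 := (n19.sub (Near.int 15)).mul he 2034985285674587 436 (by decide +kernel)
  have n21 := (n20.sub (Near.int 39)).mul he 2243378913996143 898 (by decide +kernel)
  have n22 := (n14.add (Near.int 24)).mul n12 534034058420586 1195 (by decide +kernel)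
  have n23 := (n22.add (n17.sub (Near.int 6))).mul n12 (-402474250427766) 1466 (by decide +kernel)
  have n24 : Near (((-4 * e + 4) * e + 24) * w ^ 2 + (((-3 * e + 4) * e + 17) * e - 6) * w +
      ((((2 * e + 4) * e - 15) * e - 39) * e - 18)) 40904663568377 2364 :=
    (n23.add (n21.sub (Near.int 18))).congr (by push_cast; ring)
  have n25 := (he.sub (Near.int 3)).mul (he.add (Near.int 2)) (-335021794052686) 101 (by
      decide +kernel)
  have n26 : Near ((e - 3) * (e + 2)) (-335021794052686) 101 :=
    n25.congr (by push_cast; ring)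
  have n27 : Near f (-12209553018495) 710 :=
    Near.div n24 n26 (by linear_combination -2 * hH) (-12209553018495) 710 (by decide +kernel)
    (by decide +kernel)
  have n28 := he.mul he 144690741362479 49 (by decide +kernel)
  have n29 := (Near.int 2).mul n27 (-24419106036990) 1420 (by decide +kernel)
  -- Here `2 * A * B * C = e ^ 2 - 2 * f - 1`, which is `hK`.
  have n30 := Near.half (((n28.sub n29).sub (Near.int 1)).congr (y := 2 * (A * B * C)) (by
      rw [← hf, ← hee]; push_cast; linear_combination -h.hK)) 34554923699734 735 (by decide +kernel)
  have n31 := (Near.int 2).mul n12 79701390760358 162 (by decide +kernel)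
  have n32 := (he.add (Near.int 2)).mul he (-95884187807191) 41 (by decide +kernel)
  have n33 := (Near.int 4).mul n27 (-48838212073980) 2840 (by decide +kernel)
  have n34 := (n31.sub (Near.int 1)).mul ((n32.sub (Near.int 3)).sub n33) 70445506495987 1148 (by
      decide +kernel)
  have n35 : Near ((2 * w - 1) * ((e + 2) * e - 3 - 4 * f)) 70445506495987 1148 :=
    n34.congr (by push_cast; ring)
  refine ⟨n12, ?_⟩
  have hcyc : 0 < (2 * w - 1) * ((e + 2) * e - 3 - 4 * f) := by
    have := n35.bounds
    norm_num at this
    linarith [this.1]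
  have hcyc' : (A - B) * (B - C) * (C - A) < 0 := by
    have := h.cyclic
    rw [hf, hee] at this
    linarith
  -- `2 * g` lies just below the smallest gap of the roots, `κ` is just above `3 * η / g ^ 2`, and
  -- `κ'` just above `3 * η / M`.
  have hroot := near_three_roots (a := 48938990594000 / 10 ^ 14) (b := (-74684396505393) / 10 ^ 14)
    (c := (-94542058673443) / 10 ^ 14) (e := e) (f := f) (k := A * B * C) (η := 737 / 10 ^ 14)
    (g := 1 / 11) (κ := 267532 / 10 ^ 14)
    (M := 245 / 1000) (κ' := 9025 / 10 ^ 14) (by norm_num [le_abs]) (by norm_num [le_abs])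
    (by norm_num [le_abs])
    (by
      have := he.bounds
      norm_num at this
      rw [abs_le]
      constructor <;> linarith [this.1, this.2])
    (by
      have := n27.bounds
      norm_num at this
      rw [abs_le]
      constructor <;> linarith [this.1, this.2])
    (by
      have := n30.bounds
      norm_num at this
      rw [abs_le]
      constructor <;> linarith [this.1, this.2])
    (by norm_num) (by norm_num) (by norm_num [abs_of_pos, abs_of_neg]) (by norm_num [abs_of_pos,
        abs_of_neg])
    (by norm_num [abs_of_pos, abs_of_neg]) (by norm_num)
  have rA := hroot A hA (by rw [← hf, ← hee]; ring)
  have rB := hroot B hB (by rw [← hf, ← hee]; ring)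
  have rC := hroot C hC (by rw [← hf, ← hee]; ring)
  simp only [near_iff, Int.cast_neg, Int.cast_ofNat, Nat.cast_ofNat]
  have key := near_perm (a := 48938990594000 / 10 ^ 14) (b := (-74684396505393) / 10 ^ 14)
    (c := (-94542058673443) / 10 ^ 14) (κ := 9025 / 10 ^ 14) rA rB rC hcyc' (by norm_num) (by
      rw [hee, abs_le]
      constructor <;> linarith [heb.1, heb.2]) (by norm_num)
  exact key

/-- The same derivation at the other value of `e`. The roots are further apart here, which permits a
larger `g` and gives a smaller final error. -/
theorem PlanarRelations.near_second {A B C w : ℝ} (h : PlanarRelations A B C w) (hA : |A| ≤ 1)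
    (hB : |B| ≤ 1) (hC : |C| ≤ 1) (he : Near (A + B + C) (-54691982323974) 20) :
    Near w (-25814643779110) 50 ∧
      ((Near A 76318781472811 2278 ∧ Near B (-40852865319455) 2278 ∧
        Near C (-90157898477329) 2278) ∨
      (Near B 76318781472811 2278 ∧ Near C (-40852865319455) 2278 ∧
        Near A (-90157898477329) 2278) ∨
      (Near C 76318781472811 2278 ∧ Near A (-40852865319455) 2278 ∧
        Near B (-90157898477329) 2278)) := by
  generalize hee : A + B + C = e at he
  generalize hf : A * B + B * C + C * A = f
  have heb := he.bounds
  norm_num at heb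
  have hl := h.linear_eq hee.symm (by linarith [heb.1, heb.2]) (by linarith [heb.1, heb.2])
  have hH := (h.symm_eqs hee.symm hf.symm).2
  have n1 := (Near.int 48).mul he (-2625215151550752) 960 (by decide +kernel)
  have n2 := (n1.sub (Near.int 8)).mul he 1873318065244217 1211 (by decide +kernel)
  have n3 := (n2.sub (Near.int 28)).mul he 506820719956093 848 (by decide +kernel)
  have n4 := (n3.add (Near.int 74)).mul he (-4324396990546700) 2046 (by decide +kernel)
  have n5 : Near (48 * e ^ 4 - 8 * e ^ 3 - 28 * e ^ 2 + 74 * e - 302) (-34524396990546700) 2046 :=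
    (n4.sub (Near.int 302)).congr (by push_cast; ring)
  have n6 := (Near.int 16).mul he (-875071717183584) 320 (by decide +kernel)
  have n7 := (n6.sub (Near.int 48)).mul he 3103809220434894 1311 (by decide +kernel)
  have n8 := (n7.sub (Near.int 476)).mul he 24335848796001497 9617 (by decide +kernel)
  have n9 := (n8.sub (Near.int 492)).mul he 13598697181497030 10233 (by decide +kernel)
  have n10 := (n9.add (Near.int 405)).mul he (-29587649900004576) 16417 (by decide +kernel)
  have n11 : Near (16 * e ^ 5 - 48 * e ^ 4 - 476 * e ^ 3 - 492 * e ^ 2 + 405 * e +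
      385) 8912350099995424 16417 :=
    (n10.add (Near.int 385)).congr (by push_cast; ring)
  have n12 : Near w (-25814643779110) 50 :=
    Near.div n11 n5 ((mul_comm _ _).trans hl) (-25814643779110) 50 (by decide +kernel)
    (by decide +kernel)
  have n13 := (Near.int (-4)).mul he 218767929295896 80 (by decide +kernel)
  have n14 := (n13.add (Near.int 4)).mul he (-338416446516931) 168 (by decide +kernel)
  have n15 := (Near.int (-3)).mul he 164075946971922 60 (by decide +kernel)
  have n16 := (n15.add (Near.int 4)).mul he (-308504317211673) 147 (by decide +kernel)
  have n17 := (n16.add (Near.int 17)).mul he (-761036572869453) 359 (by decide +kernel)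
  have n18 := (Near.int 2).mul he (-109383964647948) 40 (by decide +kernel)
  have n19 := (n18.add (Near.int 4)).mul he (-158943670685378) 81 (by decide +kernel)
  have n20 := (n19.sub (Near.int 15)).mul he 907309179135932 377 (by decide +kernel)
  have n21 := (n20.sub (Near.int 39)).mul he 1636761934758168 806 (by decide +kernel)
  have n22 := (n14.add (Near.int 24)).mul n12 (-532190450540372) 1075 (by decide +kernel)
  have n23 := (n22.add (n17.sub (Near.int 6))).mul n12 488729812023094 1317 (by decide +kernel)
  have n24 : Near (((-4 * e + 4) * e + 24) * w ^ 2 + (((-3 * e + 4) * e + 17) * e - 6) * w +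
      ((((2 * e + 4) * e - 15) * e - 39) * e - 18)) 325491746781262 2123 :=
    (n23.add (n21.sub (Near.int 18))).congr (by push_cast; ring)
  have n25 := (he.sub (Near.int 3)).mul (he.add (Near.int 2)) (-515395888370767) 101 (by
      decide +kernel)
  have n26 : Near ((e - 3) * (e + 2)) (-515395888370767) 101 :=
    n25.congr (by push_cast; ring)
  have n27 : Near f (-63153733688133) 425 :=
    Near.div n24 n26 (by linear_combination -2 * hH) (-63153733688133) 425 (by decide +kernel)
    (by decide +kernel)
  have n28 := he.mul he 29912129305259 23 (by decide +kernel)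
  have n29 := (Near.int 2).mul n27 (-126307467376266) 850 (by decide +kernel)
  have n30 := Near.half (((n28.sub n29).sub (Near.int 1)).congr (y := 2 * (A * B * C)) (by
      rw [← hf, ← hee]; push_cast; linear_combination -h.hK)) 28109798340762 437 (by decide +kernel)
  have n31 := (Near.int 2).mul n12 (-51629287558220) 100 (by decide +kernel)
  have n32 := (he.add (Near.int 2)).mul he (-79471835342689) 41 (by decide +kernel)
  have n33 := (Near.int 4).mul n27 (-252614934752532) 1700 (by decide +kernel)
  have n34 := (n31.sub (Near.int 1)).mul ((n32.sub (Near.int 3)).sub n33) 192352214583294 2768 (by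
      decide +kernel)
  have n35 : Near ((2 * w - 1) * ((e + 2) * e - 3 - 4 * f)) 192352214583294 2768 :=
    n34.congr (by push_cast; ring)
  refine ⟨n12, ?_⟩
  have hcyc : 0 < (2 * w - 1) * ((e + 2) * e - 3 - 4 * f) := by
    have := n35.bounds
    norm_num at this
    linarith [this.1]
  have hcyc' : (A - B) * (B - C) * (C - A) < 0 := by
    have := h.cyclic
    rw [hf, hee] at this
    linarith
  have hroot := near_three_roots (a := 76318781472811 / 10 ^ 14) (b := (-40852865319455) / 10 ^ 14)
    (c := (-90157898477329) / 10 ^ 14) (e := e) (f := f) (k := A * B * C) (η := 438 / 10 ^ 14)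
    (g := 1 / 5) (κ := 32851 / 10 ^ 14)
    (M := 577 / 1000) (κ' := 2278 / 10 ^ 14) (by norm_num [le_abs]) (by norm_num [le_abs])
    (by norm_num [le_abs])
    (by
      have := he.bounds
      norm_num at this
      rw [abs_le]
      constructor <;> linarith [this.1, this.2])
    (by
      have := n27.bounds
      norm_num at this
      rw [abs_le]
      constructor <;> linarith [this.1, this.2])
    (by
      have := n30.bounds
      norm_num at this
      rw [abs_le]
      constructor <;> linarith [this.1, this.2])
    (by norm_num) (by norm_num) (by norm_num [abs_of_pos, abs_of_neg]) (by norm_num [abs_of_pos,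
        abs_of_neg])
    (by norm_num [abs_of_pos, abs_of_neg]) (by norm_num)
  have rA := hroot A hA (by rw [← hf, ← hee]; ring)
  have rB := hroot B hB (by rw [← hf, ← hee]; ring)
  have rC := hroot C hC (by rw [← hf, ← hee]; ring)
  simp only [near_iff, Int.cast_neg, Int.cast_ofNat, Nat.cast_ofNat]
  have key := near_perm (a := 76318781472811 / 10 ^ 14) (b := (-40852865319455) / 10 ^ 14)
    (c := (-90157898477329) / 10 ^ 14) (κ := 2278 / 10 ^ 14) rA rB rC hcyc' (by norm_num) (by
      rw [hee, abs_le]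
      constructor <;> linarith [heb.1, heb.2]) (by norm_num)
  exact key

theorem norm_sub_le_of_near {z : ℂ} {a b p q : ℤ} {ε δ : ℕ} (hr : Near z.re a ε)
    (hi : Near z.im b δ) (ha : (a - p * 10 ^ 8).natAbs + ε ≤ 10 ^ 8)
    (hb : (b - q * 10 ^ 8).natAbs + δ ≤ 10 ^ 8) :
    ‖z - ((p : ℂ) + q * Complex.I) / 10 ^ 6‖ ≤ 2 / 10 ^ 6 := by
  have key : ∀ {x : ℝ} {a p : ℤ} {ε : ℕ}, Near x a ε → (a - p * 10 ^ 8).natAbs + ε ≤ 10 ^ 8 →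
      |x - p / 10 ^ 6| ≤ 1 / 10 ^ 6 := by
    intro x a p ε h h'
    have h0 := Near.abs_cast_le (a - p * 10 ^ 8)
    have h1 : ((a - p * 10 ^ 8).natAbs + ε : ℝ) ≤ 10 ^ 8 := by exact_mod_cast h'
    have h2 := h.bounds
    generalize (a - p * 10 ^ 8).natAbs = k at h0 h1
    push_cast at h0
    rw [abs_le] at h0 ⊢
    constructor <;> linarith [h0.1, h0.2, h2.1, h2.2]
  refine (Complex.norm_le_abs_re_add_abs_im _).trans ?_
  have e : ((p : ℂ) + q * Complex.I) / 10 ^ 6 = ((p / 10 ^ 6 : ℝ) : ℂ) +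
      ((q / 10 ^ 6 : ℝ) : ℂ) * Complex.I := by push_cast; ring
  have h1 := key hr ha
  have h2 := key hi hb
  rw [e]
  simp only [Complex.sub_re, Complex.sub_im, Complex.add_re, Complex.add_im, Complex.ofReal_re,
    Complex.ofReal_im, Complex.re_ofReal_mul, Complex.im_ofReal_mul, Complex.I_re, Complex.I_im,
    mul_zero, mul_one, add_zero, zero_add]
  linarith

/-- With `x = 1`, the Gram data are the real parts of `y` and `z`, and the rest follows: the
imaginary parts, then `u - v` from its inner products with `1` and `y`, then `u`, `v` and the
normalizing factor. -/
theorem IsCoreSolution.approxFirst {y z u v : ℂ} (h : IsCoreSolution 1 y z u v) (hy : 0 ≤ y.im)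
    (nw : Near (ip u (1 + y + z) + 1) 39850695380179 81) (nA : Near (ip y z) 48938990594000 9025)
    (nB : Near (ip z 1) (-74684396505393) 9025) (nC : Near (ip 1 y) (-94542058673443) 9025) :
    ApproxSymbols (coreSymbols 1 y z u v) symbolReFirst symbolImFirst := by
  have h1 : ip (u - v) 1 = ip u (1 + y + z) + 1 + ip 1 y := h.diff_x
  have h2 := h.diff_y
  have h3 := h.diff_u
  have hyy : y.re * y.re + y.im * y.im = 1 := ip_self_of_norm_one h.hy
  rw [show ip (u - v) 1 = (u - v).re by simp [ip], show ip 1 y = y.re by simp [ip]] at h1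
  set f := -(starRingEnd ℂ) (v + 2 * (1 + y + z + u)) with f_def
  have n1 : Near (y.re) (-94542058673443) 9025 :=
    nC.congr (by simp [ip])
  have n2 : Near (z.re) (-74684396505393) 9025 :=
    nB.congr (by simp [ip])
  have n3 := n1.mul n1 89382008582127 17066 (by decide +kernel)
  -- The hypothesis `hy` selects the square root; this is where the freedom of complex conjugation
  -- is used up.
  have n4 : Near (y.im) 32585259578332 52375 :=
    Near.sqrt ((Near.int 1).sub n3) hy (by push_cast; linarith [hyy]) 32585259578332 52375 (by
        decide +kernel)
    (by decide +kernel)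
  have n5 := n1.mul n2 70608165964035 15274 (by decide +kernel)
  have n6 : Near (z.im) (-66499931718955) 181458 :=
    Near.div (nA.sub n5) n4 (by simp only [ip]; ring) (-66499931718955) 181458 (by decide +kernel)
    (by decide +kernel)
  have n7 : Near ((u - v).re) (-54691363293264) 9106 :=
    (nw.add n1).congr (by rw [← h1])
  have n8 := n7.mul n1 51706340774024 13546 (by decide +kernel)
  have n9 : Near ((u - v).im) 113804050297681 252437 :=
    Near.div ((nw.add nA).sub n8) n4 (by rw [← h2]; simp only [ip]; ring) 113804050297681 252437
        (by decide +kernel)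
    (by decide +kernel)
  have n10 : Near ((1 + y + z).re) (-69226455178836) 18050 :=
    (((Near.int 1).add n1).add n2).congr (by push_cast; simp)
  have n11 : Near ((1 + y + z).im) (-33914672140623) 233833 :=
    (n4.add n6).congr (by simp)
  have n12 := n10.mul n9 (-78782509871024) 195295 (by decide +kernel)
  have n13 := n11.mul n7 18548396550148 130976 (by decide +kernel)
  have n14 : Near (ip u (u - v)) 79712535415164 27075 :=
    ((Near.int 2).add ((nA.add nB).add nC)).congr (by push_cast; rw [h3])
  have n15 : Near (ip u (1 + y + z)) (-60149304619821) 81 :=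
    (nw.sub (Near.int 1)).congr (by push_cast; ring)
  have n16 := n15.mul n9 (-68452344883246) 151932 (by decide +kernel)
  have n17 := n14.mul n11 (-27034245041031) 195577 (by decide +kernel)
  -- Cramer's rule for `u`, whose inner products with `1 + y + z` and with `u - v` are known.
  have n18 : Near (u.re) 42553903343908 499688 :=
    Near.div (n16.sub n17) (n12.sub n13) (by simp only [ip]; ring) 42553903343908 499688 (by
        decide +kernel)
    (by decide +kernel)
  have n19 := n10.mul n14 (-55182162601092) 33132 (by decide +kernel)
  have n20 := n7.mul n15 32896474707998 5522 (by decide +kernel)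
  have n21 : Near (u.im) 90494007040225 343067 :=
    Near.div (n19.sub n20) (n12.sub n13) (by simp only [ip]; ring) 90494007040225 343067 (by
        decide +kernel)
    (by decide +kernel)
  have n22 : Near (v.re) 97245266637172 508794 :=
    (n18.sub n7).congr (by simp)
  have n23 : Near (v.im) (-23310043257456) 595504 :=
    (n21.sub n9).congr (by simp)
  have n24 := (Near.int 2).mul (n10.add n18) (-53345103669856) 1035476 (by decide +kernel)
  have n25 : Near (f.re) (-43900162967316) 1544270 :=
    (n22.add n24).neg.congr (by push_cast; simp [f])
  have n26 := (Near.int 2).mul (n11.add n21) 113158669799204 1153800 (by decide +kernel)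
  have n27 : Near (f.im) 89848626541748 1749304 :=
    (n23.add n26).congr (by push_cast; simp [f]; ring)
  have n28 : Near ((f * 1).re) (-43900162967316) 1544270 :=
    n25.congr (by rw [mul_one])
  have n29 : Near ((f * 1).im) 89848626541748 1749304 :=
    n27.congr (by rw [mul_one])
  have n30 := n25.mul n1 41504117830297 1463947 (by decide +kernel)
  have n31 := n27.mul n4 29277408186195 617074 (by decide +kernel)
  have n32 := n25.mul n4 (-14304982058211) 526198 (by decide +kernel)
  have n33 := n27.mul n1 (-84944741222382) 1661937 (by decide +kernel)
  have n34 : Near ((f * y).re) 12226709644102 2081021 :=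
    (n30.sub n31).congr (by rw [Complex.mul_re])
  have n35 : Near ((f * y).im) (-99249723280593) 2188135 :=
    (n32.add n33).congr (by rw [Complex.mul_im])
  have n36 := n25.mul n2 32786571777024 1157291 (by decide +kernel)
  have n37 := n27.mul n6 (-59749275300681) 1326324 (by decide +kernel)
  have n38 := n25.mul n6 29193578397775 1106599 (by decide +kernel)
  have n39 := n27.mul n2 (-67102904501089) 1314567 (by decide +kernel)
  have n40 : Near ((f * z).re) 92535847077705 2483615 :=
    (n36.sub n37).congr (by rw [Complex.mul_re])
  have n41 : Near ((f * z).im) (-37909326103314) 2421166 :=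
    (n38.add n39).congr (by rw [Complex.mul_im])
  have n42 := n25.mul n18 (-18681232916930) 876512 (by decide +kernel)
  have n43 := n27.mul n21 81307622428235 1891257 (by decide +kernel)
  have n44 := n25.mul n21 (-39727016566313) 1548079 (by decide +kernel)
  have n45 := n27.mul n18 38234097694404 1193361 (by decide +kernel)
  have n46 : Near ((f * u).re) (-99988855345165) 2767769 :=
    (n42.sub n43).congr (by rw [Complex.mul_re])
  have n47 : Near ((f * u).im) (-1492918871909) 2741440 :=
    (n44.add n45).congr (by rw [Complex.mul_im])
  have n48 := n25.mul n22 (-42690830531719) 1725092 (by decide +kernel)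
  have n49 := n27.mul n23 (-20943753713112) 942817 (by decide +kernel)
  have n50 := n25.mul n23 10233146977775 621398 (by decide +kernel)
  have n51 := n27.mul n22 87373536450360 2158261 (by decide +kernel)
  have n52 : Near ((f * v).re) (-21747076818607) 2667909 :=
    (n48.sub n49).congr (by rw [Complex.mul_re])
  have n53 : Near ((f * v).im) 97606683428135 2779659 :=
    (n50.add n51).congr (by rw [Complex.mul_im])
  intro i
  fin_cases i
  · exact norm_sub_le_of_near (z := 1) (p := 1000000) (q := 0)
      ((Near.int 1).congr (by simp)) ((Near.int 0).congr (by simp)) (by decide +kernel) (by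
          decide +kernel)
  · exact norm_sub_le_of_near (p := (-439002)) (q := 898486) n28 n29 (by decide +kernel) (by
        decide +kernel)
  · exact norm_sub_le_of_near (p := 122267) (q := (-992497)) n34 n35 (by decide +kernel) (by
        decide +kernel)
  · exact norm_sub_le_of_near (p := 925358) (q := (-379093)) n40 n41 (by decide +kernel) (by
        decide +kernel)
  · exact norm_sub_le_of_near (p := (-999889)) (q := (-14929)) n46 n47 (by decide +kernel) (by
        decide +kernel)
  · exact norm_sub_le_of_near (p := (-217471)) (q := 976067) n52 n53 (by decide +kernel) (by
        decide +kernel)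

theorem IsCoreSolution.approxSecond {y z u v : ℂ} (h : IsCoreSolution 1 y z u v) (hy : 0 ≤ y.im)
    (nw : Near (ip u (1 + y + z) + 1) (-25814643779110) 50) (nA : Near (ip y z) 76318781472811 2278)
    (nB : Near (ip z 1) (-40852865319455) 2278) (nC : Near (ip 1 y) (-90157898477329) 2278) :
    ApproxSymbols (coreSymbols 1 y z u v) symbolReSecond symbolImSecond := by
  have h1 : ip (u - v) 1 = ip u (1 + y + z) + 1 + ip 1 y := h.diff_x
  have h2 := h.diff_y
  have h3 := h.diff_u
  have hyy : y.re * y.re + y.im * y.im = 1 := ip_self_of_norm_one h.hy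
  rw [show ip (u - v) 1 = (u - v).re by simp [ip], show ip 1 y = y.re by simp [ip]] at h1
  set f := -(starRingEnd ℂ) (v + 2 * (1 + y + z + u)) with f_def
  have n1 : Near (y.re) (-90157898477329) 2278 :=
    nC.congr (by simp [ip])
  have n2 : Near (z.re) (-40852865319455) 2278 :=
    nB.congr (by simp [ip])
  have n3 := n1.mul n1 81284466578484 4108 (by decide +kernel)
  have n4 : Near (y.im) 43261453306050 9498 :=
    Near.sqrt ((Near.int 1).sub n3) hy (by push_cast; linarith [hyy]) 43261453306050 9498 (by
        decide +kernel)
    (by decide +kernel)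
  have n5 := n1.mul n2 36832084839794 2985 (by decide +kernel)
  have n6 : Near (z.im) 91274549548003 32206 :=
    Near.div (nA.sub n5) n4 (by simp only [ip]; ring) 91274549548003 32206 (by decide +kernel)
    (by decide +kernel)
  have n7 : Near ((u - v).re) (-115972542256439) 2328 :=
    (nw.add n1).congr (by rw [← h1])
  have n8 := n7.mul n1 104558406909138 4741 (by decide +kernel)
  have n9 : Near ((u - v).im) (-124947881045590) 43773 :=
    Near.div ((nw.add nA).sub n8) n4 (by rw [← h2]; simp only [ip]; ring) (-124947881045590) 43773
        (by decide +kernel)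
    (by decide +kernel)
  have n10 : Near ((1 + y + z).re) (-31010763796784) 4556 :=
    (((Near.int 1).add n1).add n2).congr (by push_cast; simp)
  have n11 : Near ((1 + y + z).im) 134536002854053 41704 :=
    (n4.add n6).congr (by simp)
  have n12 := n10.mul n9 38747292260135 19268 (by decide +kernel)
  have n13 := n11.mul n7 (-156024822760041) 51498 (by decide +kernel)
  have n14 : Near (ip u (u - v)) 145308017676027 6834 :=
    ((Near.int 2).add ((nA.add nB).add nC)).congr (by push_cast; rw [h3])
  have n15 : Near (ip u (1 + y + z)) (-125814643779110) 50 :=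
    (nw.sub (Near.int 1)).congr (by push_cast; ring)
  have n16 := n15.mul n9 157202731447055 55136 (by decide +kernel)
  have n17 := n14.mul n11 195491598807788 69794 (by decide +kernel)
  have n18 : Near (u.re) (-19658290077492) 71285 :=
    Near.div (n16.sub n17) (n12.sub n13) (by simp only [ip]; ring) (-19658290077492) 71285 (by
        decide +kernel)
    (by decide +kernel)
  have n19 := n10.mul n14 (-45061126139302) 8740 (by decide +kernel)
  have n20 := n7.mul n15 145910440921517 2988 (by decide +kernel)
  have n21 : Near (u.im) (-98048720701645) 41646 :=
    Near.div (n19.sub n20) (n12.sub n13) (by simp only [ip]; ring) (-98048720701645) 41646 (by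
        decide +kernel)
    (by decide +kernel)
  have n22 : Near (v.re) 96314252178947 73613 :=
    (n18.sub n7).congr (by simp)
  have n23 : Near (v.im) 26899160343945 85419 :=
    (n21.sub n9).congr (by simp)
  have n24 := (Near.int 2).mul (n10.add n18) (-101338107748552) 151682 (by decide +kernel)
  have n25 : Near (f.re) 5023855569605 225295 :=
    (n22.add n24).neg.congr (by push_cast; simp [f])
  have n26 := (Near.int 2).mul (n11.add n21) 72974564304816 166700 (by decide +kernel)
  have n27 : Near (f.im) 99873724648761 252119 :=
    (n23.add n26).congr (by push_cast; simp [f]; ring)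
  have n28 : Near ((f * 1).re) 5023855569605 225295 :=
    n25.congr (by rw [mul_one])
  have n29 : Near ((f * 1).im) 99873724648761 252119 :=
    n27.congr (by rw [mul_one])
  have n30 := n25.mul n1 (-4529402604092) 203236 (by decide +kernel)
  have n31 := n27.mul n4 43206824753937 118557 (by decide +kernel)
  have n32 := n25.mul n4 2173392931408 97944 (by decide +kernel)
  have n33 := n27.mul n1 (-90044051274357) 229581 (by decide +kernel)
  have n34 : Near ((f * y).re) (-47736227358029) 321793 :=
    (n30.sub n31).congr (by rw [Complex.mul_re])
  have n35 : Near ((f * y).im) (-87870658342949) 327525 :=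
    (n32.add n33).congr (by rw [Complex.mul_im])
  have n36 := n25.mul n2 (-2052388949695) 92155 (by decide +kernel)
  have n37 := n27.mul n6 91159292289969 262287 (by decide +kernel)
  have n38 := n25.mul n6 4585501541099 207256 (by decide +kernel)
  have n39 := n27.mul n2 (-40801278220282) 105274 (by decide +kernel)
  have n40 : Near ((f * z).re) (-93211681239664) 354442 :=
    (n36.sub n37).congr (by rw [Complex.mul_re])
  have n41 : Near ((f * z).im) (-36215776679183) 312530 :=
    (n38.add n39).congr (by rw [Complex.mul_im])
  have n42 := n25.mul n18 (-987604100947) 47871 (by decide +kernel)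
  have n43 := n27.mul n21 (-97924909335194) 288794 (by decide +kernel)
  have n44 := n25.mul n21 (-4925826115896) 222992 (by decide +kernel)
  have n45 := n27.mul n18 (-19633466502649) 120758 (by decide +kernel)
  have n46 : Near ((f * u).re) 96937305234247 336665 :=
    (n42.sub n43).congr (by rw [Complex.mul_re])
  have n47 : Near ((f * u).im) (-24559292618545) 343750 :=
    (n44.add n45).congr (by rw [Complex.mul_im])
  have n48 := n25.mul n22 4838688922415 220690 (by decide +kernel)
  have n49 := n27.mul n23 26865193334740 153130 (by decide +kernel)
  have n50 := n25.mul n23 1351374965116 64895 (by decide +kernel)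
  have n51 := n27.mul n22 96192631018715 316347 (by decide +kernel)
  have n52 : Near ((f * v).re) (-22026504412325) 373820 :=
    (n48.sub n49).congr (by rw [Complex.mul_re])
  have n53 : Near ((f * v).im) 97544005983831 381242 :=
    (n50.add n51).congr (by rw [Complex.mul_im])
  intro i
  fin_cases i
  · exact norm_sub_le_of_near (z := 1) (p := 1000000) (q := 0)
      ((Near.int 1).congr (by simp)) ((Near.int 0).congr (by simp)) (by decide +kernel) (by
          decide +kernel)
  · exact norm_sub_le_of_near (p := 50239) (q := 998737) n28 n29 (by decide +kernel) (by
        decide +kernel)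
  · exact norm_sub_le_of_near (p := (-477362)) (q := (-878707)) n34 n35 (by decide +kernel) (by
        decide +kernel)
  · exact norm_sub_le_of_near (p := (-932117)) (q := (-362158)) n40 n41 (by decide +kernel) (by
        decide +kernel)
  · exact norm_sub_le_of_near (p := 969373) (q := (-245593)) n46 n47 (by decide +kernel) (by
        decide +kernel)
  · exact norm_sub_le_of_near (p := (-220265)) (q := 975440) n52 n53 (by decide +kernel) (by
        decide +kernel)

/-! ### Reduction to the two reference solutions -/

/-- Location of the Gram data of a core solution at the first or at the second of the two
reference solutions. -/
def IsLocated (x y z u : ℂ) : Prop :=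
  (Near (ip u (x + y + z) + 1) 39850695380179 81 ∧ Near (ip y z) 48938990594000 9025 ∧
    Near (ip z x) (-74684396505393) 9025 ∧ Near (ip x y) (-94542058673443) 9025) ∨
  (Near (ip u (x + y + z) + 1) (-25814643779110) 50 ∧ Near (ip y z) 76318781472811 2278 ∧
    Near (ip z x) (-40852865319455) 2278 ∧ Near (ip x y) (-90157898477329) 2278)

theorem abs_ip_le_one {p q : ℂ} (hp : ‖p‖ = 1) (hq : ‖q‖ = 1) : |ip p q| ≤ 1 := by
  have e : ip p q = (p * (starRingEnd ℂ) q).re := by simp [ip]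
  rw [e]
  refine (Complex.abs_re_le_norm _).trans ?_
  rw [norm_mul, RCLike.norm_conj, hp, hq, mul_one]

namespace IsCoreSolution

variable {x y z u v : ℂ}

theorem isLocated_rotation (h : IsCoreSolution x y z u v) :
    IsLocated x y z u ∨ IsLocated y z x u ∨ IsLocated z x y u := by
  have hA := abs_ip_le_one h.hy h.hz
  have hB := abs_ip_le_one h.hz h.hx
  have hC := abs_ip_le_one h.hx h.hy
  have e1 : y + z + x = x + y + z := by ring
  have e2 : z + x + y = x + y + z := by ring
  unfold IsLocated
  rw [e1, e2]
  rcases h.near_sum with hs | hs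
  · obtain ⟨hw, hr⟩ := h.planarRelations.near_first hA hB hC hs
    rcases hr with ⟨h1, h2, h3⟩ | ⟨h1, h2, h3⟩ | ⟨h1, h2, h3⟩
    · exact Or.inl (Or.inl ⟨hw, h1, h2, h3⟩)
    · exact Or.inr (Or.inl (Or.inl ⟨hw, h1, h2, h3⟩))
    · exact Or.inr (Or.inr (Or.inl ⟨hw, h1, h2, h3⟩))
  · obtain ⟨hw, hr⟩ := h.planarRelations.near_second hA hB hC hs
    rcases hr with ⟨h1, h2, h3⟩ | ⟨h1, h2, h3⟩ | ⟨h1, h2, h3⟩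
    · exact Or.inl (Or.inr ⟨hw, h1, h2, h3⟩)
    · exact Or.inr (Or.inl (Or.inr ⟨hw, h1, h2, h3⟩))
    · exact Or.inr (Or.inr (Or.inr ⟨hw, h1, h2, h3⟩))

theorem invariants_of_im_nonneg (h : IsCoreSolution 1 y z u v) (hl : IsLocated 1 y z u)
    (hy : 0 ≤ y.im) :
    hadamardDefect (coreMatrix (coreSymbols 1 y z u v)) = 0 ∧
      (haagerupSet (coreMatrix (coreSymbols 1 y z u v))).ncard = 99 := by
  refine coreMatrix_invariants_of_approx rfl h.norm_coreSymbols h.isComplexHadamard ?_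
  rcases hl with ⟨hw, hA, hB, hC⟩ | ⟨hw, hA, hB, hC⟩
  · exact Or.inl (h.approxFirst hy hw hA hB hC)
  · exact Or.inr (h.approxSecond hy hw hA hB hC)

/-- Multiplying by the conjugate of `x` makes `x = 1`, and a conjugation, if needed, makes `y.im ≥
0`. Neither changes the defect or the size of the Haagerup set. -/
theorem invariants_of_isLocated (h : IsCoreSolution x y z u v) (hl : IsLocated x y z u) :
    hadamardDefect (coreMatrix (coreSymbols x y z u v)) = 0 ∧
      (haagerupSet (coreMatrix (coreSymbols x y z u v))).ncard = 99 := by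
  have ht : ‖(starRingEnd ℂ) x‖ = 1 := by rw [RCLike.norm_conj, h.hx]
  have hx := conj_mul_of_norm_one h.hx
  rw [← coreSymbols_smul ht]
  have h' := h.smul ht
  have hl' : IsLocated ((starRingEnd ℂ) x * x) ((starRingEnd ℂ) x * y) ((starRingEnd ℂ) x * z)
      ((starRingEnd ℂ) x * u) := by
    simpa only [IsLocated, ← mul_add, ip_mul_left ht] using hl
  rw [hx] at h' hl' ⊢
  generalize (starRingEnd ℂ) x * y = y at *
  generalize (starRingEnd ℂ) x * z = z at *
  generalize (starRingEnd ℂ) x * u = u at *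
  generalize (starRingEnd ℂ) x * v = v at *
  by_cases hy : 0 ≤ y.im
  · exact h'.invariants_of_im_nonneg hl' hy
  · have hc := h'.conj
    rw [map_one] at hc
    have hlc : IsLocated 1 ((starRingEnd ℂ) y) ((starRingEnd ℂ) z) ((starRingEnd ℂ) u) := by
      rw [← map_one (starRingEnd ℂ)]
      simpa only [IsLocated, ← map_add, ip_conj] using hl'
    have := hc.invariants_of_im_nonneg hlc (by rw [Complex.conj_im]; linarith)
    have e := coreMatrix_conj 1 y z u v
    rw [map_one] at e
    rwa [e, hadamardDefect_conjMatrix, ncard_haagerupSet_conjMatrix] at this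

/-- A rotation of `x, y, z` brings the Gram data into reference order, at the cost of an equivalence
of matrices. -/
theorem invariants (h : IsCoreSolution x y z u v) :
    hadamardDefect (coreMatrix (coreSymbols x y z u v)) = 0 ∧
      (haagerupSet (coreMatrix (coreSymbols x y z u v))).ncard = 99 := by
  have e1 := hadamardEquiv_coreMatrix_rotate x y z u v
  have e2 := hadamardEquiv_coreMatrix_rotate y z x u v
  rcases h.isLocated_rotation with hl | hl | hl
  · exact h.invariants_of_isLocated hl
  · rw [← e1.hadamardDefect_eq, ← e1.haagerupSet_eq]
    exact h.rotate.invariants_of_isLocated hl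
  · rw [← e1.hadamardDefect_eq, ← e1.haagerupSet_eq, ← e2.hadamardDefect_eq, ← e2.haagerupSet_eq]
    exact h.rotate.rotate.invariants_of_isLocated hl

end IsCoreSolution

/-! ### Existence by a contraction argument -/

/-- The real part of `(c + d I) * exp (τ I)`. -/
noncomputable def phaseWave (c d τ : ℝ) : ℝ := c * Real.cos τ - d * Real.sin τ

theorem ip_mul_exp {p q : ℂ} {c d : ℝ} (hc : ip p q = c) (hd : p.im * q.re - p.re * q.im = d)
    (s t : ℝ) : ip (p * Complex.exp (s * Complex.I)) (q * Complex.exp (t * Complex.I)) =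
      phaseWave c d (s - t) := by
  subst hc hd
  simp only [ip, phaseWave, Complex.mul_re, Complex.mul_im, Complex.exp_ofReal_mul_I_re,
    Complex.exp_ofReal_mul_I_im, Real.cos_sub, Real.sin_sub]
  ring

theorem phaseWave_zero (c d : ℝ) : phaseWave c d 0 = c := by simp [phaseWave]

/-- The derivative of `phaseWave` at `0` is `-d`, so this bounds the deviation from linearity. By
Cauchy–Schwarz the derivative of the remainder at `s` is at most `√(2 - 2 cos s) ≤ |s|`. -/
theorem abs_phaseWave_sub_le {c d ρ τ τ' : ℝ} (hcd : c ^ 2 + d ^ 2 = 1) (h : |τ| ≤ ρ)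
    (h' : |τ'| ≤ ρ) :
    |phaseWave c d τ - phaseWave c d τ' + d * (τ - τ')| ≤ ρ * |τ - τ'| := by
  have hder : ∀ s ∈ Set.Icc (-ρ) ρ, HasDerivWithinAt (fun s => phaseWave c d s + d * s)
      (c * -Real.sin s - d * Real.cos s + d * 1) (Set.Icc (-ρ) ρ) s := fun s _ =>
    ((((Real.hasDerivAt_cos s).const_mul c).sub ((Real.hasDerivAt_sin s).const_mul d)).add
      ((hasDerivAt_id s).const_mul d)).hasDerivWithinAt
  have hbd : ∀ s ∈ Set.Icc (-ρ) ρ, ‖c * -Real.sin s - d * Real.cos s + d * 1‖ ≤ ρ := by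
    intro s hs
    rw [Real.norm_eq_abs]
    refine le_trans (sq_le_sq.1 ?_) (abs_le.2 hs)
    have h1 := Real.sin_sq_add_cos_sq s
    have h2 := Real.one_sub_sq_div_two_le_cos (x := s)
    nlinarith [sq_nonneg (c * (Real.cos s - 1) - d * Real.sin s)]
  have := (convex_Icc (-ρ) ρ).norm_image_sub_le_of_norm_hasDerivWithin_le hder hbd
    (abs_le.1 h') (abs_le.1 h)
  rw [Real.norm_eq_abs, Real.norm_eq_abs] at this
  refine le_of_eq_of_le (congrArg _ ?_) this
  ring

/-- The four equations of `IsCoreSolution` near a rational base point, in angle coordinates. -/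
noncomputable def coreEquations (t : Fin 4 → ℝ) : Fin 4 → ℝ :=
  ![1 + phaseWave (-15453/16805) (-6604/16805) (0 - t 2) +
      phaseWave (-1009256/9494825) (-9441033/9494825) (t 1 - t 2) +
      phaseWave (-10788/11413) (3725/11413) (t 0 - t 1) +
      phaseWave (1210503/1244825) (-290296/1244825) (t 0 - t 3),
    1 + phaseWave (3606837/8486525) (7681916/8486525) (t 0 - t 2) +
      phaseWave (-15453/16805) (-6604/16805) (0 - t 2) +
      phaseWave (276/565) (493/565) (t 1 - 0) +
      phaseWave (-1386164/1392725) (-135027/1392725) (t 1 - t 3),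
    1 + phaseWave (3606837/8486525) (7681916/8486525) (t 0 - t 2) +
      phaseWave (-1009256/9494825) (-9441033/9494825) (t 1 - t 2) +
      phaseWave (-377/505) (336/505) (0 - t 0) +
      phaseWave (-1407/2465) (2024/2465) (0 - t 3),
    1 + phaseWave (-377/505) (336/505) (0 - t 0) +
      phaseWave (-10788/11413) (3725/11413) (t 0 - t 1) +
      phaseWave (276/565) (493/565) (t 1 - 0) +
      phaseWave (335035/1656973) (-1622748/1656973) (t 2 - t 3)]

/-- An approximate Newton step for `coreEquations`. -/
noncomputable def newtonStep (t : Fin 4 → ℝ) : Fin 4 → ℝ :=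
  ![t 0 - ((-39/100) * coreEquations t 0 + (-101/100) * coreEquations t 1 +
      (-3/10) * coreEquations t 2 + (-1/20) * coreEquations t 3),
    t 1 - ((37/100) * coreEquations t 0 + (-3/100) * coreEquations t 1 +
        (83/100) * coreEquations t 2 + (61/100) * coreEquations t 3),
    t 2 - ((-1/4) * coreEquations t 0 + (2/25) * coreEquations t 1 + (39/50) * coreEquations t 2 +
        (7/10) * coreEquations t 3),
    t 3 - ((-59/100) * coreEquations t 0 + (-1/4) * coreEquations t 1 +
        (21/100) * coreEquations t 2 + (-17/25) * coreEquations t 3)]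

/-- Replacing each wave difference by its linear part costs at most `δ / 25`. The rational matrix in
`newtonStep` nearly inverts the linear part, which leaves a contraction factor below `1 / 2`. -/
theorem abs_newtonStep_sub_le {t s : Fin 4 → ℝ} {δ : ℝ} (ht : ∀ i, |t i| ≤ 1 / 100)
    (hs : ∀ i, |s i| ≤ 1 / 100) (hδ : ∀ i, |t i - s i| ≤ δ) (i : Fin 4) :
    |newtonStep t i - newtonStep s i| ≤ 1 / 2 * δ := by
  have hz : |(0 : ℝ)| ≤ 1 / 100 := by norm_num
  have δ0 : 0 ≤ δ := (abs_nonneg _).trans (hδ 0)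
  have hz' : |(0 : ℝ) - 0| ≤ δ := by rwa [sub_self, abs_zero]
  have key : ∀ {c d a b a' b' : ℝ}, c ^ 2 + d ^ 2 = 1 → |a| ≤ 1 / 100 → |b| ≤ 1 / 100 →
      |a'| ≤ 1 / 100 → |b'| ≤ 1 / 100 → |a - a'| ≤ δ → |b - b'| ≤ δ →
      -(1 / 25 * δ) ≤ phaseWave c d (a - b) - phaseWave c d (a' - b') + d * ((a - b) - (a' - b')) ∧
      phaseWave c d (a - b) - phaseWave c d (a' - b') + d * ((a - b) - (a' - b')) ≤ 1 / 25 * δ := by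
    intro c d a b a' b' hcd ha hb ha' hb' h h'
    have h1 := abs_phaseWave_sub_le (ρ := 1 / 50) (τ := a - b) (τ' := a' - b') hcd
      ((abs_sub _ _).trans (by linarith)) ((abs_sub _ _).trans (by linarith))
    have h2 : |(a - b) - (a' - b')| ≤ 2 * δ := by
      rw [show (a - b) - (a' - b') = (a - a') - (b - b') by ring]
      exact (abs_sub _ _).trans (by linarith)
    rw [← abs_le]
    linarith
  have kxu := key (c := (-15453/16805)) (d := (-6604/16805)) (by norm_num) hz (ht 2)
    hz (hs 2) hz' (hδ 2)
  have kzu := key (c := (-1009256/9494825)) (d := (-9441033/9494825)) (by norm_num) (ht 1) (ht 2)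
    (hs 1) (hs 2) (hδ 1) (hδ 2)
  have kyz := key (c := (-10788/11413)) (d := (3725/11413)) (by norm_num) (ht 0) (ht 1)
    (hs 0) (hs 1) (hδ 0) (hδ 1)
  have kyv := key (c := (1210503/1244825)) (d := (-290296/1244825)) (by norm_num) (ht 0) (ht 3)
    (hs 0) (hs 3) (hδ 0) (hδ 3)
  have kyu := key (c := (3606837/8486525)) (d := (7681916/8486525)) (by norm_num) (ht 0) (ht 2)
    (hs 0) (hs 2) (hδ 0) (hδ 2)
  have kzx := key (c := (276/565)) (d := (493/565)) (by norm_num) (ht 1) hz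
    (hs 1) hz (hδ 1) hz'
  have kzv := key (c := (-1386164/1392725)) (d := (-135027/1392725)) (by norm_num) (ht 1) (ht 3)
    (hs 1) (hs 3) (hδ 1) (hδ 3)
  have kxy := key (c := (-377/505)) (d := (336/505)) (by norm_num) hz (ht 0)
    hz (hs 0) hz' (hδ 0)
  have kxv := key (c := (-1407/2465)) (d := (2024/2465)) (by norm_num) hz (ht 3)
    hz (hs 3) hz' (hδ 3)
  have kuv := key (c := (335035/1656973)) (d := (-1622748/1656973)) (by norm_num) (ht 2) (ht 3)
    (hs 2) (hs 3) (hδ 2) (hδ 3)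
  have d0 := abs_le.1 (hδ 0)
  have d1 := abs_le.1 (hδ 1)
  have d2 := abs_le.1 (hδ 2)
  have d3 := abs_le.1 (hδ 3)
  clear key
  rw [abs_le]
  fin_cases i <;>
  · simp only [newtonStep, coreEquations, Fin.zero_eta, Fin.mk_one, Fin.reduceFinMk,
        Matrix.cons_val]
    constructor <;> linarith [d0.1, d0.2, d1.1, d1.2, d2.1, d2.2, d3.1, d3.2, kxu.1, kxu.2, kzu.1,
        kzu.2, kyz.1, kyz.2, kyv.1, kyv.2, kyu.1, kyu.2, kzx.1, kzx.2, kzv.1, kzv.2, kxy.1, kxy.2,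
            kxv.1, kxv.2, kuv.1, kuv.2]

theorem abs_newtonStep_zero_le (i : Fin 4) : |newtonStep 0 i| ≤ 1 / 200 := by
  fin_cases i <;>
  · simp [newtonStep, coreEquations, phaseWave_zero]
    rw [abs_le]
    constructor <;> norm_num

/-- At a fixed point the correction vanishes, and the rational matrix applied to the equations is
invertible. -/
theorem coreEquations_eq_zero {t : Fin 4 → ℝ} (h : newtonStep t = t) (k : Fin 4) :
    coreEquations t k = 0 := by
  have h0 := congrFun h 0
  have h1 := congrFun h 1
  have h2 := congrFun h 2
  have h3 := congrFun h 3
  simp only [newtonStep, Matrix.cons_val] at h0 h1 h2 h3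
  fin_cases k <;> simp only [Fin.zero_eta, Fin.mk_one, Fin.reduceFinMk] <;> linarith

theorem exists_newtonStep_fixed : ∃ t, newtonStep t = t := by
  have hmem : ∀ {t : Fin 4 → ℝ}, t ∈ Metric.closedBall (0 : Fin 4 → ℝ) (1 / 100) →
      ∀ i, |t i| ≤ 1 / 100 := by
    intro t ht i
    rw [mem_closedBall_zero_iff] at ht
    exact (norm_le_pi_norm t i).trans ht
  have hsub : ∀ {t s : Fin 4 → ℝ}, t ∈ Metric.closedBall (0 : Fin 4 → ℝ) (1 / 100) →
      s ∈ Metric.closedBall (0 : Fin 4 → ℝ) (1 / 100) →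
      ∀ i, |newtonStep t i - newtonStep s i| ≤ 1 / 2 * dist t s := fun {t s} ht hs =>
    abs_newtonStep_sub_le (hmem ht) (hmem hs) fun i => by
      rw [dist_eq_norm]
      exact norm_le_pi_norm (t - s) i
  have h0 : (0 : Fin 4 → ℝ) ∈ Metric.closedBall (0 : Fin 4 → ℝ) (1 / 100) :=
    Metric.mem_closedBall_self (by norm_num)
  -- Contraction by `1 / 2` contributes at most `1 / 200`, and the displacement of the centre is at
  -- most `1 / 200`.
  have hmaps : Set.MapsTo newtonStep (Metric.closedBall 0 (1 / 100)) (Metric.closedBall 0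
      (1 / 100)) := by
    intro t ht
    rw [mem_closedBall_zero_iff, pi_norm_le_iff_of_nonneg (by norm_num)]
    intro i
    have h1 := hsub ht h0 i
    have h2 := abs_newtonStep_zero_le i
    have h3 := Metric.mem_closedBall.1 ht
    have h4 := abs_sub_abs_le_abs_sub (newtonStep t i) (newtonStep 0 i)
    rw [Real.norm_eq_abs]
    linarith
  obtain ⟨t, -, ht, -⟩ := ContractingWith.exists_fixedPoint' (K := 1 / 2)
    Metric.isClosed_closedBall.isComplete hmaps
    ⟨by rw [div_lt_one (by norm_num)]; norm_num, LipschitzWith.of_dist_le_mul fun t s => by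
      rw [Subtype.dist_eq, Subtype.dist_eq, dist_pi_le_iff (by positivity)]
      intro i
      have := hsub t.2 s.2 i
      simpa [Real.dist_eq] using this⟩ h0 (edist_ne_top _ _)
  exact ⟨t, ht⟩

theorem exists_isCoreSolution : ∃ x y z u v : ℂ, IsCoreSolution x y z u v := by
  obtain ⟨t, ht⟩ := exists_newtonStep_fixed
  have he := coreEquations_eq_zero ht
  have h0 := he 0
  have h1 := he 1
  have h2 := he 2
  have h3 := he 3
  simp only [coreEquations, Matrix.cons_val] at h0 h1 h2 h3
  have hn : ∀ (a b s : ℝ), a * a + b * b = 1 → ‖(⟨a, b⟩ : ℂ) * Complex.exp (s * Complex.I)‖ = 1 :=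
      by
    intro a b s h
    rw [norm_mul, Complex.norm_exp_ofReal_mul_I, mul_one, ← sq_eq_sq₀ (norm_nonneg _) zero_le_one,
      ← Complex.normSq_eq_norm_sq, Complex.normSq_mk, h, one_pow]
  -- The base points are rational points of the unit circle, so all inner products at the base are
  -- exact rationals. They lie near the first reference solution, up to rotation of `x, y, z`.
  refine ⟨(⟨1, 0⟩ : ℂ) * Complex.exp ((0 : ℝ) * Complex.I),
    (⟨-377/505, -336/505⟩ : ℂ) * Complex.exp ((t 0 : ℝ) * Complex.I),
    (⟨276/565, 493/565⟩ : ℂ) * Complex.exp ((t 1 : ℝ) * Complex.I),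
    (⟨-15453/16805, 6604/16805⟩ : ℂ) * Complex.exp ((t 2 : ℝ) * Complex.I),
    (⟨-1407/2465, -2024/2465⟩ : ℂ) * Complex.exp ((t 3 : ℝ) * Complex.I), hn _ _ _ (by norm_num),
    hn _ _ _ (by norm_num), hn _ _ _ (by norm_num), hn _ _ _ (by norm_num), hn _ _ _ (by norm_num),
    ?_, ?_, ?_, ?_⟩
  · rw [ip_mul_exp (c := -15453/16805) (d := -6604/16805) (by norm_num [ip]) (by norm_num),
      ip_mul_exp (c := -1009256/9494825) (d := -9441033/9494825) (by norm_num [ip]) (by norm_num),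
      ip_mul_exp (c := -10788/11413) (d := 3725/11413) (by norm_num [ip]) (by norm_num),
      ip_mul_exp (c := 1210503/1244825) (d := -290296/1244825) (by norm_num [ip]) (by norm_num)]
    exact h0
  · rw [ip_mul_exp (c := 3606837/8486525) (d := 7681916/8486525) (by norm_num [ip]) (by norm_num),
      ip_mul_exp (c := -15453/16805) (d := -6604/16805) (by norm_num [ip]) (by norm_num),
      ip_mul_exp (c := 276/565) (d := 493/565) (by norm_num [ip]) (by norm_num),
      ip_mul_exp (c := -1386164/1392725) (d := -135027/1392725) (by norm_num [ip]) (by norm_num)]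
    exact h1
  · rw [ip_mul_exp (c := 3606837/8486525) (d := 7681916/8486525) (by norm_num [ip]) (by norm_num),
      ip_mul_exp (c := -1009256/9494825) (d := -9441033/9494825) (by norm_num [ip]) (by norm_num),
      ip_mul_exp (c := -377/505) (d := 336/505) (by norm_num [ip]) (by norm_num),
      ip_mul_exp (c := -1407/2465) (d := 2024/2465) (by norm_num [ip]) (by norm_num)]
    exact h2
  · rw [ip_mul_exp (c := -377/505) (d := 336/505) (by norm_num [ip]) (by norm_num),
      ip_mul_exp (c := -10788/11413) (d := 3725/11413) (by norm_num [ip]) (by norm_num),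
      ip_mul_exp (c := 276/565) (d := 493/565) (by norm_num [ip]) (by norm_num),
      ip_mul_exp (c := 335035/1656973) (d := -1622748/1656973) (by norm_num [ip]) (by norm_num)]
    exact h3

theorem exists_isUnimodularY10ASolution : ∃ a b c d : ℂ, IsUnimodularY10ASolution a b c d := by
  obtain ⟨x, y, z, u, v, h⟩ := exists_isCoreSolution
  exact ⟨_, _, _, _, (isUnimodularY10ASolution_iff h.hx h.hy h.hz h.hu h.hv).2 h⟩

/-! ### Assembly of the theorem -/

theorem isSymm_y10A (a b c d : ℂ) : (y10A a b c d).IsSymm := by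
  unfold y10A y10AShape
  ext j k
  fin_cases j <;> fin_cases k <;> rfl

theorem y10A_zero_left (a b c d : ℂ) (k : Fin 10) : y10A a b c d 0 k = 1 := by
  fin_cases k <;> rfl

/-- The numbers `a, b, c, d` are themselves entries of the matrix. -/
theorem not_isButson_y10A {a b c d : ℂ} (h : IsUnimodularY10ASolution a b c d) {q : ℕ}
    (hq : 1 ≤ q) : ¬ IsButson q (y10A a b c d) := fun hB =>
  not_roots_of_unity (fun _ _ _ _ h => ratioSum_bound h) h hq (hB.2 1 4) (hB.2 6 9) (hB.2 1 7)
    (hB.2 9 9)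

theorem mainTheorem4 :
    (∃ a b c d : ℂ, IsUnimodularY10ASolution a b c d) ∧
    ∀ a b c d : ℂ, IsUnimodularY10ASolution a b c d →
      IsComplexHadamard (y10A a b c d) ∧
      (y10A a b c d).IsSymm ∧
      hadamardDefect (y10A a b c d) = 0 ∧
      IsIsolatedHadamard (y10A a b c d) ∧
      (∀ q : ℕ, 1 ≤ q → ¬ IsButson q (y10A a b c d)) ∧
      (haagerupSet (y10A a b c d)).ncard = 99 ∧
      (∀ K : Matrix (Fin 10) (Fin 10) ℂ, IsComplexHadamard K →
        ((∃ q : ℕ, 1 ≤ q ∧ IsButson q K) ∨ ¬ IsIsolatedHadamard K ∨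
          hadamardDefect K ≠ 0 ∨ (haagerupSet K).ncard ≠ 99) →
        ¬ HadamardEquiv (y10A a b c d) K) := by
  refine ⟨exists_isUnimodularY10ASolution, fun a b c d h => ?_⟩
  obtain ⟨hcore, he⟩ := hadamardEquiv_y10A h
  have hH : IsComplexHadamard (y10A a b c d) := he.isComplexHadamard hcore.isComplexHadamard
  have hd : hadamardDefect (y10A a b c d) = 0 := by
    rw [he.hadamardDefect_eq, hcore.invariants.1]
  have hn : (haagerupSet (y10A a b c d)).ncard = 99 := by
    rw [he.haagerupSet_eq, hcore.invariants.2]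
  have hB : ∀ q : ℕ, 1 ≤ q → ¬ IsButson q (y10A a b c d) := fun q hq => not_isButson_y10A h hq
  have hsymm := isSymm_y10A a b c d
  refine ⟨hH, hsymm, hd, isIsolatedHadamard_of_defect_eq_zero hH hd, hB, hn,
    fun K hK hcase hequiv => ?_⟩
  have hdK : hadamardDefect K = 0 := by rw [← hequiv.hadamardDefect_eq, hd]
  rcases hcase with ⟨q, hq, hKB⟩ | hiso | hdef | hcard
  -- A matrix equivalent to one of Butson type need not have root-of-unity entries, but `Y_{10A}` is
  -- dephased, so its entries lie in the common Haagerup set.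
  · refine hB q hq (isButson_of_haagerupSet hH (y10A_zero_left a b c d)
      (fun j => (hsymm.apply 0 j).trans (y10A_zero_left a b c d j)) ?_)
    rw [hequiv.haagerupSet_eq]
    exact haagerupSet_pow_of_isButson hKB
  · exact hiso (isIsolatedHadamard_of_defect_eq_zero hK hdK)
  · exact hdef hdK
  · exact hcard (by rw [← hequiv.haagerupSet_eq, hn])
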